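/- **Setting.** For a Coxeter matrix $M=(m_{st})_{s,t\in S}$ over an arbitrary set $S$ ($m_{ss}=1$, $m_{st}=m_{ts}\in\{2,3,\dots,\infty\}$ for $s\ne t$), let $A_M$ be the Artin group and $A_M^+$ the Artin monoid, both presented by the generators $S$ and the relations $\langle st\rangle^{m_{st}}=\langle ts\rangle^{m_{st}}$ for $m_{st}<\infty$, where $\langle st\rangle^{m}=sts\cdots$ has $m$ letters. The pair of $A_M$ and $A_M^+$, with the canonical map $A_M^+\to A_M$ and the canonical generators, is called the Artin group-monoid pair of $M$. $M$ is right-angled if $m_{st}\in\{2,\infty\}$ for $s\neq t$, and of finite type if its Coxeter group is finite. For a monoid $P$, a finite set $K\subset P$ and $R\subset P$, put $\Omega_K=\bigcap_{k\in K}(P\setminus kP)$ and let $$\mathcal A_R=\Big\{\bigsqcup_{j=1}^n p_j\Omega_{K_j} : n\ge 0,\ p_j\in P,\ K_j\subset R \text{ finite or empty}\Big\}$$ be the collection of all finite (possibly empty) disjoint unions of sets $p\Omega_K$. A collection of subsets of $P$ is an algebra if it is nonempty and closed under complements and finite unions. Let $P$ be a monoid, and let $\vee K\in P\cup\{\infty\}$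 be the least common right multiple of a finite set $K\subset P$ ($\infty$ if there is none). Let $X=\{X_p\}_{p\in P}$ be a compactly aligned product system of $C^*$-correspondences over a $C^*$-algebra $A=X_e$, $N:P\to(0,\infty)$ a homomorphism, $\beta\in\mathbb R$ and $\tau$ a tracial state of $A$. The induced trace is $\operatorname{Tr}_\tau^p(a)=\sup_H\sum_{\xi\in H}\tau(\langle\xi,a\xi\rangle)\in[0,\infty]$, over the finite $H\subset X_p$ with $\sum_{\xi\in H}\theta_{\xi,\xi}\le 1$. For $R\subset P$ consider the condition $$(\mathrm{Pos}_R)\qquad \tau(a)+\sum_{\emptyset\ne K\subset J}(-1)^{|K|}N(\vee K)^{-\beta}\operatorname{Tr}_\tau^{\vee K}(a)\ge 0\quad\text{for all } a\in A_+ \text{ and all finite } J\subset R,$$ where the terms with $\vee K=\infty$ are $0$ (and the inequality for $J=\{p\}$ is understood to include $\operatorname{Tr}^p_\tau(a)<\infty$). *Reduction of positivity to $R$ holds for $P$* if, for all $A,X,N,\beta,\tau$ as above, $(\mathrm{Pos}_{P\setminus\{e\}})$ holds if and only if $(\mathrm{Pos}_R)$ holds. **Theorem.** (a) Let $(G_1,P_1)$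 and $(G_2,P_2)$ be Artin group-monoid pairs with Coxeter matrices $M_1$, $M_2$ and canonical generating sets $P_a^1$, $P_a^2$, and suppose that $\mathcal A_{P_a^1}$ and $\mathcal A_{P_a^2}$ are algebras of subsets of $P_1$ and $P_2$. Let $P_a=P_a^1\cup P_a^2$, and let $(G,P)$ be either the free product $(G_1*G_2,P_1*P_2)$ or the direct product $(G_1\times G_2,P_1\times P_2)$. Then $(G,P)$, with the canonical generating set $P_a$, is the Artin group-monoid pair whose Coxeter matrix has diagonal blocks $M_1$, $M_2$ and all remaining entries equal to $\infty$ (free product) or $2$ (direct product); $P_a$ is the set of atoms of $P$; $\mathcal A_{P_a}$ is an algebra of subsets of $P$; and reduction of positivity to the generators $P_a$ holds for $P$. (b) There are $M_1$ and $M_2$ over finite sets, each right-angled or of finite type, satisfying the hypotheses of (a), such that the Coxeter matrices of the free product and of the direct product are both neither right-angled nor of finite type. Hence there are Artin monoids that are neither right-angled nor of finite type for which reduction of positivity to generators holds. -/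

import Mathlib

open MulOpposite
open scoped ENNReal

universe u u₁ u₂ v w

/-! ## Artin groups and Artin monoids

Coxeter matrices are Mathlib's `CoxeterMatrix`; the entry `0` encodes `∞`. -/

/-- The alternating word `s t s ⋯` of length `n`, starting with `s`. -/
def altWord {B : Type u} (s t : B) : ℕ → List B
  | 0 => []
  | n + 1 => s :: altWord t s n

/-- The braid relations `⟨s t⟩^{m_{st}} = ⟨t s⟩^{m_{ts}}`, one for each pair with `m_{st} < ∞`. -/
def artinRel {B : Type u} (M : CoxeterMatrix B) (x y : FreeMonoid B) : Prop :=
  ∃ s t : B, M s t ≠ 0 ∧ x = FreeMonoid.ofList (altWord s t (M s t)) ∧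
    y = FreeMonoid.ofList (altWord t s (M t s))

/-- The Artin monoid `A_M⁺`. -/
abbrev ArtinMonoid {B : Type u} (M : CoxeterMatrix B) : Type u :=
  PresentedMonoid (artinRel M)

/-- The value in the free group of a positive word. -/
def groupWord {B : Type u} (l : List B) : FreeGroup B := (l.map FreeGroup.of).prod

/-- The Artin group `A_M`, with the same generators and relations as `A_M⁺`. -/
abbrev ArtinGroup {B : Type u} (M : CoxeterMatrix B) : Type u :=
  PresentedGroup {r : FreeGroup B | ∃ s t : B, M s t ≠ 0 ∧
    r = groupWord (altWord s t (M s t)) * (groupWord (altWord t s (M t s)))⁻¹}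

/-- The canonical generators of the Artin monoid. -/
def artinGen {B : Type u} (M : CoxeterMatrix B) (b : B) : ArtinMonoid M :=
  PresentedMonoid.of (artinRel M) b

/-- The canonical generators of the Artin group. -/
def artinGroupGen {B : Type u} (M : CoxeterMatrix B) (b : B) : ArtinGroup M :=
  PresentedGroup.of b

theorem lift_artinGroupGen_ofList {B : Type u} (M : CoxeterMatrix B) (l : List B) :
    FreeMonoid.lift (artinGroupGen M) (FreeMonoid.ofList l) =
      PresentedGroup.mk _ (groupWord l) := by
  rw [FreeMonoid.lift_apply, groupWord, map_list_prod, List.map_map]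
  rfl

/-- The canonical homomorphism `A_M⁺ → A_M`, the identity on generators. -/
def artinToGroup {B : Type u} (M : CoxeterMatrix B) : ArtinMonoid M →* ArtinGroup M :=
  PresentedMonoid.lift (artinGroupGen M) (by
    rintro x y ⟨s, t, h, rfl, rfl⟩
    rw [lift_artinGroupGen_ofList, lift_artinGroupGen_ofList]
    rw [← mul_inv_eq_one, ← map_inv, ← map_mul]
    exact PresentedGroup.one_of_mem ⟨s, t, h, rfl⟩)

/-- `κ : P → G`, together with the family `s` of elements of `P`, is the Artin group-monoid pair of
the Coxeter matrix `M` with its canonical generators. -/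
def IsArtinPair {B : Type u} (M : CoxeterMatrix B) {G : Type u₁} {P : Type u₂} [Group G] [Monoid P]
    (κ : P →* G) (s : B → P) : Prop :=
  ∃ (eP : ArtinMonoid M ≃* P) (eG : ArtinGroup M ≃* G),
    (∀ b, eP (artinGen M b) = s b) ∧ ∀ x, eG (artinToGroup M x) = κ (eP x)

/-- The Coxeter matrix with diagonal blocks `M₁`, `M₂` and all remaining entries equal to `c`. -/
def blockCoxeter {B₁ : Type u₁} {B₂ : Type u₂} (M₁ : CoxeterMatrix B₁) (M₂ : CoxeterMatrix B₂)
    (c : ℕ) (hc : c ≠ 1) : CoxeterMatrix (B₁ ⊕ B₂) where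
  M := Matrix.fromBlocks M₁.M (Matrix.of fun _ _ => c) (Matrix.of fun _ _ => c) M₂.M
  isSymm := Matrix.IsSymm.fromBlocks M₁.isSymm rfl M₂.isSymm
  diagonal := by rintro (i | i) <;> simp
  off_diagonal := by
    rintro (i | i) (j | j) h
    · simpa using M₁.off_diagonal i j (fun e => h (by rw [e]))
    · simpa using hc
    · simpa using hc
    · simpa using M₂.off_diagonal i j (fun e => h (by rw [e]))

/-- The matrix of the free product: the off-diagonal blocks are `∞`. -/
def freeCoxeter {B₁ : Type u₁} {B₂ : Type u₂} (M₁ : CoxeterMatrix B₁) (M₂ : CoxeterMatrix B₂) :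
    CoxeterMatrix (B₁ ⊕ B₂) := blockCoxeter M₁ M₂ 0 (by decide)

/-- The matrix of the direct product: the off-diagonal blocks are `2`. -/
def directCoxeter {B₁ : Type u₁} {B₂ : Type u₂} (M₁ : CoxeterMatrix B₁) (M₂ : CoxeterMatrix B₂) :
    CoxeterMatrix (B₁ ⊕ B₂) := blockCoxeter M₁ M₂ 2 (by decide)

/-- The canonical generators of the free product, `P_a = P_a¹ ∪ P_a²`. -/
def freeGen {B₁ : Type u₁} {B₂ : Type u₂} (M₁ : CoxeterMatrix B₁) (M₂ : CoxeterMatrix B₂) :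
    B₁ ⊕ B₂ → Monoid.Coprod (ArtinMonoid M₁) (ArtinMonoid M₂) :=
  Sum.elim (fun b => Monoid.Coprod.inl (artinGen M₁ b)) (fun b => Monoid.Coprod.inr (artinGen M₂ b))

/-- The canonical generators of the direct product, `P_a = P_a¹ ∪ P_a²`. -/
def directGen {B₁ : Type u₁} {B₂ : Type u₂} (M₁ : CoxeterMatrix B₁) (M₂ : CoxeterMatrix B₂) :
    B₁ ⊕ B₂ → ArtinMonoid M₁ × ArtinMonoid M₂ :=
  Sum.elim (fun b => (artinGen M₁ b, 1)) (fun b => (1, artinGen M₂ b))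

/-- Right-angled: all off-diagonal entries are `2` or `∞`. -/
def IsRightAngled {B : Type u} (M : CoxeterMatrix B) : Prop :=
  ∀ s t : B, s ≠ t → M s t = 2 ∨ M s t = 0

/-- Finite type: the Coxeter group is finite. -/
def IsFiniteType {B : Type u} (M : CoxeterMatrix B) : Prop := Finite M.Group

/-! ## Subsets of a monoid

In a monoid, Mathlib's `p ∣ q` is `∃ q', q = p * q'`, that is, `q ∈ pP`. -/

/-- `Ω_K = ⋂_{k ∈ K} (P \ kP)`. -/
def omegaSet {P : Type u} [Monoid P] (K : Finset P) : Set P := {x | ∀ k ∈ K, ¬ k ∣ x}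

/-- `pΩ_K`. -/
def mulOmega {P : Type u} [Monoid P] (p : P) (K : Finset P) : Set P :=
  (fun x => p * x) '' omegaSet K

/-- The collection `𝒜_R` of all finite (or empty) disjoint unions of sets `pΩ_K` with `p ∈ P` and
`K ⊆ R` finite or empty. -/
def omegaCollection {P : Type u} [Monoid P] (R : Set P) : Set (Set P) :=
  {U | ∃ (n : ℕ) (p : Fin n → P) (K : Fin n → Finset P), (∀ j, (K j : Set P) ⊆ R) ∧
    Pairwise (fun i j => Disjoint (mulOmega (p i) (K i)) (mulOmega (p j) (K j))) ∧
    U = ⋃ j, mulOmega (p j) (K j)}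

/-- `r` is a right LCM of `U`. -/
def IsRightLCM {P : Type u} [Monoid P] (U : Set P) (r : P) : Prop :=
  (∀ p ∈ U, p ∣ r) ∧ ∀ r', (∀ p ∈ U, p ∣ r') → r ∣ r'

/-! ## C⋆-correspondences

Mathlib's `CStarModule C E` is compatible with a *left* action of `C` on `E`, so a right Hilbert
`A`-module is a `CStarModule Aᵐᵒᵖ E`; the right action is `ξ a = op a • ξ`, and the `A`-valued inner
product (conjugate linear in the first variable) is recovered by `unop`. -/

/-- A C⋆-correspondence over `A`: a right Hilbert `A`-module with a left action of `A` by a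
⋆-homomorphism into the adjointable operators. -/
structure Correspondence (A : Type v) [NonUnitalCStarAlgebra A] [PartialOrder A]
    [StarOrderedRing A] where
  carrier : Type w
  [normedAddCommGroup : NormedAddCommGroup carrier]
  [normedSpace : NormedSpace ℂ carrier]
  [completeSpace : CompleteSpace carrier]
  [rightSMul : SMul Aᵐᵒᵖ carrier]
  [cstarModule : CStarModule Aᵐᵒᵖ carrier]
  left : A →ₙₐ[ℂ] (carrier →L[ℂ] carrier)
  left_adjoint : ∀ (a : A) (x y : carrier),
    inner Aᵐᵒᵖ (left a x) y = inner Aᵐᵒᵖ x (left (star a) y)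

namespace Correspondence

variable {A : Type v} [NonUnitalCStarAlgebra A] [PartialOrder A] [StarOrderedRing A]

instance : CoeSort (Correspondence.{v, w} A) (Type w) := ⟨carrier⟩

attribute [instance] normedAddCommGroup normedSpace completeSpace rightSMul cstarModule

variable (E : Correspondence.{v, w} A)

/-- The `A`-valued inner product `⟨x, y⟩`. -/
def ip (x y : E) : A := unop (inner Aᵐᵒᵖ x y)

/-- The right action `x a`. -/
def rmul (x : E) (a : A) : E := op a • x

theorem ip_rmul (x y : E) (a : A) : E.ip x (E.rmul y a) = E.ip x y * a := by
  simp [ip, rmul]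

theorem ext_ip {x y : E} (h : ∀ z, E.ip z x = E.ip z y) : x = y := by
  rw [← sub_eq_zero, ← CStarModule.inner_self (A := Aᵐᵒᵖ), CStarModule.inner_sub_right,
    sub_eq_zero]
  exact unop_injective (h (x - y))

theorem norm_rmul_le (x : E) (a : A) : ‖E.rmul x a‖ ≤ ‖x‖ * ‖a‖ := by
  refine le_of_sq_le_sq ?_ (by positivity)
  rw [CStarModule.norm_sq_eq Aᵐᵒᵖ, rmul, CStarModule.inner_op_smul_right,
    CStarModule.inner_op_smul_left, mul_pow, CStarModule.norm_sq_eq Aᵐᵒᵖ (x := x)]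
  calc ‖op a * (inner Aᵐᵒᵖ x x * star (op a))‖
      ≤ ‖op a‖ * (‖inner Aᵐᵒᵖ x x‖ * ‖star (op a)‖) :=
        (norm_mul_le _ _).trans (by gcongr; exact norm_mul_le _ _)
    _ = ‖inner Aᵐᵒᵖ x x‖ * ‖a‖ ^ 2 := by rw [norm_star, norm_op]; ring

/-- The rank-one operator `θ_{x,y} z = x ⟨y, z⟩`. -/
noncomputable def theta (x y : E) : E →L[ℂ] E :=
  LinearMap.mkContinuous
    { toFun := fun z => E.rmul x (E.ip y z)
      map_add' := fun z z' => E.ext_ip fun t => by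
        rw [ip_rmul]
        simp only [ip, rmul, CStarModule.inner_add_right, CStarModule.inner_op_smul_right,
          unop_add, unop_mul, unop_op, mul_add]
      map_smul' := fun c z => E.ext_ip fun t => by
        rw [ip_rmul]
        simp only [ip, rmul, CStarModule.inner_smul_right_complex,
          CStarModule.inner_op_smul_right, unop_smul, unop_mul, unop_op, mul_smul_comm,
          RingHom.id_apply] }
    (‖x‖ * ‖y‖) fun z => by
      refine (E.norm_rmul_le x _).trans ?_
      rw [mul_assoc]
      gcongr
      exact CStarModule.norm_inner_le (A := Aᵐᵒᵖ) E

/-- The generalised compact operators `𝒦(E)`: the closed linear span of the operators `θ_{x,y}`. -/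
noncomputable def compacts : Submodule ℂ (E →L[ℂ] E) :=
  (Submodule.span ℂ (Set.range fun q : E × E => E.theta q.1 q.2)).topologicalClosure

/-- The condition `∑_{ξ ∈ H} θ_{ξ,ξ} ≤ 1` in the C⋆-algebra of adjointable operators on `E`. -/
def SubIdentity (H : Finset E) : Prop :=
  ∀ y : E, E.ip y ((∑ ξ ∈ H, E.theta ξ ξ) y) ≤ E.ip y y

/-- The induced trace `Tr_τ^E(T) = sup_H ∑_{ξ ∈ H} τ(⟨ξ, T ξ⟩) ∈ [0, ∞]`, for `T ≥ 0`, over all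
finite `H ⊆ E` with `∑_{ξ ∈ H} θ_{ξ,ξ} ≤ 1`. -/
noncomputable def inducedTrace (τ : A →L[ℂ] ℂ) (T : E →L[ℂ] E) : ℝ≥0∞ :=
  ⨆ (H : Finset E) (_ : E.SubIdentity H), ∑ ξ ∈ H, ENNReal.ofReal (τ (E.ip ξ (T ξ))).re

end Correspondence

/-- A tracial state of a C⋆-algebra. -/
structure IsTracialState {A : Type v} [NonUnitalCStarAlgebra A] [PartialOrder A]
    (τ : A →L[ℂ] ℂ) : Prop where
  nonneg : ∀ a, 0 ≤ a → 0 ≤ (τ a).re ∧ (τ a).im = 0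
  norm_eq_one : ‖τ‖ = 1
  tracial : ∀ a b, τ (a * b) = τ (b * a)

/-! ## Product systems -/

/-- A product system over `P` of C⋆-correspondences over `A`, with `X_e = A`. The multiplication
`X_p × X_q → X_r` is given for every `r` equal to `p q`. The fields `ip_mul` and `dense_mul` say that
`ξ ⊗ ζ ↦ ξ ζ` extends to an isometric isomorphism of `X_p ⊗_A X_q` onto `X_{pq}`: the inner product
of the interior tensor product is `⟨ξ ⊗ ζ, ξ' ⊗ ζ'⟩ = ⟨ζ, ⟨ξ, ξ'⟩ ζ'⟩`. -/
structure ProductSystem (P : Type u) [Monoid P] (A : Type v) [NonUnitalCStarAlgebra A]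
    [PartialOrder A] [StarOrderedRing A] where
  fib : P → Correspondence.{v, w} A
  /-- The identification of `A` with `X_e`. -/
  unitEquiv : A ≃ₗ[ℂ] fib 1
  ip_unit : ∀ a b, (fib 1).ip (unitEquiv a) (unitEquiv b) = star a * b
  rmul_unit : ∀ a b, (fib 1).rmul (unitEquiv a) b = unitEquiv (a * b)
  left_unit : ∀ a b, (fib 1).left a (unitEquiv b) = unitEquiv (a * b)
  mul : ∀ {p q r : P}, p * q = r → (fib p →ₗ[ℂ] fib q →ₗ[ℂ] fib r)
  mul_assoc : ∀ {p q r pq qr pqr : P} (h₁ : p * q = pq) (h₂ : pq * r = pqr) (h₃ : q * r = qr)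
    (h₄ : p * qr = pqr) (x : fib p) (y : fib q) (z : fib r),
    mul h₂ (mul h₁ x y) z = mul h₄ x (mul h₃ y z)
  unit_mul : ∀ (p : P) (a : A) (x : fib p), mul (one_mul p) (unitEquiv a) x = (fib p).left a x
  mul_unit : ∀ (p : P) (x : fib p) (a : A), mul (mul_one p) x (unitEquiv a) = (fib p).rmul x a
  ip_mul : ∀ {p q r : P} (h : p * q = r), p ≠ 1 → ∀ (x x' : fib p) (y y' : fib q),
    (fib r).ip (mul h x y) (mul h x' y') = (fib q).ip y ((fib q).left ((fib p).ip x x') y')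
  dense_mul : ∀ {p q r : P} (h : p * q = r), p ≠ 1 →
    Dense (Submodule.span ℂ {z : fib r | ∃ (x : fib p) (y : fib q), z = mul h x y} : Set (fib r))

namespace ProductSystem

variable {P : Type u} [Monoid P] {A : Type v} [NonUnitalCStarAlgebra A] [PartialOrder A]
  [StarOrderedRing A] (X : ProductSystem.{u, v, w} P A)

/-- For `p q = r`, the operator `S'` on `X_r` is `S ⊗ I` on `X_p ⊗_A X_q ≅ X_r`. -/
def IsAmplification {p q r : P} (h : p * q = r) (S : X.fib p →L[ℂ] X.fib p)
    (S' : X.fib r →L[ℂ] X.fib r) : Prop :=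
  ∀ (x : X.fib p) (y : X.fib q), S' (X.mul h x y) = X.mul h (S x) y

/-- Compact alignment: `ι_p^r(𝒦(X_p)) ι_q^r(𝒦(X_q)) ⊆ 𝒦(X_r)` whenever `pP ∩ qP = rP`. Here
`ι_p^r(S)` is the amplification of `S`, which is unique for `p ≠ e`. If `p = e` or `q = e`, the
condition holds automatically (`𝒦(X_r)` is an ideal, and `ι_e^r` is the left action of `A`). -/
def IsCompactlyAligned : Prop :=
  ∀ p q r : P, p ≠ 1 → q ≠ 1 → {x | p ∣ x} ∩ {x | q ∣ x} = {x | r ∣ x} →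
    ∀ (p' q' : P) (hp : p * p' = r) (hq : q * q' = r),
    ∀ S ∈ (X.fib p).compacts, ∀ T ∈ (X.fib q).compacts,
    ∀ S' T' : X.fib r →L[ℂ] X.fib r, X.IsAmplification hp S S' → X.IsAmplification hq T T' →
      S' ∘L T' ∈ (X.fib r).compacts

open Classical in
/-- The summand `(-1)^{|K|} N(∨K)^{-β} Tr_τ^{∨K}(a)`, which is `0` if `∨K = ∞`. -/
noncomputable def lcmTerm (N : P →* ℝ) (β : ℝ) (τ : A →L[ℂ] ℂ) (K : Finset P) (a : A) : EReal :=
  if h : ∃ r, IsRightLCM (K : Set P) r then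
    (((-1) ^ K.card * N h.choose ^ (-β) : ℝ) : EReal) *
      ((X.fib h.choose).inducedTrace τ ((X.fib h.choose).left a) : EReal)
  else 0

/-- The positivity condition for all finite subsets of `R`:
`τ(a) + ∑_{∅ ≠ K ⊆ J} (-1)^{|K|} N(∨K)^{-β} Tr_τ^{∨K}(a) ≥ 0` for all finite `J ⊆ R`, `a ∈ A₊`.
The sum is taken in `[-∞, ∞]`, where `∞ + (-∞) = -∞`; so the inequality for `J = {p}` forces
`Tr_τ^p(a) < ∞`. -/
def Positivity (N : P →* ℝ) (β : ℝ) (τ : A →L[ℂ] ℂ) (R : Set P) : Prop :=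
  ∀ J : Finset P, (J : Set P) ⊆ R → ∀ a : A, 0 ≤ a →
    0 ≤ ((τ a).re : EReal) + ∑ K ∈ J.powerset with K.Nonempty, X.lcmTerm N β τ K a

end ProductSystem

/-- Reduction of the positivity condition to the subset `S` of `P`: for every compactly aligned
product system over `P`, every homomorphism `N : P → (0, ∞)`, every `β ∈ ℝ` and every tracial state,
positivity for all finite subsets of `P \ {e}` is equivalent to positivity for those of `S`. -/
def ReductionOfPositivity (P : Type u) [Monoid P] (S : Set P) : Prop :=
  ∀ (A : Type v) [NonUnitalCStarAlgebra A] [PartialOrder A] [StarOrderedRing A]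
    (X : ProductSystem.{u, v, w} P A), X.IsCompactlyAligned →
    ∀ N : P →* ℝ, (∀ p, 0 < N p) → ∀ (β : ℝ) (τ : A →L[ℂ] ℂ), IsTracialState τ →
      (X.Positivity N β τ {p | p ≠ 1} ↔ X.Positivity N β τ S)

/-! Reduction. Send the basis vector [q] of the real vector space on P to the indicator of qP. In a
left cancellative monoid graded by a length this map is injective, and inclusion-exclusion maps ∑_{K
⊆ J} (-1)^{|K|} [∨K] to the indicator of Ω_J. If 𝒜_R is an algebra, then for every finite J ⊆ P the
set Ω_J is a disjoint union of sets p_jΩ_{K_j} with K_j ⊆ R, so the alternating sum of J is the sum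
of the p_j-translates of those of the K_j (`IsGradedLCMMonoid.lcmSum_eq_sum`). It remains to see
that positivity survives left translation.

Translation. Tr^{pq}(a) is the supremum of ∑_{ξ ∈ H} Tr^q(⟨ξ, aξ⟩) over the finite families H in X_p
whose creation operators satisfy ∑ L_ξ L_ξ^* ≤ 1 on every X_{pq}. Such a family can be enlarged
until D = 1 - ∑ L_ξ L_ξ^* is small at prescribed vectors: adjoining ξ = Dz replaces the defect g =
⟨z, Dz⟩ at z by g - g². One family thus serves finitely many q at once, and a combination of the
Tr^q that is positive on A₊ can be evaluated at the positive elements ⟨ξ, aξ⟩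
(`ProductSystem.sum_fibTrace_mul_nonneg`). The same formula bounds all traces by those at the
generators (`ProductSystem.fibTrace_le`), so everything is finite. `reductionOfPositivity` combines
these facts.

Algebras. By `isSetAlgebra_of_residuals` it suffices to find a family T of members of 𝒜_R that
contains all Ω_K with K ⊆ R and is stable, for generators s, under V ↦ {x | sx ∈ V} and V ↦ V \ sP.
For a direct product T consists of rectangles; for a free product, of the sets given by conditions
on the heads of an element in the two factors, at least one of which is 1. The two factors of the
example in (b), of type A₂ and free of rank two, are treated by the same criterion.

Artin monoids. The argument needs left cancellation and least common multiples of pairs that have a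
common one. Both follow from the statement that sa = tb with s ≠ t forces a common factor Δ, the
alternating product of s and t of length m_{st} (`headRel_of_gen_mul_eq`). This is proved by
induction on length, and its transitivity along a chain of words is reduced to the Coxeter group by
Matsumoto's theorem (`IsReducedElt.ext`) and bounded joins in the weak order
(`CoxeterMatrix.exists_weak_join`); both rest on the fact that every root of the geometric
representation has a sign. Free and direct products are Artin monoids of block matrices, so they
inherit these properties. -/

/-! ## The geometric representation of a Coxeter group -/

namespace CoxeterMatrix

variable {B : Type u} (M : CoxeterMatrix B)

/-- The number `2 cos (π / m_{st})`, with value `2` for `m_{st} = ∞`. -/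
noncomputable def bond (s t : B) : ℝ :=
  if M s t = 0 then 2 else 2 * Real.cos (Real.pi / M s t)

theorem bond_comm (s t : B) : M.bond s t = M.bond t s := by
  simp only [bond, M.symmetric s t]

theorem bond_self (s : B) : M.bond s s = -2 := by
  simp [bond]

/-- The simple coroot of `s`, as a linear functional. -/
noncomputable def coroot (s : B) : (B →₀ ℝ) →ₗ[ℝ] ℝ :=
  Finsupp.linearCombination ℝ fun t => -M.bond s t

/-- The simple root of `s`. -/
noncomputable def simpleRoot (_M : CoxeterMatrix B) (s : B) : B →₀ ℝ := Finsupp.single s 1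

theorem coroot_simpleRoot (s t : B) : M.coroot s (M.simpleRoot t) = -M.bond s t := by
  simp [coroot, simpleRoot]

/-- The simple reflection of `s`. -/
noncomputable def simpleReflection (s : B) : Module.End ℝ (B →₀ ℝ) :=
  LinearMap.id - (M.coroot s).smulRight (M.simpleRoot s)

theorem simpleReflection_apply (s : B) (v : B →₀ ℝ) :
    M.simpleReflection s v = v - M.coroot s v • M.simpleRoot s := rfl

theorem simpleReflection_simpleRoot (s t : B) :
    M.simpleReflection s (M.simpleRoot t) = M.simpleRoot t + M.bond s t • M.simpleRoot s := by
  rw [simpleReflection_apply, coroot_simpleRoot, neg_smul, sub_neg_eq_add]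

theorem simpleReflection_simpleRoot_self (s : B) :
    M.simpleReflection s (M.simpleRoot s) = -M.simpleRoot s := by
  rw [simpleReflection_simpleRoot, bond_self]; module

/-- The sequence `sin (j θ) / sin θ`, where `c = 2 cos θ`. -/
def chebSeq (c : ℝ) : ℕ → ℝ
  | 0 => 0
  | 1 => 1
  | n + 2 => c * chebSeq c (n + 1) - chebSeq c n

theorem chebSeq_two_mul_cos (θ : ℝ) : ∀ n : ℕ,
    chebSeq (2 * Real.cos θ) n * Real.sin θ = Real.sin (n * θ)
  | 0 => by simp [chebSeq]
  | 1 => by simp [chebSeq]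
  | n + 2 => by
    have h1 := chebSeq_two_mul_cos θ n
    have h2 := chebSeq_two_mul_cos θ (n + 1)
    have e1 : ((n + 2 : ℕ) : ℝ) * θ = ((n + 1 : ℕ) : ℝ) * θ + θ := by push_cast; ring
    have e2 : (n : ℝ) * θ = ((n + 1 : ℕ) : ℝ) * θ - θ := by push_cast; ring
    rw [e2, Real.sin_sub] at h1
    rw [e1, Real.sin_add, chebSeq, sub_mul, mul_assoc, h2, h1]
    ring

theorem chebSeq_two : ∀ n : ℕ, chebSeq 2 n = n
  | 0 => by simp [chebSeq]
  | 1 => by simp [chebSeq]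
  | n + 2 => by
    rw [chebSeq, chebSeq_two n, chebSeq_two (n + 1)]; push_cast; ring

theorem two_le_of_ne {s t : B} (h : s ≠ t) (h0 : M s t ≠ 0) : 2 ≤ M s t := by
  have := M.off_diagonal s t h
  omega

theorem sin_pos_of_two_le {m : ℕ} (h : 2 ≤ m) : 0 < Real.sin (Real.pi / m) := by
  have h2 : (2 : ℝ) ≤ m := by exact_mod_cast h
  apply Real.sin_pos_of_pos_of_lt_pi (by positivity)
  exact div_lt_self Real.pi_pos (by linarith)

/-- For θ = π/m the value is sin(kθ)/sin θ, and kθ stays in [0, π] as long as k ≤ m. For m = ∞ the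
value is k. -/
theorem chebSeq_bond_nonneg {s t : B} (h : s ≠ t) {k : ℕ} (hk : M s t = 0 ∨ k ≤ M s t) :
    0 ≤ chebSeq (M.bond s t) k := by
  by_cases h0 : M s t = 0
  · simp [bond, h0, chebSeq_two]
  · have hk : k ≤ M s t := by tauto
    have hs := sin_pos_of_two_le (M.two_le_of_ne h h0)
    have hc := chebSeq_two_mul_cos (Real.pi / M s t) k
    simp only [bond, h0, if_false]
    have hm : (0 : ℝ) < M s t := by positivity
    have : 0 ≤ Real.sin (k * (Real.pi / M s t)) := by
      apply Real.sin_nonneg_of_nonneg_of_le_pi (by positivity)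
      have : (k : ℝ) ≤ M s t := by exact_mod_cast hk
      calc (k : ℝ) * (Real.pi / M s t) ≤ M s t * (Real.pi / M s t) := by gcongr
        _ = Real.pi := by field_simp
    rw [← hc] at this
    exact nonneg_of_mul_nonneg_left this hs

/-- In the plane of the two roots each reflection advances the recursion of `chebSeq` by one step,
so a product of two advances it by two. -/
theorem reflection_pair_pow_apply {s t : B} (j : ℕ) :
    ((M.simpleReflection s * M.simpleReflection t) ^ j) (M.simpleRoot s) =
      chebSeq (M.bond s t) (2 * j + 1) • M.simpleRoot s +
        chebSeq (M.bond s t) (2 * j) • M.simpleRoot t := by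
  induction j with
  | zero => simp [chebSeq]
  | succ j ih =>
    rw [pow_succ', Module.End.mul_apply, ih, map_add, map_smul, map_smul, Module.End.mul_apply,
      Module.End.mul_apply, simpleReflection_simpleRoot_self, simpleReflection_simpleRoot, map_add,
      map_neg, map_smul, simpleReflection_simpleRoot_self, simpleReflection_simpleRoot,
      M.bond_comm t s]
    have e1 : chebSeq (M.bond s t) (2 * (j + 1)) =
      M.bond s t * chebSeq (M.bond s t) (2 * j + 1) - chebSeq (M.bond s t) (2 * j) := rfl
    have e2 : chebSeq (M.bond s t) (2 * (j + 1) + 1) =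
      M.bond s t * chebSeq (M.bond s t) (2 * (j + 1)) - chebSeq (M.bond s t) (2 * j + 1) := rfl
    rw [e2, e1]
    module

theorem simpleReflection_mul_self (s : B) :
    M.simpleReflection s * M.simpleReflection s = 1 := by
  refine LinearMap.ext fun v => ?_
  rw [Module.End.mul_apply, simpleReflection_apply M s v, map_sub, map_smul,
    simpleReflection_simpleRoot_self, simpleReflection_apply]
  simp

theorem reflection_pair_pow_fix {s t : B} (v : B →₀ ℝ) (hs : M.coroot s v = 0)
    (ht : M.coroot t v = 0) (j : ℕ) :
    ((M.simpleReflection s * M.simpleReflection t) ^ j) v = v := by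
  induction j with
  | zero => simp
  | succ j ih =>
    rw [pow_succ', Module.End.mul_apply, ih, Module.End.mul_apply, simpleReflection_apply M t, ht,
      simpleReflection_apply]
    simp [hs]

/-- For s ≠ t and m finite the plane of the two simple roots is a complement of the common kernel of
the two coroots. The product of the reflections has order dividing m on the plane and is the
identity on the kernel. -/
theorem reflection_pair_pow_eq_one (s t : B) :
    (M.simpleReflection s * M.simpleReflection t) ^ M s t = 1 := by
  by_cases hst : s = t
  · subst hst; rw [simpleReflection_mul_self, one_pow]
  by_cases h0 : M s t = 0
  · rw [h0, pow_zero]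
  have hs := sin_pos_of_two_le (M.two_le_of_ne hst h0)
  have hm : (M s t : ℝ) ≠ 0 := by exact_mod_cast h0
  have hb : M.bond s t = 2 * Real.cos (Real.pi / M s t) := by simp [bond, h0]
  have c0 : chebSeq (M.bond s t) (2 * M s t) = 0 := by
    have := chebSeq_two_mul_cos (Real.pi / M s t) (2 * M s t)
    rw [← hb] at this
    have e : ((2 * M s t : ℕ) : ℝ) * (Real.pi / M s t) = 2 * Real.pi := by push_cast; field_simp
    rw [e, Real.sin_two_pi] at this
    exact (mul_eq_zero.mp this).resolve_right hs.ne'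
  have c1 : chebSeq (M.bond s t) (2 * M s t + 1) = 1 := by
    have := chebSeq_two_mul_cos (Real.pi / M s t) (2 * M s t + 1)
    rw [← hb] at this
    have e : ((2 * M s t + 1 : ℕ) : ℝ) * (Real.pi / M s t) =
      Real.pi / M s t + 2 * Real.pi := by push_cast; field_simp; ring
    rw [e, Real.sin_add_two_pi] at this
    exact mul_right_cancel₀ hs.ne' (this.trans (one_mul _).symm)
  have hα : ((M.simpleReflection s * M.simpleReflection t) ^ M s t) (M.simpleRoot s) =
      M.simpleRoot s := by
    rw [reflection_pair_pow_apply, c0, c1]; simp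
  -- The power of ts fixes the root of t by the previous computation with s and t exchanged, and it
  -- is inverse to the power of st.
  have hα' : ((M.simpleReflection s * M.simpleReflection t) ^ M s t) (M.simpleRoot t) =
      M.simpleRoot t := by
    have h2 : ((M.simpleReflection t * M.simpleReflection s) ^ M s t) (M.simpleRoot t) =
        M.simpleRoot t := by
      rw [reflection_pair_pow_apply, ← M.bond_comm s t, c0, c1]; simp
    have h3 : ((M.simpleReflection s * M.simpleReflection t) ^ M s t *
        (M.simpleReflection t * M.simpleReflection s) ^ M s t) = 1 := by
      have hc : (M.simpleReflection t * M.simpleReflection s) *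
          (M.simpleReflection s * M.simpleReflection t) = 1 := by
        rw [mul_assoc, ← mul_assoc (M.simpleReflection s) (M.simpleReflection s),
          simpleReflection_mul_self, one_mul, simpleReflection_mul_self]
      have hc' : (M.simpleReflection s * M.simpleReflection t) *
          (M.simpleReflection t * M.simpleReflection s) = 1 := by
        rw [mul_assoc, ← mul_assoc (M.simpleReflection t) (M.simpleReflection t),
          simpleReflection_mul_self, one_mul, simpleReflection_mul_self]
      rw [← Commute.mul_pow (hc'.trans hc.symm), hc', one_pow]
    conv_lhs => rw [← h2]
    rw [← Module.End.mul_apply, h3, Module.End.one_apply]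
  refine LinearMap.ext fun v => ?_
  -- subtract the component of `v` in the plane of the two simple roots
  set c := M.bond s t with hcdef
  -- This is the determinant of the Gram matrix with rows (2, -c) and (-c, 2), equal to 4 sin²(π/m);
  -- `p` and `q` below come from Cramer's rule.
  have hd : 4 - c ^ 2 ≠ 0 := by
    rw [hb, mul_pow]
    have := Real.sin_sq_add_cos_sq (Real.pi / M s t)
    nlinarith
  set x := M.coroot s v
  set y := M.coroot t v
  set p := (2 * x + c * y) / (4 - c ^ 2)
  set q := (2 * y + c * x) / (4 - c ^ 2)
  set v' := v - p • M.simpleRoot s - q • M.simpleRoot t with hv'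
  have e1 : M.coroot s v' = 0 := by
    rw [hv', map_sub, map_sub, map_smul, map_smul, coroot_simpleRoot, coroot_simpleRoot, bond_self]
    change x - p * (- -2) - q * (- c) = 0
    simp only [p, q]; field_simp; ring
  have e2 : M.coroot t v' = 0 := by
    rw [hv', map_sub, map_sub, map_smul, map_smul, coroot_simpleRoot, coroot_simpleRoot, bond_self,
      M.bond_comm t s]
    change y - p * (- c) - q * (- -2) = 0
    simp only [p, q]; field_simp; ring
  have hv : v = v' + p • M.simpleRoot s + q • M.simpleRoot t := by rw [hv']; abel
  rw [hv, map_add, map_add, map_smul, map_smul, hα, hα', M.reflection_pair_pow_fix v' e1 e2]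
  rfl

/-- The geometric representation of the Coxeter group. -/
noncomputable def geomRep : M.Group →* Module.End ℝ (B →₀ ℝ) :=
  M.toCoxeterSystem.lift ⟨M.simpleReflection, M.reflection_pair_pow_eq_one⟩

theorem geomRep_simple (s : B) : M.geomRep (M.simple s) = M.simpleReflection s := by
  rw [← M.toCoxeterSystem_simple]
  exact CoxeterSystem.lift_apply_simple _ M.reflection_pair_pow_eq_one s

theorem geomRep_inv_apply (w : M.Group) (v : B →₀ ℝ) : M.geomRep w⁻¹ (M.geomRep w v) = v := by
  rw [← Module.End.mul_apply, ← map_mul, inv_mul_cancel, map_one, Module.End.one_apply]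

theorem geomRep_apply_ne_zero (w : M.Group) (s : B) : M.geomRep w (M.simpleRoot s) ≠ 0 := by
  intro h
  have := M.geomRep_inv_apply w (M.simpleRoot s)
  rw [h, map_zero, simpleRoot] at this
  exact Finsupp.single_ne_zero.mpr one_ne_zero this.symm

end CoxeterMatrix

/-! ## Alternating words -/

theorem length_altWord {B : Type u} (s t : B) : ∀ n, (altWord s t n).length = n
  | 0 => rfl
  | n + 1 => by rw [altWord, List.length_cons, length_altWord t s n]

theorem exists_altWord_add {B : Type u} (s t : B) (a b : ℕ) :
    ∃ l : List B, l.length = b ∧ altWord s t (a + b) = altWord s t a ++ l := by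
  induction a generalizing s t with
  | zero => exact ⟨altWord s t b, length_altWord s t b, by simp [altWord]⟩
  | succ a ih =>
    obtain ⟨l, hl, h⟩ := ih t s
    exact ⟨l, hl, by rw [Nat.add_right_comm, altWord, h, altWord, List.cons_append]⟩

theorem map_altWord {B : Type u} {C : Type v} (f : B → C) (s t : B) (n : ℕ) :
    (altWord s t n).map f = altWord (f s) (f t) n := by
  induction n generalizing s t with
  | zero => rfl
  | succ n ih => rw [altWord, altWord, List.map_cons, ih]

/-- `CoxeterSystem.alternatingWord` prescribes the last letter and `altWord` the first. -/
theorem reverse_alternatingWord {B : Type u} (s t : B) (n : ℕ) :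
    (CoxeterSystem.alternatingWord t s n).reverse = altWord s t n := by
  induction n generalizing s t with
  | zero => rfl
  | succ n ih =>
    rw [CoxeterSystem.alternatingWord_succ, List.concat_eq_append, List.reverse_append, ih]
    rfl

/-! ### Word length in the Coxeter group and signs of roots -/

namespace CoxeterMatrix

variable {B : Type u} (M : CoxeterMatrix B)

/-- The word length of an element of the Coxeter group. -/
noncomputable def len (w : M.Group) : ℕ := M.toCoxeterSystem.length w

theorem len_mul_le (x y : M.Group) : M.len (x * y) ≤ M.len x + M.len y :=
  M.toCoxeterSystem.length_mul_le x y

theorem len_eq_zero {w : M.Group} : M.len w = 0 ↔ w = 1 := M.toCoxeterSystem.length_eq_zero_iff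

theorem exists_simple_mul_lt {w : M.Group} (hw : w ≠ 1) :
    ∃ s, M.len (M.simple s * w) < M.len w := by
  obtain ⟨t, ht⟩ := M.toCoxeterSystem.exists_leftDescent_of_ne_one hw
  rw [CoxeterSystem.IsLeftDescent, M.toCoxeterSystem_simple] at ht
  exact ⟨t, ht⟩

theorem len_simple (s : B) : M.len (M.simple s) = 1 := by
  rw [← M.toCoxeterSystem_simple]; exact M.toCoxeterSystem.length_simple s

theorem len_simple_mul (w : M.Group) (s : B) :
    M.len (M.simple s * w) = M.len w + 1 ∨ M.len (M.simple s * w) + 1 = M.len w := by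
  rw [← M.toCoxeterSystem_simple]; exact M.toCoxeterSystem.length_simple_mul w s

theorem simple_mul_simple (s : B) (w : M.Group) : M.simple s * (M.simple s * w) = w := by
  rw [← M.toCoxeterSystem_simple]; exact M.toCoxeterSystem.simple_mul_simple_cancel_left s

theorem simple_inv (s : B) : (M.simple s)⁻¹ = M.simple s := by
  rw [← M.toCoxeterSystem_simple]; exact M.toCoxeterSystem.inv_simple s

/-- The product of a word in the Coxeter group. -/
noncomputable def wordVal (l : List B) : M.Group := (l.map M.simple).prod

theorem wordVal_nil : M.wordVal [] = 1 := rfl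

theorem wordVal_cons (s : B) (l : List B) : M.wordVal (s :: l) = M.simple s * M.wordVal l := by
  simp [wordVal]

theorem wordVal_append (l l' : List B) : M.wordVal (l ++ l') = M.wordVal l * M.wordVal l' := by
  simp [wordVal]

theorem wordVal_eq_wordProd (l : List B) : M.wordVal l = M.toCoxeterSystem.wordProd l := by
  rw [wordVal, CoxeterSystem.wordProd, M.toCoxeterSystem_simple]

theorem len_wordVal_le (l : List B) : M.len (M.wordVal l) ≤ l.length := by
  rw [wordVal_eq_wordProd]; exact M.toCoxeterSystem.length_wordProd_le l

theorem exists_reduced_word (w : M.Group) : ∃ l : List B, M.wordVal l = w ∧ l.length = M.len w := by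
  obtain ⟨l, hl, rfl⟩ := M.toCoxeterSystem.exists_isReduced w
  exact ⟨l, M.wordVal_eq_wordProd l, hl.symm⟩

/-- The alternating product `s t s ⋯` with `n` factors in the Coxeter group. -/
noncomputable abbrev altProd (s t : B) (n : ℕ) : M.Group := M.wordVal (altWord s t n)

theorem altProd_succ (s t : B) (n : ℕ) :
    M.altProd s t (n + 1) = M.simple s * M.altProd t s n := M.wordVal_cons _ _

theorem len_altProd_le (s t : B) (n : ℕ) : M.len (M.altProd s t n) ≤ n :=
  (M.len_wordVal_le _).trans_eq (length_altWord s t n)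

theorem altProd_braid (s t : B) : M.altProd s t (M s t) = M.altProd t s (M s t) := by
  have h := M.toCoxeterSystem.wordProd_braidWord_eq t s
  rw [CoxeterSystem.braidWord, CoxeterSystem.braidWord, M.symmetric t s] at h
  rw [altProd, altProd, wordVal_eq_wordProd, wordVal_eq_wordProd, ← reverse_alternatingWord,
    ← reverse_alternatingWord, CoxeterSystem.wordProd_reverse, CoxeterSystem.wordProd_reverse, h]

theorem exists_altProd_add (s t : B) (a b : ℕ) :
    ∃ x, M.len x ≤ b ∧ M.altProd s t (a + b) = M.altProd s t a * x := by
  obtain ⟨l, hl, h⟩ := exists_altWord_add s t a b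
  exact ⟨M.wordVal l, (M.len_wordVal_le l).trans_eq hl, by rw [altProd, h, wordVal_append]⟩

/-- Peel off t, s, t, … while they are left descents. The letter just removed is no longer a
descent, so the process can only stop when neither letter is one; `v` is then the shortest element
of the coset ⟨s, t⟩w. -/
theorem exists_strip (n : ℕ) : ∀ (w : M.Group) (s t : B), M.len w ≤ n →
    M.len w < M.len (M.simple s * w) → ∃ k v, w = M.altProd t s k * v ∧ M.len w = k + M.len v ∧
      M.len v < M.len (M.simple s * v) ∧ M.len v < M.len (M.simple t * v) := by
  induction n with
  | zero =>
    intro w s t hn hs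
    refine ⟨0, w, by simp [altWord, wordVal], by simp, hs, ?_⟩
    rcases M.len_simple_mul w t with h | h <;> omega
  | succ n ih =>
    intro w s t hn hs
    rcases M.len_simple_mul w t with h | h
    · exact ⟨0, w, by simp [altWord, wordVal], by simp, hs, by omega⟩
    · obtain ⟨k, v, hv, hl, h1, h2⟩ := ih (M.simple t * w) t s (by omega)
        (by rw [simple_mul_simple]; omega)
      refine ⟨k + 1, v, ?_, by omega, h2, h1⟩
      rw [altProd_succ, mul_assoc, ← hv, simple_mul_simple]

/-- One reflection turns the coefficients (c_j, c_{j+1}) into (c_{j+1}, c_{j+2}) and exchanges the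
roles of the two roots; `x` and `y` record the outcome, which depends on the parity of `k`. -/
theorem geomRep_altProd_inv (k : ℕ) : ∀ (s t : B) (j : ℕ),
    ∃ x y, (x = s ∧ y = t ∨ x = t ∧ y = s) ∧ M.geomRep (M.altProd s t k)⁻¹
      (chebSeq (M.bond s t) j • M.simpleRoot s + chebSeq (M.bond s t) (j + 1) • M.simpleRoot t) =
      chebSeq (M.bond s t) (j + k) • M.simpleRoot x +
        chebSeq (M.bond s t) (j + k + 1) • M.simpleRoot y := by
  induction k with
  | zero => exact fun s t j => ⟨s, t, by simp, by simp [altWord, wordVal]⟩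
  | succ k ih =>
    intro s t j
    obtain ⟨x, y, hxy, h⟩ := ih t s (j + 1)
    refine ⟨x, y, by tauto, ?_⟩
    rw [M.bond_comm t s] at h
    rw [altProd_succ, mul_inv_rev, map_mul, Module.End.mul_apply, simple_inv, geomRep_simple,
      map_add, map_smul, map_smul, simpleReflection_simpleRoot_self, simpleReflection_simpleRoot]
    have e : chebSeq (M.bond s t) (j + 1 + 1) =
      M.bond s t * chebSeq (M.bond s t) (j + 1) - chebSeq (M.bond s t) j := rfl
    rw [show j + (k + 1) = j + 1 + k by ring, ← h, e]
    congr 1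
    module

theorem geomRep_altProd_inv_simpleRoot (k : ℕ) (s t : B) :
    ∃ x y, (x = s ∧ y = t ∨ x = t ∧ y = s) ∧ M.geomRep (M.altProd s t k)⁻¹ (M.simpleRoot t) =
      chebSeq (M.bond s t) k • M.simpleRoot x + chebSeq (M.bond s t) (k + 1) • M.simpleRoot y := by
  simpa [chebSeq] using M.geomRep_altProd_inv k s t 0

/-- Strip the alternating prefix of length k, so that w = (t s ⋯) v. Its inverse takes the root of s
to a combination of the two simple roots with coefficients of the form sin(kθ)/sin θ, nonnegative
because k < m, and the inverse of the shorter element v keeps both simple roots nonnegative by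
induction. -/
theorem geomRep_inv_nonneg (n : ℕ) : ∀ (w : M.Group) (s : B), M.len w ≤ n →
    M.len w < M.len (M.simple s * w) → 0 ≤ M.geomRep w⁻¹ (M.simpleRoot s) := by
  induction n with
  | zero =>
    intro w s hn hs
    have : w = 1 := M.len_eq_zero.mp (by omega)
    subst this
    simp [simpleRoot]
  | succ n ih =>
    intro w s hn hs
    by_cases hw : w = 1
    · subst hw; simp [simpleRoot]
    obtain ⟨t, ht⟩ := M.exists_simple_mul_lt hw
    have hst : s ≠ t := by rintro rfl; omega
    obtain ⟨k, v, hv, hl, h1, h2⟩ := M.exists_strip _ w s t le_rfl hs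
    have hk : k ≠ 0 := by
      rintro rfl
      simp only [altProd, altWord, wordVal_nil, one_mul] at hv
      subst hv; omega
    -- A prefix of length at least m could be rewritten by the braid relation to begin with s, and
    -- then s would be a left descent of w.
    have hkm : M s t = 0 ∨ k < M s t := by
      by_contra! hc
      obtain ⟨h0, hc⟩ := hc
      obtain ⟨x, hx, e⟩ := M.exists_altProd_add t s (M s t) (k - M s t)
      obtain ⟨m, hm⟩ := Nat.exists_eq_succ_of_ne_zero h0
      rw [Nat.add_sub_cancel' hc] at e
      rw [e, ← altProd_braid, hm, altProd_succ] at hv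
      have : M.len (M.simple s * w) ≤ m + (k - M s t) + M.len v := by
        rw [hv, mul_assoc, mul_assoc, simple_mul_simple, ← mul_assoc]
        refine (M.len_mul_le _ _).trans (Nat.add_le_add_right ((M.len_mul_le _ _).trans ?_) _)
        exact Nat.add_le_add (M.len_altProd_le _ _ _) hx
      omega
    have i1 := ih v s (by omega) h1
    have i2 := ih v t (by omega) h2
    obtain ⟨x, y, hxy, e⟩ := M.geomRep_altProd_inv_simpleRoot k t s
    rw [M.bond_comm t s] at e
    rw [hv, mul_inv_rev, map_mul, Module.End.mul_apply, e, map_add, map_smul, map_smul]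
    have c1 := M.chebSeq_bond_nonneg hst (k := k) (by omega)
    have c2 := M.chebSeq_bond_nonneg hst (k := k + 1) (by omega)
    rcases hxy with ⟨rfl, rfl⟩ | ⟨rfl, rfl⟩
    · exact add_nonneg (smul_nonneg c1 i2) (smul_nonneg c2 i1)
    · exact add_nonneg (smul_nonneg c1 i1) (smul_nonneg c2 i2)

theorem geomRep_inv_nonneg_of_lt {w : M.Group} {s : B} (h : M.len w < M.len (M.simple s * w)) :
    0 ≤ M.geomRep w⁻¹ (M.simpleRoot s) := M.geomRep_inv_nonneg _ w s le_rfl h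

theorem geomRep_inv_nonpos_of_lt {w : M.Group} {s : B} (h : M.len (M.simple s * w) < M.len w) :
    M.geomRep w⁻¹ (M.simpleRoot s) ≤ 0 := by
  have := M.geomRep_inv_nonneg_of_lt (w := M.simple s * w) (s := s) (by rwa [simple_mul_simple])
  rw [mul_inv_rev, map_mul, Module.End.mul_apply, simple_inv, geomRep_simple,
    simpleReflection_simpleRoot_self, map_neg] at this
  exact neg_nonneg.mp this

theorem len_lt_of_nonneg {w : M.Group} {s : B} (h : 0 ≤ M.geomRep w⁻¹ (M.simpleRoot s)) :
    M.len w < M.len (M.simple s * w) := by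
  by_contra hc
  have h' := M.geomRep_inv_nonpos_of_lt (w := w) (s := s) (by
    rcases M.len_simple_mul w s with e | e <;> omega)
  exact M.geomRep_apply_ne_zero w⁻¹ s (le_antisymm h' h)

theorem len_lt_of_nonpos {w : M.Group} {s : B} (h : M.geomRep w⁻¹ (M.simpleRoot s) ≤ 0) :
    M.len (M.simple s * w) < M.len w := by
  by_contra hc
  have h' := M.geomRep_inv_nonneg_of_lt (w := w) (s := s) (by
    rcases M.len_simple_mul w s with e | e <;> omega)
  exact M.geomRep_apply_ne_zero w⁻¹ s (le_antisymm h h')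

/-- Every new letter lengthens the word, since the root that decides this is a nonnegative
combination of two simple roots up to length m. -/
theorem len_altProd {s t : B} (hst : s ≠ t) (k : ℕ) (hk : M s t = 0 ∨ k ≤ M s t) :
    M.len (M.altProd s t k) = k := by
  induction k generalizing s t with
  | zero => exact M.len_eq_zero.mpr rfl
  | succ k ih =>
    have h1 := ih hst.symm (by rw [M.symmetric t s]; omega)
    rw [altProd_succ]
    have : M.len (M.altProd t s k) < M.len (M.simple s * M.altProd t s k) := by
      apply len_lt_of_nonneg
      obtain ⟨x, y, hxy, e⟩ := M.geomRep_altProd_inv_simpleRoot k t s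
      rw [M.bond_comm t s] at e
      rw [e]
      have c1 := M.chebSeq_bond_nonneg hst (k := k) (by omega)
      have c2 := M.chebSeq_bond_nonneg hst (k := k + 1) (by omega)
      have p : ∀ z, 0 ≤ M.simpleRoot z := fun z => by simp [simpleRoot]
      exact add_nonneg (smul_nonneg c1 (p _)) (smul_nonneg c2 (p _))
    rcases M.len_simple_mul (M.altProd t s k) s with e | e <;> omega

/-- If `s ≠ t` are left descents of `w`, then `w` is a reduced product with the longest element of
the parabolic subgroup of `s` and `t`. -/
theorem exists_eq_altProd_mul {w : M.Group} {s t : B} (hst : s ≠ t)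
    (hs : M.len (M.simple s * w) < M.len w) (ht : M.len (M.simple t * w) < M.len w) :
    M s t ≠ 0 ∧ ∃ v, w = M.altProd s t (M s t) * v ∧ M.len w = M s t + M.len v := by
  obtain ⟨k, v, hv, hl, h1, h2⟩ := M.exists_strip _ (M.simple s * w) s t le_rfl
    (by rwa [simple_mul_simple])
  have hw : w = M.altProd s t (k + 1) * v := by
    rw [altProd_succ, mul_assoc, ← hv, simple_mul_simple]
  have hlw : M.len w = k + 1 + M.len v := by
    rcases M.len_simple_mul w s with e | e <;> omega
  -- With a shorter alternating prefix the image of the root of t would still be nonnegative, and t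
  -- would not be a descent.
  have hkm : ¬ (M s t = 0 ∨ k + 1 < M s t) := by
    intro hkm
    obtain ⟨x, y, hxy, e⟩ := M.geomRep_altProd_inv_simpleRoot (k + 1) s t
    have c1 := M.chebSeq_bond_nonneg hst (k := k + 1) (by omega)
    have c2 := M.chebSeq_bond_nonneg hst (k := k + 1 + 1) (by omega)
    have i1 := M.geomRep_inv_nonneg_of_lt h1
    have i2 := M.geomRep_inv_nonneg_of_lt h2
    have := M.len_lt_of_nonneg (w := w) (s := t) (by
      rw [hw, mul_inv_rev, map_mul, Module.End.mul_apply, e, map_add, map_smul, map_smul]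
      rcases hxy with ⟨rfl, rfl⟩ | ⟨rfl, rfl⟩
      · exact add_nonneg (smul_nonneg c1 i1) (smul_nonneg c2 i2)
      · exact add_nonneg (smul_nonneg c1 i2) (smul_nonneg c2 i1))
    omega
  push Not at hkm
  obtain ⟨h0, hkm⟩ := hkm
  obtain ⟨x, hx, e⟩ := M.exists_altProd_add s t (M s t) (k + 1 - M s t)
  rw [Nat.add_sub_cancel' hkm] at e
  refine ⟨h0, x * v, by rw [hw, e, mul_assoc], ?_⟩
  have a1 := M.len_mul_le x v
  have a2 := M.len_mul_le (M.altProd s t (M s t)) (x * v)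
  have a3 := M.len_altProd_le s t (M s t)
  rw [← mul_assoc, ← e, ← hw] at a2
  omega

end CoxeterMatrix

/-- In a relation graded by `rk`, upper bounds of pairs of covers that have joins yield joins of all
bounded pairs. -/
theorem exists_join_of_covers {α : Type u} (r cov : α → α → Prop) (rk : α → ℕ)
    (refl : ∀ x, r x x) (trans : ∀ x y z, r x y → r y z → r x z)
    (mono : ∀ x y, r x y → rk x ≤ rk y) (hcov : ∀ z x, cov z x → r z x ∧ rk z < rk x)
    (hex : ∀ z u, r z u → z ≠ u → ∃ x, cov z x ∧ r x u)
    (hloc : ∀ z x y w, cov z x → cov z y → r x w → r y w →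
      ∃ j, r x j ∧ r y j ∧ ∀ w', r x w' → r y w' → r j w')
    (n : ℕ) : ∀ z u v w, rk w ≤ n + rk z → r z u → r z v → r u w → r v w →
      ∃ j, r u j ∧ r v j ∧ ∀ w', r u w' → r v w' → r j w' := by
  induction n with
  | zero =>
    intro z u v w hn hzu hzv huw hvw
    by_cases e : z = u
    · subst e; exact ⟨v, hzv, refl v, fun w' _ h => h⟩
    · obtain ⟨x, hx, hxu⟩ := hex z u hzu e
      have := (hcov z x hx).2
      have := mono x w (trans _ _ _ hxu huw)
      omega
  | succ n ih =>
    intro z u v w hn hzu hzv huw hvw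
    by_cases e : z = u
    · subst e; exact ⟨v, hzv, refl v, fun w' _ h => h⟩
    by_cases e' : z = v
    · subst e'; exact ⟨u, refl u, hzu, fun w' h _ => h⟩
    obtain ⟨x, hx, hxu⟩ := hex z u hzu e
    obtain ⟨y, hy, hyv⟩ := hex z v hzv e'
    have lx := (hcov z x hx).2
    have ly := (hcov z y hy).2
    -- With `j` the join of the two covers, take p = u ∨ j above x, q = v ∨ j above y, and finally p
    -- ∨ q above x. Each join is over a base of larger rank than z, so the induction hypothesis
    -- applies.
    obtain ⟨j, hxj, hyj, hj⟩ :=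
      hloc z x y w hx hy (trans _ _ _ hxu huw) (trans _ _ _ hyv hvw)
    have hjw := hj w (trans _ _ _ hxu huw) (trans _ _ _ hyv hvw)
    obtain ⟨p, hup, hjp, hp⟩ := ih x u j w (by omega) hxu hxj huw hjw
    obtain ⟨q, hvq, hjq, hq⟩ := ih y v j w (by omega) hyv hyj hvw hjw
    obtain ⟨k, hpk, hqk, hk⟩ := ih x p q w (by omega) (trans _ _ _ hxu hup)
      (trans _ _ _ hxj hjq) (hp w huw hjw) (hq w hvw hjw)
    refine ⟨k, trans _ _ _ hup hpk, trans _ _ _ hvq hqk, fun w' h h' => ?_⟩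
    have hjw' := hj w' (trans _ _ _ hxu h) (trans _ _ _ hyv h')
    exact hk w' (hp w' h hjw') (hq w' h' hjw')

/-! ### The weak order and inversions -/

namespace CoxeterMatrix

variable {B : Type u} (M : CoxeterMatrix B)

/-- The left-divisibility weak order on the Coxeter group. -/
def WeakLE (x y : M.Group) : Prop := M.len y = M.len x + M.len (x⁻¹ * y)

variable {M}

theorem WeakLE.refl (x : M.Group) : M.WeakLE x x := by
  simp [WeakLE, M.len_eq_zero.mpr rfl]

theorem WeakLE.len_le {x y : M.Group} (h : M.WeakLE x y) : M.len x ≤ M.len y := by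
  rw [h]; omega

theorem WeakLE.trans {x y z : M.Group} (h : M.WeakLE x y) (h' : M.WeakLE y z) : M.WeakLE x z := by
  have e : x⁻¹ * z = (x⁻¹ * y) * (y⁻¹ * z) := by group
  have h1 := M.len_mul_le (x⁻¹ * y) (y⁻¹ * z)
  have h2 := M.len_mul_le x (x⁻¹ * z)
  rw [mul_inv_cancel_left] at h2
  rw [← e] at h1
  unfold WeakLE at *
  omega

theorem weakLE_mul_iff {x y : M.Group} : M.WeakLE x (x * y) ↔ M.len (x * y) = M.len x + M.len y := by
  rw [WeakLE, inv_mul_cancel_left]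

theorem one_weakLE (x : M.Group) : M.WeakLE 1 x := by
  simp [WeakLE, M.len_eq_zero.mpr rfl]

theorem simple_weakLE_iff {s : B} {w : M.Group} :
    M.WeakLE (M.simple s) w ↔ M.len (M.simple s * w) < M.len w := by
  rw [WeakLE, simple_inv, len_simple]
  rcases M.len_simple_mul w s with h | h <;> omega

theorem weakLE_simple_mul_iff {s : B} {x y : M.Group} (hx : M.len x < M.len (M.simple s * x))
    (hy : M.len y < M.len (M.simple s * y)) :
    M.WeakLE (M.simple s * x) (M.simple s * y) ↔ M.WeakLE x y := by
  have e : (M.simple s * x)⁻¹ * (M.simple s * y) = x⁻¹ * y := by group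
  rw [WeakLE, WeakLE, e]
  rcases M.len_simple_mul x s with h | h <;> rcases M.len_simple_mul y s with h' | h' <;> omega

theorem WeakLE.simple_mul {s : B} {x y : M.Group} (h : M.WeakLE x y)
    (hx : M.len (M.simple s * x) < M.len x) :
    M.len (M.simple s * y) < M.len y ∧ M.WeakLE (M.simple s * x) (M.simple s * y) := by
  have hy := simple_weakLE_iff.mp ((simple_weakLE_iff.mpr hx).trans h)
  refine ⟨hy, ?_⟩
  rwa [← weakLE_simple_mul_iff (s := s) (by rwa [simple_mul_simple]) (by rwa [simple_mul_simple]),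
    simple_mul_simple, simple_mul_simple]

variable (M) in
/-- A root of the geometric representation. -/
def IsRoot (β : B →₀ ℝ) : Prop := ∃ (x : M.Group) (t : B), β = M.geomRep x (M.simpleRoot t)

theorem isRoot_simpleRoot (s : B) : M.IsRoot (M.simpleRoot s) := ⟨1, s, by simp⟩

theorem IsRoot.nonneg_or_nonpos {β : B →₀ ℝ} (h : M.IsRoot β) : 0 ≤ β ∨ β ≤ 0 := by
  obtain ⟨x, t, rfl⟩ := h
  rw [← inv_inv x]
  rcases M.len_simple_mul x⁻¹ t with h | h
  · exact Or.inl (M.geomRep_inv_nonneg_of_lt (by omega))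
  · exact Or.inr (M.geomRep_inv_nonpos_of_lt (by omega))

theorem IsRoot.simpleReflection {β : B →₀ ℝ} (h : M.IsRoot β) (s : B) :
    M.IsRoot (M.simpleReflection s β) := by
  obtain ⟨x, t, rfl⟩ := h
  exact ⟨M.simple s * x, t, by rw [map_mul, Module.End.mul_apply, geomRep_simple]⟩

/-- The reflection changes only the coordinate at s. Any other nonzero coordinate stays positive,
and a root with a positive coordinate is nonnegative. -/
theorem IsRoot.simpleReflection_nonneg {β : B →₀ ℝ} (h : M.IsRoot β) (hβ : 0 ≤ β) (s : B) :
    β = β s • M.simpleRoot s ∨ 0 ≤ M.simpleReflection s β := by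
  by_cases hc : ∃ t, t ≠ s ∧ β t ≠ 0
  · obtain ⟨t, hts, ht⟩ := hc
    right
    refine (h.simpleReflection s).nonneg_or_nonpos.resolve_right fun hn => ht ?_
    have h1 := hn t
    rw [simpleReflection_apply] at h1
    simp only [simpleRoot, Finsupp.coe_sub, Finsupp.coe_smul, Pi.sub_apply, Pi.smul_apply,
      Finsupp.single_eq_of_ne hts, smul_zero, sub_zero] at h1
    exact le_antisymm h1 (hβ t)
  · left
    push Not at hc
    ext t
    by_cases e : t = s
    · subst e; simp [simpleRoot]
    · simp [simpleRoot, Finsupp.single_eq_of_ne e, hc t e]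

theorem geomRep_simple_mul_inv (s : B) (w : M.Group) (v : B →₀ ℝ) :
    M.geomRep (M.simple s * w)⁻¹ v = M.geomRep w⁻¹ (M.simpleReflection s v) := by
  rw [mul_inv_rev, map_mul, Module.End.mul_apply, simple_inv, geomRep_simple]

theorem simpleReflection_simpleReflection (s : B) (v : B →₀ ℝ) :
    M.simpleReflection s (M.simpleReflection s v) = v := by
  rw [← Module.End.mul_apply, simpleReflection_mul_self, Module.End.one_apply]

/-- Inversions of x are inversions of every y above it. A left descent s of x is one of y; removing
it from both lets the reflection in s act on the remaining positive roots, and multiples of the root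
of s are treated directly. -/
theorem WeakLE.geomRep_inv_nonpos (n : ℕ) : ∀ (x y : M.Group) (β : B →₀ ℝ), M.len x ≤ n →
    M.WeakLE x y → M.IsRoot β → 0 ≤ β → M.geomRep x⁻¹ β ≤ 0 → M.geomRep y⁻¹ β ≤ 0 := by
  induction n with
  | zero =>
    intro x y β hn h hβ h0 hx
    have : x = 1 := M.len_eq_zero.mp (by omega)
    subst this
    rw [inv_one, map_one, Module.End.one_apply] at hx
    rw [le_antisymm hx h0, map_zero]
  | succ n ih =>
    intro x y β hn h hβ h0 hx
    by_cases hx1 : x = 1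
    · subst hx1
      rw [inv_one, map_one, Module.End.one_apply] at hx
      rw [le_antisymm hx h0, map_zero]
    obtain ⟨s, hs⟩ := M.exists_simple_mul_lt hx1
    obtain ⟨hy, hxy⟩ := h.simple_mul hs
    rcases hβ.simpleReflection_nonneg h0 s with e | e
    · rw [e, map_smul]
      exact smul_nonpos_of_nonneg_of_nonpos (h0 s) (M.geomRep_inv_nonpos_of_lt hy)
    · have := ih _ _ _ (by omega) hxy (hβ.simpleReflection s) e
        (by rwa [geomRep_simple_mul_inv, simpleReflection_simpleReflection])
      rwa [geomRep_simple_mul_inv, simpleReflection_simpleReflection] at this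

/-- Converse of the preceding lemma, so that the weak order is inclusion of inversions. The root of
a descent s of x is an inversion of x, hence of y, so s can be removed from both. -/
theorem weakLE_of_geomRep_inv_nonpos (n : ℕ) : ∀ (x y : M.Group), M.len x ≤ n →
    (∀ β, M.IsRoot β → 0 ≤ β → M.geomRep x⁻¹ β ≤ 0 → M.geomRep y⁻¹ β ≤ 0) → M.WeakLE x y := by
  induction n with
  | zero =>
    intro x y hn h
    rw [M.len_eq_zero.mp (show M.len x = 0 by omega)]
    exact one_weakLE y
  | succ n ih =>
    intro x y hn h
    by_cases hx1 : x = 1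
    · subst hx1; exact one_weakLE y
    obtain ⟨s, hs⟩ := M.exists_simple_mul_lt hx1
    have hy : M.len (M.simple s * y) < M.len y := M.len_lt_of_nonpos
      (h _ (isRoot_simpleRoot s) (by simp [simpleRoot]) (M.geomRep_inv_nonpos_of_lt hs))
    rw [← M.simple_mul_simple s x, ← M.simple_mul_simple s y,
      weakLE_simple_mul_iff (by rwa [simple_mul_simple]) (by rwa [simple_mul_simple])]
    refine ih _ _ (by omega) fun β hβ h0 hx => ?_
    rcases hβ.simpleReflection_nonneg h0 s with e | e
    · have h1 : 0 ≤ M.geomRep (M.simple s * x)⁻¹ (M.simpleRoot s) :=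
        M.geomRep_inv_nonneg_of_lt (by rwa [simple_mul_simple])
      have h2 : M.geomRep (M.simple s * x)⁻¹ β = 0 := by
        refine le_antisymm hx ?_
        rw [e, map_smul]
        exact smul_nonneg (h0 s) h1
      have h3 := M.geomRep_inv_apply (M.simple s * x)⁻¹ β
      rw [h2, map_zero] at h3
      rw [← h3, map_zero]
    · rw [geomRep_simple_mul_inv] at hx ⊢
      exact h _ (hβ.simpleReflection s) e hx

/-- If `s` is below `y` but not below `x ≤ y`, then `x ≤ s y`. -/
theorem WeakLE.le_simple_mul {x y : M.Group} (h : M.WeakLE x y) {s : B}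
    (hx : M.len x < M.len (M.simple s * x)) (hy : M.len (M.simple s * y) < M.len y) :
    M.WeakLE x (M.simple s * y) := by
  refine weakLE_of_geomRep_inv_nonpos _ x _ le_rfl fun β hβ h0 hxβ => ?_
  have hyβ := h.geomRep_inv_nonpos _ x y β le_rfl hβ h0 hxβ
  have i1 := M.geomRep_inv_nonneg_of_lt hx
  have i2 := M.geomRep_inv_nonpos_of_lt hy
  rw [geomRep_simple_mul_inv]
  -- If the coroot is nonpositive on β, then sβ is β plus a nonnegative multiple of the root of s,
  -- and the inverse of y makes both summands nonpositive. Otherwise sβ is again an inversion of x,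
  -- hence of y, unless β is a multiple of the root of s, in which case β = 0 because s is not a
  -- descent of x.
  rcases le_total (M.coroot s β) 0 with hc | hc
  · rw [simpleReflection_apply, map_sub, map_smul]
    exact sub_nonpos.mpr (hyβ.trans (smul_nonneg_of_nonpos_of_nonpos hc i2))
  · have i3 : M.geomRep x⁻¹ (M.simpleReflection s β) ≤ 0 := by
      rw [simpleReflection_apply, map_sub, map_smul]
      exact sub_nonpos.mpr (hxβ.trans (smul_nonneg hc i1))
    rcases hβ.simpleReflection_nonneg h0 s with e | e
    · rw [e, map_smul, simpleReflection_simpleRoot_self, smul_neg, map_neg, map_smul]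
      rw [e, map_smul] at hxβ
      have h2 : M.geomRep x⁻¹ β = 0 := by
        rw [e, map_smul]
        exact le_antisymm hxβ (smul_nonneg (h0 s) i1)
      have h3 := M.geomRep_inv_apply x⁻¹ β
      rw [h2, map_zero] at h3
      rw [← h3]; simp
    · exact h.geomRep_inv_nonpos _ x y _ le_rfl (hβ.simpleReflection s) e i3

/-- Bounded pairs have joins in the weak order. -/
theorem exists_weak_join {x y w : M.Group} (hx : M.WeakLE x w) (hy : M.WeakLE y w) :
    ∃ j, M.WeakLE x j ∧ M.WeakLE y j ∧ ∀ w', M.WeakLE x w' → M.WeakLE y w' → M.WeakLE j w' := by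
  refine exists_join_of_covers M.WeakLE
    (fun z x => ∃ s, x = z * M.simple s ∧ M.len x = M.len z + 1) M.len WeakLE.refl
    (fun _ _ _ => WeakLE.trans) (fun _ _ => WeakLE.len_le) ?_ ?_ ?_ (M.len w) 1 x y w
    (by omega) (one_weakLE x) (one_weakLE y) hx hy
  · rintro z _ ⟨s, rfl, h⟩
    exact ⟨weakLE_mul_iff.mpr (by rw [h, len_simple]), by omega⟩
  · intro z u h hne
    have h1 : z⁻¹ * u ≠ 1 := fun h => hne (inv_mul_eq_one.mp h)
    obtain ⟨s, hs⟩ := M.exists_simple_mul_lt h1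
    have e : u = z * M.simple s * (M.simple s * (z⁻¹ * u)) := by
      rw [mul_assoc, simple_mul_simple, mul_inv_cancel_left]
    have l1 := M.len_mul_le (z * M.simple s) (M.simple s * (z⁻¹ * u))
    rw [← e] at l1
    have l2 := M.len_mul_le z (M.simple s)
    rw [len_simple] at l2
    have l3 := M.len_simple_mul (z⁻¹ * u) s
    rw [WeakLE] at h
    refine ⟨z * M.simple s, ⟨s, rfl, by omega⟩, ?_⟩
    rw [WeakLE, mul_inv_rev, simple_inv, mul_assoc]
    omega
  · rintro z _ _ w ⟨s, rfl, hs⟩ ⟨t, rfl, ht⟩ hsw htw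
    -- If zr lies below w', then r is a left descent of z⁻¹w'. Two such descents s and t split off
    -- their longest alternating product, which gives the join of zs and zt.
    have key : ∀ (r : B) (w' : M.Group), M.len (z * M.simple r) = M.len z + 1 →
        M.WeakLE (z * M.simple r) w' → M.len w' = M.len z + M.len (z⁻¹ * w') ∧
          M.len (M.simple r * (z⁻¹ * w')) < M.len (z⁻¹ * w') := by
      intro r w' hr hw'
      have h1 : M.WeakLE z (z * M.simple r) := weakLE_mul_iff.mpr (by rw [hr, len_simple])
      have h2 := h1.trans hw'
      rw [WeakLE, mul_inv_rev, simple_inv, mul_assoc] at hw'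
      rw [WeakLE] at h2
      exact ⟨h2, by omega⟩
    by_cases hst : s = t
    · subst hst
      exact ⟨_, WeakLE.refl _, WeakLE.refl _, fun _ h _ => h⟩
    have low : ∀ w', M.WeakLE (z * M.simple s) w' → M.WeakLE (z * M.simple t) w' → M s t ≠ 0 ∧
        M.len (z * M.altProd s t (M s t)) = M.len z + M s t ∧
          M.WeakLE (z * M.altProd s t (M s t)) w' := by
      intro w' h1 h2
      obtain ⟨l1, d1⟩ := key s w' hs h1
      obtain ⟨-, d2⟩ := key t w' ht h2
      obtain ⟨h0, v, hv, hl⟩ := M.exists_eq_altProd_mul hst d1 d2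
      have e : w' = z * M.altProd s t (M s t) * v := by
        rw [mul_assoc, ← hv, mul_inv_cancel_left]
      have l2 := M.len_mul_le (z * M.altProd s t (M s t)) v
      rw [← e] at l2
      have l3 := M.len_mul_le z (M.altProd s t (M s t))
      have l4 := M.len_altProd_le s t (M s t)
      refine ⟨h0, by omega, ?_⟩
      have e' : (z * M.altProd s t (M s t))⁻¹ * w' = v := by rw [e]; group
      rw [WeakLE, e']
      omega
    obtain ⟨h0, hl, -⟩ := low w hsw htw
    have up : ∀ r r' : B, M.altProd s t (M s t) = M.altProd r r' (M s t) →
        M.len (z * M.simple r) = M.len z + 1 →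
        M.WeakLE (z * M.simple r) (z * M.altProd s t (M s t)) := by
      intro r r' e hr
      obtain ⟨m, hm⟩ := Nat.exists_eq_succ_of_ne_zero h0
      have e2 : z * M.altProd s t (M s t) = z * M.simple r * M.altProd r' r m := by
        rw [e, hm, Nat.succ_eq_add_one, altProd_succ, mul_assoc]
      have l1 := M.len_altProd_le r' r m
      have l2 := M.len_mul_le (z * M.simple r) (M.altProd r' r m)
      rw [e2] at hl
      rw [e2, weakLE_mul_iff]
      omega
    exact ⟨_, up s t rfl hs, up t s (M.altProd_braid s t) ht, fun w' h h' => (low w' h h').2.2⟩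

/-- Elements below `y` that are not above `s` have an upper bound below `y` that is not above
`s`. -/
theorem exists_weak_bound {x x' y : M.Group} {s : B} (h : M.WeakLE x y) (h' : M.WeakLE x' y)
    (hx : M.len x < M.len (M.simple s * x)) (hx' : M.len x' < M.len (M.simple s * x')) :
    ∃ z, M.WeakLE z y ∧ M.WeakLE x z ∧ M.WeakLE x' z ∧ M.len z < M.len (M.simple s * z) := by
  obtain ⟨z, h1, h2, hz⟩ := exists_weak_join h h'
  refine ⟨z, hz y h h', h1, h2, ?_⟩
  rcases M.len_simple_mul z s with e | e
  · omega
  -- If s were a descent of the join z, then sz would be a shorter upper bound.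
  · have := (hz _ (h1.le_simple_mul hx (by omega)) (h2.le_simple_mul hx' (by omega))).len_le
    omega

end CoxeterMatrix

/-! ## Artin monoids: cancellation and least common multiples -/

section ArtinMonoid

variable {B : Type u} (M : CoxeterMatrix B)

/-- The value of a word in the Artin monoid. -/
def artinWord (l : List B) : ArtinMonoid M := PresentedMonoid.mk _ (FreeMonoid.ofList l)

theorem artinWord_nil : artinWord M [] = 1 := rfl

theorem artinWord_append (l l' : List B) :
    artinWord M (l ++ l') = artinWord M l * artinWord M l' := by
  rw [artinWord, FreeMonoid.ofList_append, map_mul]; rfl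

theorem artinWord_cons (s : B) (l : List B) :
    artinWord M (s :: l) = artinGen M s * artinWord M l := by
  rw [artinWord, FreeMonoid.ofList_cons, map_mul]; rfl

theorem exists_artinWord (x : ArtinMonoid M) : ∃ l, artinWord M l = x := by
  obtain ⟨l, rfl⟩ := PresentedMonoid.surjective_mk x
  exact ⟨FreeMonoid.toList l, rfl⟩

/-- The alternating product `s t s ⋯` with `n` factors in the Artin monoid. -/
abbrev artinAlt (s t : B) (n : ℕ) : ArtinMonoid M := artinWord M (altWord s t n)

theorem artinAlt_succ (s t : B) (n : ℕ) :
    artinAlt M s t (n + 1) = artinGen M s * artinAlt M t s n := artinWord_cons M _ _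

theorem artinAlt_braid {s t : B} (h : M s t ≠ 0) :
    artinAlt M s t (M s t) = artinAlt M t s (M s t) := by
  have := PresentedMonoid.mk_eq_mk_of_rel (rels := artinRel M) ⟨s, t, h, rfl, rfl⟩
  rw [M.symmetric t s] at this
  exact this

theorem artinAlt_eq_mul_pred {s t : B} (h : M s t ≠ 0) :
    artinAlt M s t (M s t) = artinGen M s * artinAlt M t s (M s t - 1) := by
  obtain ⟨m, hm⟩ := Nat.exists_eq_succ_of_ne_zero h
  rw [hm, Nat.succ_eq_add_one, artinAlt_succ, Nat.add_sub_cancel]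

theorem lift_ofList {N : Type v} [Monoid N] (f : B → N) (l : List B) :
    FreeMonoid.lift f (FreeMonoid.ofList l) = (l.map f).prod := by
  rw [FreeMonoid.lift_apply]; rfl

/-- The word length on the Artin monoid, as a homomorphism. -/
def artinLenHom : ArtinMonoid M →* Multiplicative ℕ :=
  PresentedMonoid.lift (fun _ => Multiplicative.ofAdd 1) (by
    rintro x y ⟨s, t, h, rfl, rfl⟩
    simp [length_altWord, M.symmetric s t])

/-- The word length on the Artin monoid. -/
def artinLen (x : ArtinMonoid M) : ℕ := (artinLenHom M x).toAdd

theorem artinLen_mul (x y : ArtinMonoid M) : artinLen M (x * y) = artinLen M x + artinLen M y := by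
  rw [artinLen, map_mul]; rfl

theorem artinLen_one : artinLen M 1 = 0 := by
  rw [artinLen, map_one]; rfl

theorem artinLen_gen (s : B) : artinLen M (artinGen M s) = 1 := rfl

theorem artinLen_word (l : List B) : artinLen M (artinWord M l) = l.length := by
  induction l with
  | nil => exact artinLen_one M
  | cons s l ih => rw [artinWord_cons, artinLen_mul, ih, artinLen_gen, List.length_cons, add_comm]

theorem artinLen_alt (s t : B) (n : ℕ) : artinLen M (artinAlt M s t n) = n := by
  rw [artinLen_word, length_altWord]

variable {M} in
theorem eq_one_or_exists_gen_mul (x : ArtinMonoid M) : x = 1 ∨ ∃ s y, x = artinGen M s * y := by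
  obtain ⟨l, rfl⟩ := exists_artinWord M x
  cases l with
  | nil => exact Or.inl rfl
  | cons s l => exact Or.inr ⟨s, artinWord M l, artinWord_cons M s l⟩

variable {M} in
theorem artinLen_eq_zero {x : ArtinMonoid M} : artinLen M x = 0 ↔ x = 1 := by
  refine ⟨fun h => ?_, fun h => by rw [h, artinLen_one]⟩
  rcases eq_one_or_exists_gen_mul x with h' | ⟨s, y, rfl⟩
  · exact h'
  · rw [artinLen_mul, artinLen_gen] at h; omega

/-- The canonical homomorphism from the Artin monoid to the Coxeter group. -/
def artinToCoxeter : ArtinMonoid M →* M.Group :=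
  PresentedMonoid.lift M.simple (by
    rintro x y ⟨s, t, h, rfl, rfl⟩
    rw [lift_ofList, lift_ofList, M.symmetric t s]
    exact M.altProd_braid s t)

theorem artinToCoxeter_gen (s : B) : artinToCoxeter M (artinGen M s) = M.simple s := rfl

theorem artinToCoxeter_word (l : List B) : artinToCoxeter M (artinWord M l) = M.wordVal l := by
  induction l with
  | nil => exact map_one _
  | cons s l ih => rw [artinWord_cons, map_mul, ih, M.wordVal_cons, artinToCoxeter_gen]

theorem len_artinToCoxeter_le (x : ArtinMonoid M) : M.len (artinToCoxeter M x) ≤ artinLen M x := by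
  obtain ⟨l, rfl⟩ := exists_artinWord M x
  rw [artinToCoxeter_word, artinLen_word]
  exact M.len_wordVal_le l

/-- An element of the Artin monoid all of whose words are reduced. -/
def IsReducedElt (x : ArtinMonoid M) : Prop := M.len (artinToCoxeter M x) = artinLen M x

variable {M}

theorem exists_reducedElt (w : M.Group) : ∃ x, IsReducedElt M x ∧ artinToCoxeter M x = w := by
  obtain ⟨l, rfl, hl⟩ := M.exists_reduced_word w
  refine ⟨artinWord M l, ?_, artinToCoxeter_word M l⟩
  rw [IsReducedElt, artinToCoxeter_word, artinLen_word, hl]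

theorem IsReducedElt.of_mul_right {x y : ArtinMonoid M} (h : IsReducedElt M (x * y)) :
    IsReducedElt M y := by
  have h1 := len_artinToCoxeter_le M x
  have h2 := len_artinToCoxeter_le M y
  have h3 := M.len_mul_le (artinToCoxeter M x) (artinToCoxeter M y)
  rw [IsReducedElt, map_mul, artinLen_mul] at h
  rw [IsReducedElt]
  omega

/-- Matsumoto's theorem: reduced elements with the same image in the Coxeter group are equal. -/
theorem IsReducedElt.ext (n : ℕ) : ∀ x y : ArtinMonoid M, artinLen M x ≤ n → IsReducedElt M x →
    IsReducedElt M y → artinToCoxeter M x = artinToCoxeter M y → x = y := by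
  induction n with
  | zero =>
    intro x y hn hx hy h
    rw [IsReducedElt, h] at hx
    rw [artinLen_eq_zero.mp (show artinLen M x = 0 by omega),
      artinLen_eq_zero.mp (hy.symm.trans (hx.trans (by omega)))]
  | succ n ih =>
    intro x y hn hx hy h
    have hlen : artinLen M x = artinLen M y := by rw [← hx, ← hy, h]
    rcases eq_one_or_exists_gen_mul x with rfl | ⟨s, x', rfl⟩
    · exact (artinLen_eq_zero.mp (by rw [← hlen, artinLen_one])).symm
    rcases eq_one_or_exists_gen_mul y with rfl | ⟨t, y', rfl⟩
    · exact artinLen_eq_zero.mp (by rw [hlen, artinLen_one])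
    have hx' := hx.of_mul_right
    have hy' := hy.of_mul_right
    have lx := artinLen_mul M (artinGen M s) x'
    have ly := artinLen_mul M (artinGen M t) y'
    rw [artinLen_gen] at lx ly
    by_cases hst : s = t
    · subst hst
      rw [map_mul, map_mul] at h
      rw [ih x' y' (by omega) hx' hy' (mul_left_cancel h)]
    have h1 : M.len (M.simple s * artinToCoxeter M (artinGen M s * x')) <
        M.len (artinToCoxeter M (artinGen M s * x')) := by
      rw [hx, map_mul, artinToCoxeter_gen, M.simple_mul_simple, hx']; omega
    have h2 : M.len (M.simple t * artinToCoxeter M (artinGen M s * x')) <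
        M.len (artinToCoxeter M (artinGen M s * x')) := by
      rw [hx, h, map_mul, artinToCoxeter_gen, M.simple_mul_simple, hy']; omega
    obtain ⟨h0, v, hv, hl⟩ := M.exists_eq_altProd_mul hst h1 h2
    obtain ⟨z, hz, rfl⟩ := exists_reducedElt v
    obtain ⟨m, hm⟩ := Nat.exists_eq_succ_of_ne_zero h0
    -- Both elements are compared with Δz, where Δ is the alternating product of length m_{st} and z
    -- a reduced lift. After removal of the first letter each comparison is between shorter reduced
    -- elements, and the two spellings of Δ agree by the braid relation.
    have key : ∀ (r r' : B) (a : ArtinMonoid M), IsReducedElt M a → artinLen M a ≤ n →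
        artinToCoxeter M (artinGen M r * a) = M.altProd r r' (m + 1) * artinToCoxeter M z →
        M.len (artinToCoxeter M (artinGen M r * a)) = artinLen M a + 1 →
        M.len (artinToCoxeter M (artinGen M r * a)) = m + 1 + M.len (artinToCoxeter M z) →
        artinGen M r * a = artinAlt M r r' (m + 1) * z := by
      intro r r' a ha hn' he h3 h4
      rw [map_mul, artinToCoxeter_gen, M.altProd_succ, mul_assoc] at he
      have he' := mul_left_cancel he
      have e1 : artinToCoxeter M (artinAlt M r' r m * z) = artinToCoxeter M a := by
        rw [map_mul, artinToCoxeter_word, he']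
      rw [ih a (artinAlt M r' r m * z) hn' ha ?_ e1.symm, artinAlt_succ, mul_assoc]
      rw [IsReducedElt, e1, ha, artinLen_mul, artinLen_alt]
      rw [hz] at h4
      omega
    rw [hm, Nat.succ_eq_add_one] at hv hl
    rw [key s t x' hx' (by omega) hv (by rw [hx, lx, add_comm]) hl,
      key t s y' hy' (by omega) ?_ (by rw [hy, ly, add_comm]) (by rw [← h, hl]),
      ← Nat.succ_eq_add_one, ← hm, artinAlt_braid M h0]
    rw [← h, hv, ← Nat.succ_eq_add_one, ← hm, M.altProd_braid]

variable (M) in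
/-- The reduced lift of an element of the Coxeter group to the Artin monoid. -/
noncomputable def redLift (w : M.Group) : ArtinMonoid M := (exists_reducedElt w).choose

theorem isReducedElt_redLift (w : M.Group) : IsReducedElt M (redLift M w) :=
  (exists_reducedElt w).choose_spec.1

theorem artinToCoxeter_redLift (w : M.Group) : artinToCoxeter M (redLift M w) = w :=
  (exists_reducedElt w).choose_spec.2

theorem artinLen_redLift (w : M.Group) : artinLen M (redLift M w) = M.len w := by
  rw [← isReducedElt_redLift w, artinToCoxeter_redLift]

theorem eq_redLift {x : ArtinMonoid M} (h : artinLen M x = M.len (artinToCoxeter M x)) :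
    x = redLift M (artinToCoxeter M x) :=
  IsReducedElt.ext _ x _ le_rfl h.symm (isReducedElt_redLift _) (artinToCoxeter_redLift _).symm

theorem redLift_mul {x y : M.Group} (h : M.len (x * y) = M.len x + M.len y) :
    redLift M (x * y) = redLift M x * redLift M y := by
  have e : artinToCoxeter M (redLift M x * redLift M y) = x * y := by
    rw [map_mul, artinToCoxeter_redLift, artinToCoxeter_redLift]
  rw [eq_redLift (x := redLift M x * redLift M y), e]
  rw [artinLen_mul, artinLen_redLift, artinLen_redLift, e, h]

theorem redLift_simple_mul {s : B} {x : M.Group} (h : M.len x < M.len (M.simple s * x)) :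
    redLift M (M.simple s * x) = artinGen M s * redLift M x := by
  have e : artinToCoxeter M (artinGen M s * redLift M x) = M.simple s * x := by
    rw [map_mul, artinToCoxeter_redLift, artinToCoxeter_gen]
  rw [eq_redLift (x := artinGen M s * redLift M x), e]
  rw [artinLen_mul, artinLen_redLift, artinLen_gen, e]
  rcases M.len_simple_mul x s with h' | h' <;> omega

theorem redLift_altProd {s t : B} (hst : s ≠ t) (k : ℕ) (hk : M s t = 0 ∨ k ≤ M s t) :
    redLift M (M.altProd s t k) = artinAlt M s t k := by
  rw [eq_redLift (x := artinAlt M s t k), artinToCoxeter_word]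
  rw [artinLen_alt, artinToCoxeter_word, M.len_altProd hst k hk]

theorem CoxeterMatrix.WeakLE.redLift_eq {x y : M.Group} (h : M.WeakLE x y) :
    redLift M y = redLift M x * redLift M (x⁻¹ * y) := by
  rw [← redLift_mul (by rw [mul_inv_cancel_left]; exact h), mul_inv_cancel_left]

variable (M) in
/-- The relation between two factorizations `s a = t b` of an element of the Artin monoid: either
they are equal, or both come from the braid relation of `s` and `t`. -/
def HeadRel (s : B) (a : ArtinMonoid M) (t : B) (b : ArtinMonoid M) : Prop :=
  (s = t ∧ a = b) ∨ (s ≠ t ∧ M s t ≠ 0 ∧ ∃ c, a = artinAlt M t s (M s t - 1) * c ∧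
    b = artinAlt M s t (M s t - 1) * c)

theorem HeadRel.symm {s t : B} {a b : ArtinMonoid M} (h : HeadRel M s a t b) :
    HeadRel M t b s a := by
  rcases h with ⟨rfl, rfl⟩ | ⟨hst, h0, c, rfl, rfl⟩
  · exact Or.inl ⟨rfl, rfl⟩
  · exact Or.inr ⟨hst.symm, by rwa [M.symmetric t s], c, by rw [M.symmetric t s],
      by rw [M.symmetric t s]⟩

theorem HeadRel.mul {s t : B} {a b : ArtinMonoid M} (h : HeadRel M s a t b) (c : ArtinMonoid M) :
    HeadRel M s (a * c) t (b * c) := by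
  rcases h with ⟨rfl, rfl⟩ | ⟨hst, h0, d, rfl, rfl⟩
  · exact Or.inl ⟨rfl, rfl⟩
  · exact Or.inr ⟨hst, h0, d * c, mul_assoc _ _ _, mul_assoc _ _ _⟩

variable (M) in
/-- `HeadRel` holds for all factorizations of elements of length at most `n`. -/
def HeadsUpTo (n : ℕ) : Prop := ∀ (s t : B) (a b : ArtinMonoid M),
  artinLen M (artinGen M s * a) ≤ n → artinGen M s * a = artinGen M t * b → HeadRel M s a t b

theorem HeadsUpTo.cancel_gen {n : ℕ} (H : HeadsUpTo M n) {s : B} {a b : ArtinMonoid M}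
    (hn : artinLen M (artinGen M s * a) ≤ n) (h : artinGen M s * a = artinGen M s * b) : a = b := by
  rcases H s s a b hn h with ⟨-, h⟩ | ⟨h, -⟩
  · exact h
  · exact absurd rfl h

theorem HeadsUpTo.cancel {n : ℕ} (H : HeadsUpTo M n) {x a b : ArtinMonoid M}
    (hn : artinLen M (x * a) ≤ n) (h : x * a = x * b) : a = b := by
  obtain ⟨l, rfl⟩ := exists_artinWord M x
  induction l with
  | nil => simpa [artinWord_nil] using h
  | cons s l ih =>
    rw [artinWord_cons, mul_assoc] at hn
    rw [artinWord_cons, mul_assoc, mul_assoc] at h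
    refine ih ?_ (H.cancel_gen hn h)
    rw [artinLen_mul] at hn
    omega

/-- The reduced divisors of an element with a common left descent have an upper bound, provided
this holds after removing the descent. -/
theorem HeadsUpTo.exists_upper {n : ℕ} (H : HeadsUpTo M n) (k : ℕ) : ∀ (d : ArtinMonoid M)
    (x y : M.Group), artinLen M d ≤ k → artinLen M d ≤ n → redLift M x ∣ d → redLift M y ∣ d →
      ∃ z, redLift M z ∣ d ∧ M.WeakLE x z ∧ M.WeakLE y z := by
  induction k with
  | zero =>
    intro d x y hk hn hx hy
    have trivial : ∀ x : M.Group, redLift M x ∣ d → x = 1 := by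
      rintro x ⟨c, rfl⟩
      rw [artinLen_mul, artinLen_redLift] at hk
      exact M.len_eq_zero.mp (by omega)
    exact ⟨x, hx, CoxeterMatrix.WeakLE.refl x, by
      rw [trivial x hx, trivial y hy]; exact CoxeterMatrix.WeakLE.refl _⟩
  | succ k ih =>
    -- A common descent s is cancelled and the induction hypothesis gives a bound for sx and sy. It
    -- is replaced by one without s as descent, so that multiplying by s again stays reduced.
    have same : ∀ (d : ArtinMonoid M) (x y : M.Group) (s : B), artinLen M d ≤ k + 1 →
        artinLen M d ≤ n → redLift M x ∣ d → redLift M y ∣ d →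
        M.len (M.simple s * x) < M.len x → M.len (M.simple s * y) < M.len y →
        ∃ z, redLift M z ∣ d ∧ M.WeakLE x z ∧ M.WeakLE y z := by
      rintro _ x y s hk hn ⟨e, rfl⟩ ⟨f, hf⟩ hsx hsy
      have ex := redLift_simple_mul (x := M.simple s * x) (s := s) (by rwa [M.simple_mul_simple])
      have ey := redLift_simple_mul (x := M.simple s * y) (s := s) (by rwa [M.simple_mul_simple])
      rw [M.simple_mul_simple] at ex ey
      rw [ex, mul_assoc] at hk hn hf
      rw [ey, mul_assoc] at hf
      have hc := H.cancel_gen hn hf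
      rw [artinLen_mul, artinLen_gen] at hk hn
      obtain ⟨z, ⟨c, hz⟩, h1, h2⟩ := ih (redLift M (M.simple s * x) * e) (M.simple s * x)
        (M.simple s * y) (by omega) (by omega) ⟨e, rfl⟩ ⟨f, hc⟩
      obtain ⟨z', hz', h3, h4, hs⟩ := CoxeterMatrix.exists_weak_bound (s := s) h1 h2
        (by rwa [M.simple_mul_simple]) (by rwa [M.simple_mul_simple])
      refine ⟨M.simple s * z', ⟨redLift M (z'⁻¹ * z) * c, ?_⟩, ?_, ?_⟩
      · rw [redLift_simple_mul hs, ex, mul_assoc, hz, hz'.redLift_eq]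
        simp only [mul_assoc]
      · rw [← M.simple_mul_simple s x]
        exact (CoxeterMatrix.weakLE_simple_mul_iff (by rwa [M.simple_mul_simple]) hs).mpr h3
      · rw [← M.simple_mul_simple s y]
        exact (CoxeterMatrix.weakLE_simple_mul_iff (by rwa [M.simple_mul_simple]) hs).mpr h4
    intro d x y hk hn hx hy
    by_cases hx1 : x = 1
    · subst hx1; exact ⟨y, hy, CoxeterMatrix.one_weakLE y, CoxeterMatrix.WeakLE.refl y⟩
    by_cases hy1 : y = 1
    · subst hy1; exact ⟨x, hx, CoxeterMatrix.WeakLE.refl x, CoxeterMatrix.one_weakLE x⟩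
    obtain ⟨s, hs⟩ := M.exists_simple_mul_lt hx1
    obtain ⟨t, ht⟩ := M.exists_simple_mul_lt hy1
    by_cases hst : s = t
    · subst hst; exact same d x y s hk hn hx hy hs ht
    have gen_dvd : ∀ (r : B) (x : M.Group), M.len (M.simple r * x) < M.len x →
        redLift M x ∣ d → ∃ a, d = artinGen M r * a := by
      rintro r x hr ⟨c, rfl⟩
      refine ⟨redLift M (M.simple r * x) * c, ?_⟩
      rw [← mul_assoc, ← redLift_simple_mul (by rwa [M.simple_mul_simple]), M.simple_mul_simple]
    obtain ⟨a, ha⟩ := gen_dvd s x hs hx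
    obtain ⟨b, hb⟩ := gen_dvd t y ht hy
    rcases H s t a b (by rwa [← ha]) (by rw [← ha, ← hb]) with ⟨h, -⟩ | ⟨-, h0, c, rfl, rfl⟩
    · exact absurd h hst
    -- For different descents, the head relation makes the longest alternating product of s and t
    -- divide d. It shares s with x and t with y, and the two resulting bounds both have s as
    -- descent, so the previous case applies three times.
    have hΔ : redLift M (M.altProd s t (M s t)) ∣ d := by
      rw [redLift_altProd hst _ (Or.inr le_rfl), artinAlt_eq_mul_pred M h0]
      exact ⟨c, by rw [mul_assoc, ha]⟩
    have lΔ := M.len_altProd hst (M s t) (Or.inr le_rfl)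
    obtain ⟨m, hm⟩ := Nat.exists_eq_succ_of_ne_zero h0
    have hsΔ : M.len (M.simple s * M.altProd s t (M s t)) < M.len (M.altProd s t (M s t)) := by
      rw [lΔ, hm, Nat.succ_eq_add_one, M.altProd_succ, M.simple_mul_simple]
      exact Nat.lt_succ_of_le (M.len_altProd_le _ _ _)
    have htΔ : M.len (M.simple t * M.altProd s t (M s t)) < M.len (M.altProd s t (M s t)) := by
      rw [lΔ, M.altProd_braid, hm, Nat.succ_eq_add_one, M.altProd_succ, M.simple_mul_simple]
      exact Nat.lt_succ_of_le (M.len_altProd_le _ _ _)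
    obtain ⟨z, hz, hxz, hΔz⟩ := same d x _ s hk hn hx hΔ hs hsΔ
    obtain ⟨z', hz', hyz', hΔz'⟩ := same d y _ t hk hn hy hΔ ht htΔ
    obtain ⟨z'', hz'', h1, h2⟩ := same d z z' s hk hn hz hz'
      (hΔz.simple_mul hsΔ).1 (hΔz'.simple_mul hsΔ).1
    exact ⟨z'', hz'', hxz.trans h1, hyz'.trans h2⟩

end ArtinMonoid

/-! ### Transitivity of the head relation, and left cancellation -/

section ArtinMonoid

variable {B : Type u} {M : CoxeterMatrix B}

theorem CoxeterMatrix.simple_mul_altProd_braid {s r : B} {m : ℕ} (hm : M s r = m + 1) :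
    M.simple r * M.altProd s r m = M.simple s * M.altProd r s m := by
  have h := M.altProd_braid s r
  rw [hm, M.altProd_succ, M.altProd_succ] at h
  exact h.symm

/-- The alternating product is one letter short of the longest element of ⟨s, r⟩. Multiplying by r
completes it, so it also begins with s; and it stays below rz. -/
theorem CoxeterMatrix.WeakLE.descent_of_altProd {s r : B} {m : ℕ} {z : M.Group} (hsr : s ≠ r)
    (hm : M s r = m + 1) (hpz : M.WeakLE (M.altProd s r m) z)
    (hrz : M.len z < M.len (M.simple r * z)) :
    M.len (M.simple s * (M.simple r * z)) < M.len (M.simple r * z) := by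
  have hmr : M r s = m + 1 := by rw [M.symmetric r s, hm]
  have l1 : M.len (M.altProd s r m) = m := M.len_altProd hsr _ (by omega)
  have l2 : M.len (M.simple r * M.altProd s r m) = m + 1 := by
    rw [← M.altProd_succ]; exact M.len_altProd hsr.symm _ (by omega)
  have h1 : M.WeakLE (M.simple r * M.altProd s r m) (M.simple r * z) :=
    (weakLE_simple_mul_iff (by omega) hrz).mpr hpz
  refine (h1.simple_mul ?_).1
  rw [l2, simple_mul_altProd_braid hm, M.simple_mul_simple]
  exact Nat.lt_succ_of_le (M.len_altProd_le _ _ _)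

/-- Cancellation expresses `c` as a reduced lift times `e`. Up to the factor `e`, both sides are
then reduced elements over the same element srz of the Coxeter group, and Matsumoto's theorem
identifies them. -/
theorem HeadsUpTo.eq_of_altProd {n : ℕ} (H : HeadsUpTo M n) {s r t : B} {m k : ℕ} {z v : M.Group}
    {c e : ArtinMonoid M} (hn : artinLen M (artinAlt M s r m * c) ≤ n) (hsr : s ≠ r)
    (hm : M s r = m + 1) (hpz : M.WeakLE (M.altProd s r m) z)
    (he : artinAlt M s r m * c = redLift M z * e)
    (hrz : M.len z < M.len (M.simple r * z))
    (hv : M.simple r * z = M.altProd s t (k + 1) * v)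
    (hl : M.len (M.simple r * z) = k + 1 + M.len v) :
    artinAlt M r s m * c = artinAlt M t s k * (redLift M v * e) := by
  have hpl : redLift M (M.altProd s r m) = artinAlt M s r m := redLift_altProd hsr _ (by omega)
  have lp : M.len (M.altProd s r m) = m := M.len_altProd hsr _ (by omega)
  rw [hpz.redLift_eq, hpl, mul_assoc] at he
  rw [H.cancel hn he, ← mul_assoc, ← mul_assoc]
  congr 1
  have e1 : artinToCoxeter M (artinAlt M r s m * redLift M ((M.altProd s r m)⁻¹ * z)) =
      M.simple s * (M.simple r * z) := by
    rw [map_mul, artinToCoxeter_word, artinToCoxeter_redLift]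
    have := CoxeterMatrix.simple_mul_altProd_braid hm
    calc M.altProd r s m * ((M.altProd s r m)⁻¹ * z)
        = M.simple s * (M.simple s * M.altProd r s m) * ((M.altProd s r m)⁻¹ * z) := by
          rw [M.simple_mul_simple]
      _ = _ := by rw [← this]; group
  have e2 : artinToCoxeter M (artinAlt M t s k * redLift M v) = M.simple s * (M.simple r * z) := by
    rw [map_mul, artinToCoxeter_word, artinToCoxeter_redLift, hv, M.altProd_succ, mul_assoc,
      M.simple_mul_simple]
  have l1 := M.len_simple_mul (M.simple r * z) s
  have l2 := M.len_simple_mul z r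
  have l3 := len_artinToCoxeter_le M (artinAlt M t s k * redLift M v)
  have l4 : artinLen M (artinAlt M t s k * redLift M v) = k + M.len v := by
    rw [artinLen_mul, artinLen_alt, artinLen_redLift]
  have l5 : artinLen M (artinAlt M r s m * redLift M ((M.altProd s r m)⁻¹ * z)) =
      m + M.len ((M.altProd s r m)⁻¹ * z) := by
    rw [artinLen_mul, artinLen_alt, artinLen_redLift]
  have l6 : M.len z = _ := hpz
  refine IsReducedElt.ext _ _ _ le_rfl ?_ ?_ (e1.trans e2.symm)
  · rw [IsReducedElt, e1]; rw [e2] at l3; omega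
  · rw [IsReducedElt, e2]; rw [e2] at l3; omega

/-- The case of three distinct letters carries the idea. Two braid steps at r make the tail d
divisible by alternating products p = s r ⋯ and q = t r ⋯, each one letter short of a braid word.
They have a common reduced bound z dividing d without r as descent. Then rz has both s and t as
descents, so it begins with their longest alternating product, which is the required relation
between s and t. -/
theorem HeadsUpTo.trans {n : ℕ} (H : HeadsUpTo M n) {s r t : B} {a d b : ArtinMonoid M}
    (hn : artinLen M d ≤ n) (h : HeadRel M s a r d) (h' : HeadRel M r d t b) :
    HeadRel M s a t b := by
  rcases h with ⟨rfl, rfl⟩ | ⟨hsr, h0, c, rfl, hc⟩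
  · exact h'
  rcases h' with ⟨rfl, rfl⟩ | ⟨hrt, h0', c', hd, rfl⟩
  · exact Or.inr ⟨hsr, h0, c, rfl, hc⟩
  obtain ⟨m, hm⟩ : ∃ m, M s r = m + 1 := Nat.exists_eq_succ_of_ne_zero h0
  obtain ⟨m', hm'⟩ : ∃ m, M r t = m + 1 := Nat.exists_eq_succ_of_ne_zero h0'
  have hmt : M t r = m' + 1 := by rw [M.symmetric t r, hm']
  rw [hm, Nat.add_sub_cancel] at hc ⊢
  rw [hm', Nat.add_sub_cancel] at hd ⊢
  by_cases hst : s = t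
  · subst hst
    have : m' = m := by omega
    subst this
    refine Or.inl ⟨rfl, ?_⟩
    rw [H.cancel (by rwa [← hc]) (hc.symm.trans hd)]
  have hpd : redLift M (M.altProd s r m) ∣ d := by
    rw [redLift_altProd hsr _ (by omega), hc]; exact ⟨c, rfl⟩
  have hqd : redLift M (M.altProd t r m') ∣ d := by
    rw [redLift_altProd hrt.symm _ (by omega), hd]; exact ⟨c', rfl⟩
  obtain ⟨y, hyd, hpy, hqy⟩ := H.exists_upper _ d _ _ le_rfl hn hpd hqd
  have notDesc : ∀ {x : B} {k : ℕ}, x ≠ r → M x r = k + 1 →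
      M.len (M.altProd x r k) < M.len (M.simple r * M.altProd x r k) := by
    intro x k hx hk
    rw [← M.altProd_succ, M.len_altProd hx _ (by omega),
      M.len_altProd hx.symm _ (by rw [M.symmetric r x]; omega)]
    omega
  obtain ⟨z, hzy, hpz, hqz, hrz⟩ := CoxeterMatrix.exists_weak_bound (s := r) hpy hqy
    (notDesc hsr hm) (notDesc hrt.symm hmt)
  obtain ⟨e, he⟩ : redLift M z ∣ d := dvd_trans ⟨_, hzy.redLift_eq⟩ hyd
  obtain ⟨hst0, v, hv, hl⟩ := M.exists_eq_altProd_mul hst (hpz.descent_of_altProd hsr hm hrz)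
    (hqz.descent_of_altProd hrt.symm hmt hrz)
  obtain ⟨k, hk⟩ : ∃ k, M s t = k + 1 := Nat.exists_eq_succ_of_ne_zero hst0
  refine Or.inr ⟨hst, hst0, redLift M v * e, ?_, ?_⟩
  · rw [hk] at hv hl ⊢
    exact H.eq_of_altProd (by rwa [← hc]) hsr hm hpz (hc.symm.trans he) hrz hv hl
  · rw [M.altProd_braid] at hv
    rw [hk] at hv hl ⊢
    exact H.eq_of_altProd (by rwa [← hd]) hrt.symm hmt hqz (hd.symm.trans he) hrz hv hl

variable (M) in
/-- The congruence on words whose classes up to length `n + 1` satisfy the head relation. -/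
def headCon {n : ℕ} (H : HeadsUpTo M n) : Con (FreeMonoid B) where
  r x y := artinWord M x.toList = artinWord M y.toList ∧ (x.toList.length ≤ n + 1 →
    ∀ s l t l', x.toList = s :: l → y.toList = t :: l' →
      HeadRel M s (artinWord M l) t (artinWord M l'))
  iseqv := by
    have len_eq : ∀ l l' : List B, artinWord M l = artinWord M l' → l.length = l'.length := by
      intro l l' h
      rw [← artinLen_word M, h, artinLen_word]
    refine ⟨fun x => ⟨rfl, fun _ s l t l' h h' => ?_⟩, fun {x y} h => ⟨h.1.symm, ?_⟩,
      fun {x y z} h h' => ⟨h.1.trans h'.1, ?_⟩⟩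
    · rw [h] at h'
      obtain ⟨rfl, rfl⟩ := List.cons.inj h'
      exact Or.inl ⟨rfl, rfl⟩
    · intro hn s l t l' e e'
      exact (h.2 (by rwa [len_eq _ _ h.1]) t l' s l e' e).symm
    · intro hn s l t l' e e'
      have hl := len_eq _ _ h.1
      rw [hl] at hn
      rcases hy : y.toList with _ | ⟨r, d⟩
      · rw [hy, e] at hl; simp at hl
      · have hd : artinLen M (artinWord M d) ≤ n := by
          rw [hy, List.length_cons] at hn
          rw [artinLen_word]; omega
        exact H.trans hd (h.2 (by rwa [hl]) s l r d e hy) (h'.2 hn r d t l' hy e')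
  mul' := by
    intro x x' y y' h h'
    refine ⟨by rw [FreeMonoid.toList_mul, FreeMonoid.toList_mul, artinWord_append, h.1, h'.1,
      artinWord_append], ?_⟩
    intro hn s l t l' e e'
    rw [FreeMonoid.toList_mul] at e e' hn
    have hlen : x.toList.length = x'.toList.length := by
      rw [← artinLen_word M, h.1, artinLen_word]
    have hlen' : y.toList.length = y'.toList.length := by
      rw [← artinLen_word M, h'.1, artinLen_word]
    rw [List.length_append] at hn
    rcases hx : x.toList with _ | ⟨s₁, l₁⟩ <;> rcases hx' : x'.toList with _ | ⟨t₁, l₁'⟩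
    · rw [hx, List.nil_append] at e
      rw [hx', List.nil_append] at e'
      exact h'.2 (by omega) s l t l' e e'
    · rw [hx, hx'] at hlen; simp at hlen
    · rw [hx, hx'] at hlen; simp at hlen
    · rw [hx, List.cons_append] at e
      rw [hx', List.cons_append] at e'
      obtain ⟨rfl, rfl⟩ := List.cons.inj e
      obtain ⟨rfl, rfl⟩ := List.cons.inj e'
      rw [artinWord_append, artinWord_append, h'.1]
      exact (h.2 (by omega) _ _ _ _ hx hx').mul _

/-- Equality of words is the congruence generated by the braid relations, so it suffices that
`headCon` is a congruence containing them. Its transitivity at length n + 1 concerns tails of length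
at most n and uses only the induction hypothesis. -/
theorem headsUpTo (n : ℕ) : HeadsUpTo M n := by
  induction n with
  | zero =>
    intro s t a b hn
    rw [artinLen_mul, artinLen_gen] at hn
    omega
  | succ n H =>
    intro s t a b hn h
    obtain ⟨l, rfl⟩ := exists_artinWord M a
    obtain ⟨l', rfl⟩ := exists_artinWord M b
    rw [← artinWord_cons, ← artinWord_cons] at h
    have hle : conGen (artinRel M) ≤ headCon M H := by
      refine Con.conGen_le.mpr ?_
      rintro _ _ ⟨s, t, h0, rfl, rfl⟩
      rw [M.symmetric t s]
      refine ⟨artinAlt_braid M h0, fun _ s' l t' l' e e' => ?_⟩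
      obtain ⟨m, hm⟩ : ∃ m, M s t = m + 1 := Nat.exists_eq_succ_of_ne_zero h0
      rw [hm] at e e'
      obtain ⟨rfl, rfl⟩ := List.cons.inj e
      obtain ⟨rfl, rfl⟩ := List.cons.inj e'
      by_cases hst : s = t
      · subst hst; exact Or.inl ⟨rfl, rfl⟩
      · refine Or.inr ⟨hst, h0, 1, ?_, ?_⟩ <;> rw [hm, Nat.add_sub_cancel, mul_one]
    have := hle (PresentedMonoid.mk_eq_mk_iff.mp h)
    rw [artinLen_mul, artinLen_gen, artinLen_word] at hn
    exact this.2 (by simpa [add_comm] using hn) s l t l' rfl rfl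

theorem headRel_of_gen_mul_eq {s t : B} {a b : ArtinMonoid M}
    (h : artinGen M s * a = artinGen M t * b) : HeadRel M s a t b := headsUpTo _ s t a b le_rfl h

/-- Artin monoids are left cancellative. -/
theorem artinMonoid_mul_left_cancel {x a b : ArtinMonoid M} (h : x * a = x * b) : a = b :=
  (headsUpTo _).cancel le_rfl h

/-- A common right multiple of two distinct generators is a right multiple of their alternating
product. -/
theorem artinAlt_dvd {s t : B} (hst : s ≠ t) {x : ArtinMonoid M} (hs : artinGen M s ∣ x)
    (ht : artinGen M t ∣ x) : M s t ≠ 0 ∧ artinAlt M s t (M s t) ∣ x := by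
  obtain ⟨a, rfl⟩ := hs
  obtain ⟨b, hb⟩ := ht
  rcases headRel_of_gen_mul_eq hb with ⟨h, -⟩ | ⟨-, h0, c, rfl, -⟩
  · exact absurd h hst
  · exact ⟨h0, c, by rw [artinAlt_eq_mul_pred M h0, mul_assoc]⟩

end ArtinMonoid

/-! ## Left cancellative monoids with conditional least common multiples -/

/-- A left cancellative monoid, graded by an additive length that vanishes only at the identity, in
which any two elements with a common right multiple have a least one. -/
structure IsGradedLCMMonoid (P : Type u) [Monoid P] (len : P → ℕ) : Prop where
  cancel : ∀ x a b : P, x * a = x * b → a = b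
  len_mul : ∀ x y, len (x * y) = len x + len y
  eq_one_of_len : ∀ x, len x = 0 → x = 1
  lcm : ∀ x y z : P, x ∣ z → y ∣ z → ∃ r, x ∣ r ∧ y ∣ r ∧ ∀ r', x ∣ r' → y ∣ r' → r ∣ r'

/-- Every element other than the identity has a left divisor in `R`. -/
def GeneratedBy {P : Type u} [Monoid P] (R : Set P) : Prop :=
  ∀ x : P, x = 1 ∨ ∃ s ∈ R, ∃ y, x = s * y

/-- Cancelling z and applying the head relation shows that the join of zs and zt, if they are
bounded, is z times the longest alternating product; `exists_join_of_covers` extends this to all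
bounded pairs. -/
theorem artinMonoid_isGradedLCMMonoid {B : Type u} (M : CoxeterMatrix B) :
    IsGradedLCMMonoid (ArtinMonoid M) (artinLen M) where
  cancel _ _ _ := artinMonoid_mul_left_cancel
  len_mul := artinLen_mul M
  eq_one_of_len _ := artinLen_eq_zero.mp
  lcm := by
    intro x y w hx hy
    have hcancel : ∀ z x w : ArtinMonoid M, z * x ∣ z * w → x ∣ w := by
      rintro z x w ⟨c, hc⟩
      exact ⟨c, artinMonoid_mul_left_cancel (hc.trans (mul_assoc _ _ _))⟩
    refine exists_join_of_covers (fun x y : ArtinMonoid M => x ∣ y)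
      (fun z x => ∃ s, x = z * artinGen M s) (artinLen M) dvd_refl (fun _ _ _ => dvd_trans) ?_ ?_ ?_
      ?_ (artinLen M w) 1 x y w (by omega) (one_dvd _) (one_dvd _) hx hy
    · rintro x _ ⟨c, rfl⟩
      rw [artinLen_mul]; omega
    · rintro z _ ⟨s, rfl⟩
      exact ⟨⟨_, rfl⟩, by rw [artinLen_mul, artinLen_gen]; omega⟩
    · rintro z _ ⟨c, rfl⟩ hne
      rcases eq_one_or_exists_gen_mul c with rfl | ⟨s, y, rfl⟩
      · exact absurd (mul_one z).symm hne
      · exact ⟨_, ⟨s, rfl⟩, y, (mul_assoc _ _ _).symm⟩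
    · rintro z _ _ w ⟨s, rfl⟩ ⟨t, rfl⟩ h h'
      by_cases hst : s = t
      · subst hst; exact ⟨_, dvd_refl _, dvd_refl _, fun _ h _ => h⟩
      have low : ∀ w', z * artinGen M s ∣ w' → z * artinGen M t ∣ w' →
          M s t ≠ 0 ∧ z * artinAlt M s t (M s t) ∣ w' := by
        intro w' h h'
        obtain ⟨w', rfl⟩ := dvd_trans ⟨_, rfl⟩ h
        obtain ⟨h0, hd⟩ := artinAlt_dvd hst (hcancel _ _ _ h) (hcancel _ _ _ h')
        exact ⟨h0, mul_dvd_mul_left z hd⟩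
      obtain ⟨h0, -⟩ := low w h h'
      refine ⟨z * artinAlt M s t (M s t), ?_, ?_, fun w' h h' => (low w' h h').2⟩
      · rw [artinAlt_eq_mul_pred M h0, ← mul_assoc]; exact ⟨_, rfl⟩
      · rw [artinAlt_braid M h0, M.symmetric s t, artinAlt_eq_mul_pred M (by rwa [M.symmetric t s]),
          ← mul_assoc]
        exact ⟨_, rfl⟩

theorem generatedBy_artinGen {B : Type u} (M : CoxeterMatrix B) :
    GeneratedBy (Set.range (artinGen M)) := by
  intro x
  rcases eq_one_or_exists_gen_mul x with h | ⟨s, y, h⟩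
  · exact Or.inl h
  · exact Or.inr ⟨_, ⟨s, rfl⟩, y, h⟩

theorem one_notMem_range_artinGen {B : Type u} (M : CoxeterMatrix B) :
    (1 : ArtinMonoid M) ∉ Set.range (artinGen M) := by
  rintro ⟨s, hs⟩
  have := artinLen_gen M s
  rw [hs, artinLen_one] at this
  omega

namespace IsGradedLCMMonoid

variable {P : Type u} [Monoid P] {len : P → ℕ} (hP : IsGradedLCMMonoid P len)
include hP

theorem len_one : len 1 = 0 := by
  have := hP.len_mul 1 1
  rw [one_mul] at this; omega

theorem eq_one_of_mul_eq_one {x y : P} (h : x * y = 1) : x = 1 := by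
  have := hP.len_mul x y
  rw [h, hP.len_one] at this
  exact hP.eq_one_of_len x (by omega)

theorem eq_one_of_dvd_one {x : P} (h : x ∣ 1) : x = 1 := by
  obtain ⟨y, hy⟩ := h
  exact hP.eq_one_of_mul_eq_one hy.symm

theorem dvd_antisymm {x y : P} (h : x ∣ y) (h' : y ∣ x) : x = y := by
  obtain ⟨a, rfl⟩ := h
  obtain ⟨b, hb⟩ := h'
  have h2 : a * b = 1 := by
    refine (hP.cancel x _ _ ?_).symm
    rw [mul_one, ← mul_assoc]; exact hb
  rw [hP.eq_one_of_mul_eq_one h2, mul_one]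

theorem mul_dvd_mul_iff {x a b : P} : x * a ∣ x * b ↔ a ∣ b := by
  refine ⟨?_, mul_dvd_mul_left x⟩
  rintro ⟨c, hc⟩
  exact ⟨c, hP.cancel x _ _ (hc.trans (mul_assoc _ _ _))⟩

theorem isUnit_iff {x : P} : IsUnit x ↔ x = 1 := by
  refine ⟨?_, fun h => h ▸ isUnit_one⟩
  rintro ⟨u, rfl⟩
  exact hP.eq_one_of_mul_eq_one u.mul_inv

theorem isRightLCM_unique {U : Set P} {r r' : P} (h : IsRightLCM U r) (h' : IsRightLCM U r') :
    r = r' := hP.dvd_antisymm (h.2 r' h'.1) (h'.2 r h.1)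

theorem exists_isRightLCM (K : Finset P) {z : P} (hz : ∀ k ∈ K, k ∣ z) :
    ∃ r, IsRightLCM (K : Set P) r := by
  classical
  induction K using Finset.induction_on with
  | empty => exact ⟨1, by simp, fun _ _ => one_dvd _⟩
  | insert a K _ ih =>
    obtain ⟨r, hr⟩ := ih fun k hk => hz k (Finset.mem_insert_of_mem hk)
    obtain ⟨q, h1, h2, hq⟩ := hP.lcm a r z (hz a (Finset.mem_insert_self _ _))
      (hr.2 z fun k hk => hz k (Finset.mem_insert_of_mem hk))
    refine ⟨q, ?_, fun r' h' => hq r' (h' a (by simp)) (hr.2 r' fun k hk => h' k ?_)⟩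
    · intro k hk
      rcases Finset.mem_insert.mp hk with rfl | hk
      · exact h1
      · exact (hr.1 k hk).trans h2
    · exact Finset.mem_insert_of_mem hk

theorem of_mulEquiv {Q : Type v} [Monoid Q] (e : Q ≃* P) :
    IsGradedLCMMonoid Q (fun x => len (e x)) where
  cancel x a b h := by
    have : e x * e a = e x * e b := by rw [← map_mul, h, map_mul]
    exact e.injective (hP.cancel _ _ _ this)
  len_mul x y := by rw [map_mul, hP.len_mul]
  eq_one_of_len x h := by simpa using hP.eq_one_of_len _ h
  lcm x y z hx hy := by
    have iff : ∀ a b : Q, e a ∣ e b ↔ a ∣ b := fun a b => map_dvd_iff e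
    obtain ⟨r, h1, h2, hr⟩ := hP.lcm (e x) (e y) (e z) ((iff _ _).mpr hx) ((iff _ _).mpr hy)
    obtain ⟨r, rfl⟩ := e.surjective r
    exact ⟨r, (iff _ _).mp h1, (iff _ _).mp h2, fun r' h h' =>
      (iff _ _).mp (hr _ ((iff _ _).mpr h) ((iff _ _).mpr h'))⟩

/-- Generators of length one are exactly the irreducible elements. -/
theorem eq_setOf_irreducible {R : Set P} (hR : GeneratedBy R) (h1 : ∀ s ∈ R, len s = 1) :
    R = {p | Irreducible p} := by
  ext p
  constructor
  · intro hp
    refine ⟨fun hu => ?_, fun a b hab => ?_⟩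
    · have := h1 p hp
      rw [hP.isUnit_iff.mp hu, hP.len_one] at this; omega
    · have := h1 p hp
      rw [hab, hP.len_mul] at this
      rw [hP.isUnit_iff, hP.isUnit_iff]
      rcases Nat.eq_zero_or_pos (len a) with h | h
      · exact Or.inl (hP.eq_one_of_len a h)
      · exact Or.inr (hP.eq_one_of_len b (by omega))
  · intro hp
    rcases hR p with h | ⟨s, hs, y, h⟩
    · exact absurd (h ▸ isUnit_one) hp.not_isUnit
    · rcases hp.isUnit_or_isUnit h with hu | hu
      · have := h1 s hs
        rw [hP.isUnit_iff.mp hu, hP.len_one] at this; omega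
      · rw [h, hP.isUnit_iff.mp hu, mul_one]; exact hs

end IsGradedLCMMonoid

/-! ## The collections `𝒜_R` -/

section OmegaCollection

variable {P : Type u} [Monoid P] {R : Set P}

theorem mem_omegaSet {K : Finset P} {x : P} : x ∈ omegaSet K ↔ ∀ k ∈ K, ¬ k ∣ x := Iff.rfl

theorem omegaSet_empty : omegaSet (∅ : Finset P) = Set.univ := by
  ext x; simp [omegaSet]

theorem mulOmega_one (K : Finset P) : mulOmega 1 K = omegaSet K := by
  simp [mulOmega]

theorem mulOmega_empty (p : P) : mulOmega p ∅ = {x | p ∣ x} := by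
  ext x
  simp only [mulOmega, omegaSet_empty, Set.image_univ, Set.mem_range, Set.mem_ofPred_eq]
  exact ⟨fun ⟨y, h⟩ => ⟨y, h.symm⟩, fun ⟨y, h⟩ => ⟨y, h.symm⟩⟩

theorem omegaCollection_of_finite {ι : Type v} [Finite ι] (p : ι → P) (K : ι → Finset P)
    (hK : ∀ i, (K i : Set P) ⊆ R)
    (hd : Pairwise fun i j => Disjoint (mulOmega (p i) (K i)) (mulOmega (p j) (K j))) :
    ⋃ i, mulOmega (p i) (K i) ∈ omegaCollection R := by
  obtain ⟨n, ⟨e⟩⟩ := Finite.exists_equiv_fin ι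
  refine ⟨n, p ∘ e.symm, K ∘ e.symm, fun j => hK _, fun i j hij => hd (by simpa using hij), ?_⟩
  exact (e.symm.surjective.iUnion_comp fun i => mulOmega (p i) (K i)).symm

theorem omegaCollection_iUnion {ι : Type v} [Finite ι] {U : ι → Set P}
    (hU : ∀ i, U i ∈ omegaCollection R) (hd : Pairwise fun i j => Disjoint (U i) (U j)) :
    ⋃ i, U i ∈ omegaCollection R := by
  choose n p K hK hp e using hU
  have : ⋃ i, U i = ⋃ q : (Σ i, Fin (n i)), mulOmega (p q.1 q.2) (K q.1 q.2) := by
    rw [Set.iUnion_sigma]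
    exact Set.iUnion_congr e
  rw [this]
  refine omegaCollection_of_finite _ _ (fun q => hK _ _) ?_
  rintro ⟨i, a⟩ ⟨j, b⟩ hne
  by_cases hij : i = j
  · subst hij
    exact hp i fun h => hne (congrArg (Sigma.mk i) h)
  · refine (hd hij).mono ?_ ?_
    · rw [e i]; exact Set.subset_iUnion (fun a => mulOmega (p i a) (K i a)) a
    · rw [e j]; exact Set.subset_iUnion (fun a => mulOmega (p j a) (K j a)) b

theorem omegaCollection_empty : (∅ : Set P) ∈ omegaCollection R :=
  ⟨0, Fin.elim0, Fin.elim0, fun j => j.elim0, fun j => j.elim0, by simp⟩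

theorem mulOmega_mem (p : P) {K : Finset P} (hK : (K : Set P) ⊆ R) :
    mulOmega p K ∈ omegaCollection R := by
  have := omegaCollection_of_finite (ι := Unit) (R := R) (fun _ => p) (fun _ => K) (fun _ => hK)
    (fun i j h => absurd (Subsingleton.elim i j) h)
  rwa [Set.iUnion_const] at this

theorem omegaSet_mem {K : Finset P} (hK : (K : Set P) ⊆ R) : omegaSet K ∈ omegaCollection R := by
  rw [← mulOmega_one]; exact mulOmega_mem 1 hK

theorem univ_mem_omegaCollection : (Set.univ : Set P) ∈ omegaCollection R := by
  rw [← omegaSet_empty]; exact omegaSet_mem (by simp)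

theorem omegaCollection_union {U V : Set P} (hU : U ∈ omegaCollection R)
    (hV : V ∈ omegaCollection R) (h : Disjoint U V) : U ∪ V ∈ omegaCollection R := by
  rw [Set.union_eq_iUnion]
  refine omegaCollection_iUnion (by rintro (_ | _) <;> assumption) ?_
  rintro (_ | _) (_ | _) hne
  · exact absurd rfl hne
  · exact h.symm
  · exact h
  · exact absurd rfl hne

theorem omegaCollection_dvd (p : P) : {x | p ∣ x} ∈ omegaCollection R := by
  rw [← mulOmega_empty]; exact mulOmega_mem p (by simp)

/-- A set whose intersections with all basic sets lie in `𝒜_R` intersects every member of `𝒜_R` in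
a member of `𝒜_R`. -/
theorem omegaCollection_inter {V : Set P}
    (h : ∀ (p : P) (K : Finset P), (K : Set P) ⊆ R → mulOmega p K ∩ V ∈ omegaCollection R)
    {U : Set P} (hU : U ∈ omegaCollection R) : U ∩ V ∈ omegaCollection R := by
  obtain ⟨n, p, K, hK, hd, rfl⟩ := hU
  rw [Set.iUnion_inter]
  exact omegaCollection_iUnion (fun i => h _ _ (hK i))
    fun i j hij => (hd hij).mono Set.inter_subset_left Set.inter_subset_left

variable (R) in
/-- Sets that split every member of `𝒜_R` into two members of `𝒜_R`. -/
def Splits𝒜 (V : Set P) : Prop :=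
  ∀ U ∈ omegaCollection R, U ∩ V ∈ omegaCollection R ∧ U \ V ∈ omegaCollection R

theorem Splits𝒜.compl {V : Set P} (h : Splits𝒜 R V) : Splits𝒜 R Vᶜ := fun U hU =>
  ⟨by rw [← Set.sdiff_eq]; exact (h U hU).2, by rw [Set.sdiff_compl]; exact (h U hU).1⟩

theorem Splits𝒜.inter {V V' : Set P} (h : Splits𝒜 R V) (h' : Splits𝒜 R V') :
    Splits𝒜 R (V ∩ V') := by
  intro U hU
  refine ⟨by rw [← Set.inter_assoc]; exact (h' _ (h U hU).1).1, ?_⟩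
  have : U \ (V ∩ V') = (U \ V) ∪ ((U ∩ V) \ V') := by
    ext x; simp only [Set.mem_sdiff, Set.mem_inter_iff, Set.mem_union]; tauto
  rw [this]
  refine omegaCollection_union (h U hU).2 (h' _ (h U hU).1).2 ?_
  exact Set.disjoint_left.mpr fun x hx hx' => hx.2 hx'.1.2

theorem splits𝒜_univ : Splits𝒜 R Set.univ := fun U hU =>
  ⟨by rwa [Set.inter_univ], by rw [Set.sdiff_univ]; exact omegaCollection_empty⟩

theorem Splits𝒜.iUnion {ι : Type v} [Finite ι] {V : ι → Set P} (h : ∀ i, Splits𝒜 R (V i)) :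
    Splits𝒜 R (⋃ i, V i) := by
  classical
  have := Fintype.ofFinite ι
  have key : ∀ s : Finset ι, Splits𝒜 R (⋃ i ∈ s, V i) := by
    intro s
    induction s using Finset.induction_on with
    | empty =>
      have := (splits𝒜_univ (R := R)).compl
      simpa using this
    | insert a s _ ih =>
      rw [Finset.set_biUnion_insert, ← compl_compl (V a ∪ _), Set.compl_union]
      exact ((h a).compl.inter ih.compl).compl
  simpa using key Finset.univ

variable {len : P → ℕ} (hP : IsGradedLCMMonoid P len)
include hP

theorem omegaCollection_image (p : P) {U : Set P} (hU : U ∈ omegaCollection R) :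
    (fun x => p * x) '' U ∈ omegaCollection R := by
  obtain ⟨n, q, K, hK, hd, rfl⟩ := hU
  have e : ∀ j, (fun x => p * x) '' mulOmega (q j) (K j) = mulOmega (p * q j) (K j) := by
    intro j
    rw [mulOmega, mulOmega, Set.image_image]
    simp only [mul_assoc]
  rw [Set.image_iUnion]
  refine omegaCollection_iUnion (fun j => by rw [e]; exact mulOmega_mem _ (hK j)) ?_
  exact fun i j hij => (Set.disjoint_image_iff fun a b => hP.cancel p a b).mpr (hd hij)

theorem mulOmega_eq (p : P) (K : Finset P) :
    mulOmega p K = {x | p ∣ x} ∩ {x | ∀ k ∈ K, ¬ p * k ∣ x} := by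
  ext x
  constructor
  · rintro ⟨y, hy, rfl⟩
    exact ⟨⟨y, rfl⟩, fun k hk h => hy k hk (hP.mul_dvd_mul_iff.mp h)⟩
  · rintro ⟨⟨y, rfl⟩, h⟩
    exact ⟨y, fun k hk h' => h k hk (mul_dvd_mul_left p h'), rfl⟩

theorem self_mem_mulOmega (h1 : (1 : P) ∉ R) (p : P) {K : Finset P} (hK : (K : Set P) ⊆ R) :
    p ∈ mulOmega p K := by
  refine ⟨1, fun k hk h => h1 ?_, mul_one p⟩
  rw [← hP.eq_one_of_dvd_one h]
  exact hK hk

/-- A criterion for `𝒜_R` to be an algebra, in terms of a family of sets that is stable under the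
residuals with respect to a generating set. -/
theorem isSetAlgebra_of_residuals {S : Set P} (hS1 : (1 : P) ∉ S) (hS : GeneratedBy S)
    (T : Set (Set P)) (h1 : ∀ K : Finset P, (K : Set P) ⊆ R → omegaSet K ∈ T)
    (h2 : T ⊆ omegaCollection R) (h3 : ∀ s ∈ S, ∀ V ∈ T, {x | s * x ∈ V} ∈ T)
    (h4 : ∀ s ∈ S, ∀ V ∈ T, V \ {x | s ∣ x} ∈ T) :
    MeasureTheory.IsSetAlgebra (omegaCollection R) := by
  -- Induction along p = s p': outside sP the set V is handled by `h4`, and inside sP it is s times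
  -- its residual, to which the induction hypothesis for p' applies.
  have step1 : ∀ (n : ℕ) (p : P), len p ≤ n → ∀ V ∈ T,
      V ∩ {x | p ∣ x} ∈ omegaCollection R ∧ V \ {x | p ∣ x} ∈ omegaCollection R := by
    intro n
    induction n with
    | zero =>
      intro p hp V hV
      rw [hP.eq_one_of_len p (by omega)]
      simp only [isUnit_one, IsUnit.dvd, Set.ofPred_true, Set.inter_univ, Set.sdiff_univ]
      exact ⟨h2 hV, omegaCollection_empty⟩
    | succ n ih =>
      intro p hp V hV
      by_cases hp1 : p = 1
      · subst hp1
        simp only [isUnit_one, IsUnit.dvd, Set.ofPred_true, Set.inter_univ, Set.sdiff_univ]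
        exact ⟨h2 hV, omegaCollection_empty⟩
      obtain ⟨s, hs, p', rfl⟩ := (hS p).resolve_left hp1
      have hs1 : s ≠ 1 := fun h => hS1 (h ▸ hs)
      have hl : len p' ≤ n := by
        have := hP.len_mul s p'
        have : len s ≠ 0 := fun h => hs1 (hP.eq_one_of_len s h)
        omega
      obtain ⟨i1, i2⟩ := ih p' hl _ (h3 s hs V hV)
      have e1 : V ∩ {x | s * p' ∣ x} = (fun x => s * x) '' ({x | s * x ∈ V} ∩ {x | p' ∣ x}) := by
        ext x
        constructor
        · rintro ⟨hx, c, rfl⟩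
          rw [mul_assoc] at hx ⊢
          exact ⟨p' * c, ⟨hx, c, rfl⟩, rfl⟩
        · rintro ⟨y, ⟨hy, c, rfl⟩, rfl⟩
          exact ⟨hy, c, (mul_assoc _ _ _).symm⟩
      have e2 : V \ {x | s * p' ∣ x} = (V \ {x | s ∣ x}) ∪
          (fun x => s * x) '' ({x | s * x ∈ V} \ {x | p' ∣ x}) := by
        ext x
        constructor
        · rintro ⟨hx, hx'⟩
          by_cases hsx : s ∣ x
          · obtain ⟨y, rfl⟩ := hsx
            exact Or.inr ⟨y, ⟨hx, fun h => hx' (mul_dvd_mul_left s h)⟩, rfl⟩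
          · exact Or.inl ⟨hx, hsx⟩
        · rintro (⟨hx, hx'⟩ | ⟨y, ⟨hy, hy'⟩, rfl⟩)
          · exact ⟨hx, fun h => hx' (dvd_trans ⟨p', rfl⟩ h)⟩
          · exact ⟨hy, fun h => hy' (hP.mul_dvd_mul_iff.mp h)⟩
      rw [e1, e2]
      refine ⟨omegaCollection_image hP s i1, omegaCollection_union (h2 (h4 s hs V hV))
        (omegaCollection_image hP s i2) ?_⟩
      refine Set.disjoint_left.mpr ?_
      rintro _ hx ⟨y, -, rfl⟩
      exact hx.2 ⟨y, rfl⟩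
  -- If q and p have the least common multiple qa, then pP cuts qΩ_K in q(Ω_K ∩ aP), which reduces
  -- to the preceding step. If they have none, pP misses qΩ_K.
  have step2 : ∀ p : P, Splits𝒜 R {x | p ∣ x} := by
    intro p
    have basic : ∀ (q : P) (K : Finset P), (K : Set P) ⊆ R →
        mulOmega q K ∩ {x | p ∣ x} ∈ omegaCollection R ∧
          mulOmega q K ∩ {x | p ∣ x}ᶜ ∈ omegaCollection R := by
      intro q K hK
      by_cases hz : ∃ z, q ∣ z ∧ p ∣ z
      · obtain ⟨z, hqz, hpz⟩ := hz
        obtain ⟨_, ⟨a, rfl⟩, hpr, hr⟩ := hP.lcm q p z hqz hpz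
        have iff : ∀ x, p ∣ q * x ↔ a ∣ x := fun x =>
          ⟨fun h => hP.mul_dvd_mul_iff.mp (hr _ ⟨x, rfl⟩ h),
            fun h => hpr.trans (mul_dvd_mul_left q h)⟩
        obtain ⟨i1, i2⟩ := step1 _ a le_rfl _ (h1 K hK)
        have e1 : mulOmega q K ∩ {x | p ∣ x} = (fun x => q * x) '' (omegaSet K ∩ {x | a ∣ x}) := by
          ext x
          constructor
          · rintro ⟨⟨y, hy, rfl⟩, h⟩
            exact ⟨y, ⟨hy, (iff y).mp h⟩, rfl⟩
          · rintro ⟨y, ⟨hy, h⟩, rfl⟩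
            exact ⟨⟨y, hy, rfl⟩, (iff y).mpr h⟩
        have e2 : mulOmega q K ∩ {x | p ∣ x}ᶜ =
            (fun x => q * x) '' (omegaSet K \ {x | a ∣ x}) := by
          ext x
          constructor
          · rintro ⟨⟨y, hy, rfl⟩, h⟩
            exact ⟨y, ⟨hy, fun h' => h ((iff y).mpr h')⟩, rfl⟩
          · rintro ⟨y, ⟨hy, h⟩, rfl⟩
            exact ⟨⟨y, hy, rfl⟩, fun h' => h ((iff y).mp h')⟩
        rw [e1, e2]
        exact ⟨omegaCollection_image hP q i1, omegaCollection_image hP q i2⟩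
      · have e1 : mulOmega q K ∩ {x | p ∣ x} = ∅ := by
          ext x
          simp only [Set.mem_inter_iff, Set.mem_empty_iff_false, iff_false]
          rintro ⟨⟨y, hy, rfl⟩, h⟩
          exact hz ⟨_, ⟨y, rfl⟩, h⟩
        have e2 : mulOmega q K ∩ {x | p ∣ x}ᶜ = mulOmega q K := by
          rw [Set.inter_eq_left]
          intro x hx h
          have : x ∈ mulOmega q K ∩ {x | p ∣ x} := ⟨hx, h⟩
          rw [e1] at this
          exact this
        rw [e1, e2]
        exact ⟨omegaCollection_empty, mulOmega_mem q hK⟩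
    intro U hU
    rw [Set.sdiff_eq]
    exact ⟨omegaCollection_inter (fun q K hK => (basic q K hK).1) hU,
      omegaCollection_inter (fun q K hK => (basic q K hK).2) hU⟩
  have step3 : ∀ (p : P) (K : Finset P), Splits𝒜 R (mulOmega p K) := by
    intro p K
    rw [mulOmega_eq hP]
    have e : {x | ∀ k ∈ K, ¬ p * k ∣ x} = (⋃ k : K, {x | p * (k : P) ∣ x})ᶜ := by
      ext x; simp
    rw [e]
    exact (step2 p).inter (Splits𝒜.iUnion fun k => step2 _).compl
  have step4 : ∀ U ∈ omegaCollection R, Splits𝒜 R U := by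
    rintro _ ⟨n, p, K, -, -, rfl⟩
    exact Splits𝒜.iUnion fun i => step3 _ _
  refine ⟨omegaCollection_empty, fun U hU => ?_, fun U V hU hV => ?_⟩
  · have := (step4 U hU _ univ_mem_omegaCollection).2
    rwa [← Set.compl_eq_univ_sdiff] at this
  · rw [← Set.union_sdiff_self]
    exact omegaCollection_union hU (step4 U hU V hV).2 Set.disjoint_sdiff_right

/-- Residuals of members of `𝒜_R`, if `𝒜_R` is an algebra. -/
theorem omegaCollection_residual (h1 : (1 : P) ∉ R)
    (hA : MeasureTheory.IsSetAlgebra (omegaCollection R)) (s : P) {U : Set P}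
    (hU : U ∈ omegaCollection R) : {x | s * x ∈ U} ∈ omegaCollection R := by
  obtain ⟨n, p, K, hK, hd, e⟩ := hA.inter_mem hU (omegaCollection_dvd s)
  -- As 1 ∉ R, each p_j lies in its own set p_jΩ_{K_j} and hence in sP. So p_j = s q_j, and the
  -- residual is the union of the sets q_jΩ_{K_j}.
  have hp : ∀ j, s ∣ p j := by
    intro j
    have : p j ∈ U ∩ {x | s ∣ x} := by
      rw [e]; exact Set.mem_iUnion.mpr ⟨j, self_mem_mulOmega hP h1 _ (hK j)⟩
    exact this.2
  choose q hq using hp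
  have hm : ∀ j x, s * x ∈ mulOmega (p j) (K j) ↔ x ∈ mulOmega (q j) (K j) := by
    intro j x
    constructor
    · rintro ⟨y, hy, h⟩
      refine ⟨y, hy, hP.cancel s _ _ ?_⟩
      rw [← h, ← mul_assoc, ← hq]
    · rintro ⟨y, hy, rfl⟩
      exact ⟨y, hy, by simp only [hq j, mul_assoc]⟩
  have e' : {x | s * x ∈ U} = ⋃ j, mulOmega (q j) (K j) := by
    ext x
    have : s * x ∈ U ↔ s * x ∈ U ∩ {x | s ∣ x} := ⟨fun h => ⟨h, x, rfl⟩, fun h => h.1⟩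
    rw [Set.mem_ofPred_eq, this, e, Set.mem_iUnion, Set.mem_iUnion]
    simp only [hm]
  rw [e']
  refine omegaCollection_of_finite _ _ hK fun i j hij => Set.disjoint_left.mpr fun x hx hx' => ?_
  exact Set.disjoint_left.mp (hd hij) ((hm i x).mpr hx) ((hm j x).mpr hx')

end OmegaCollection

/-! ## Presentations of free and direct products of Artin groups and monoids -/

section Presentations

/-- The family `f` satisfies the braid relations of `M`. -/
def SatisfiesBraid {B : Type u} (M : CoxeterMatrix B) {N : Type v} [Monoid N] (f : B → N) : Prop :=
  ∀ s t, M s t ≠ 0 →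
    (altWord (f s) (f t) (M s t)).prod = (altWord (f t) (f s) (M s t)).prod

variable {B : Type u} {M : CoxeterMatrix B} {N : Type v}

theorem SatisfiesBraid.map {N' : Type w} [Monoid N] [Monoid N'] {f : B → N}
    (hf : SatisfiesBraid M f) (φ : N →* N') : SatisfiesBraid M (φ ∘ f) := by
  intro s t h
  have := congrArg φ (hf s t h)
  rwa [map_list_prod, map_list_prod, map_altWord, map_altWord] at this

/-- The homomorphism from the Artin monoid given by a family that satisfies the braid relations. -/
def artinLift [Monoid N] (f : B → N) (hf : SatisfiesBraid M f) : ArtinMonoid M →* N :=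
  PresentedMonoid.lift f (by
    rintro x y ⟨s, t, h, rfl, rfl⟩
    rw [lift_ofList, lift_ofList, M.symmetric t s, map_altWord, map_altWord]
    exact hf s t h)

theorem artinLift_gen [Monoid N] (f : B → N) (hf : SatisfiesBraid M f) (b : B) :
    artinLift f hf (artinGen M b) = f b := rfl

theorem artinMonoid_hom_ext [Monoid N] {φ ψ : ArtinMonoid M →* N}
    (h : ∀ b, φ (artinGen M b) = ψ (artinGen M b)) : φ = ψ := PresentedMonoid.ext _ h

/-- The homomorphism from the Artin group given by a family that satisfies the braid relations. -/
def artinGroupLift [Group N] (f : B → N) (hf : SatisfiesBraid M f) : ArtinGroup M →* N :=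
  PresentedGroup.toGroup (f := f) (by
    rintro r ⟨s, t, h, rfl⟩
    rw [map_mul, map_inv, mul_inv_eq_one, groupWord, groupWord, map_list_prod, map_list_prod,
      List.map_map, List.map_map, M.symmetric t s]
    have : (FreeGroup.lift f) ∘ FreeGroup.of = f := by ext b; simp
    rw [this, map_altWord, map_altWord]
    exact hf s t h)

theorem artinGroupLift_gen [Group N] (f : B → N) (hf : SatisfiesBraid M f) (b : B) :
    artinGroupLift f hf (artinGroupGen M b) = f b := PresentedGroup.toGroup.of _

theorem artinGroup_hom_ext [Group N] {φ ψ : ArtinGroup M →* N}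
    (h : ∀ b, φ (artinGroupGen M b) = ψ (artinGroupGen M b)) : φ = ψ := PresentedGroup.ext h

variable (M) in
theorem satisfiesBraid_artinGen : SatisfiesBraid M (artinGen M) := by
  intro s t h
  have e : ∀ l : List B, artinWord M l = (l.map (artinGen M)).prod := by
    intro l
    induction l with
    | nil => rfl
    | cons s l ih => rw [artinWord_cons, List.map_cons, List.prod_cons, ih]
  rw [← map_altWord, ← map_altWord, ← e, ← e]
  exact artinAlt_braid M h

variable (M) in
theorem artinToGroup_gen (b : B) : artinToGroup M (artinGen M b) = artinGroupGen M b := rfl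

variable (M) in
theorem satisfiesBraid_artinGroupGen : SatisfiesBraid M (artinGroupGen M) :=
  (satisfiesBraid_artinGen M).map (artinToGroup M)

theorem commute_of_artinGen [Monoid N] {φ : ArtinMonoid M →* N} {y : N}
    (h : ∀ s, Commute (φ (artinGen M s)) y) (x : ArtinMonoid M) : Commute (φ x) y := by
  obtain ⟨l, rfl⟩ := exists_artinWord M x
  induction l with
  | nil => rw [artinWord_nil, map_one]; exact Commute.one_left y
  | cons s l ih => rw [artinWord_cons, map_mul]; exact (h s).mul_left ih

theorem commute_of_artinGroupGen [Group N] {φ : ArtinGroup M →* N} {y : N}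
    (h : ∀ s, Commute (φ (artinGroupGen M s)) y) (x : ArtinGroup M) : Commute (φ x) y := by
  have hx : x ∈ Subgroup.closure (Set.range (artinGroupGen M)) := by
    have := PresentedGroup.closure_range_of {r : FreeGroup B | ∃ s t : B, M s t ≠ 0 ∧
      r = groupWord (altWord s t (M s t)) * (groupWord (altWord t s (M t s)))⁻¹}
    exact this ▸ Subgroup.mem_top x
  induction hx using Subgroup.closure_induction with
  | mem x hx => obtain ⟨s, rfl⟩ := hx; exact h s
  | one => rw [map_one]; exact Commute.one_left y
  | mul x x' _ _ h1 h2 => rw [map_mul]; exact h1.mul_left h2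
  | inv x _ h1 => rw [map_inv]; exact h1.inv_left

variable {B₁ : Type u₁} {B₂ : Type u₂} {M₁ : CoxeterMatrix B₁} {M₂ : CoxeterMatrix B₂} {c : ℕ}
  {hc : c ≠ 1}

theorem satisfiesBraid_block [Monoid N] {f : B₁ ⊕ B₂ → N}
    (h1 : SatisfiesBraid M₁ (f ∘ Sum.inl)) (h2 : SatisfiesBraid M₂ (f ∘ Sum.inr))
    (h : c = 0 ∨ c = 2 ∧ ∀ s t, Commute (f (Sum.inl s)) (f (Sum.inr t))) :
    SatisfiesBraid (blockCoxeter M₁ M₂ c hc) f := by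
  rintro (s | s) (t | t) h0
  · exact h1 s t h0
  · rcases h with rfl | ⟨rfl, h⟩
    · exact absurd rfl h0
    · change [f (Sum.inl s), f (Sum.inr t)].prod = [f (Sum.inr t), f (Sum.inl s)].prod
      simpa using (h s t).eq
  · rcases h with rfl | ⟨rfl, h⟩
    · exact absurd rfl h0
    · change [f (Sum.inr s), f (Sum.inl t)].prod = [f (Sum.inl t), f (Sum.inr s)].prod
      simpa using (h t s).eq.symm
  · exact h2 s t h0

theorem SatisfiesBraid.inl [Monoid N] {f : B₁ ⊕ B₂ → N}
    (h : SatisfiesBraid (blockCoxeter M₁ M₂ c hc) f) : SatisfiesBraid M₁ (f ∘ Sum.inl) :=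
  fun s t h0 => h (Sum.inl s) (Sum.inl t) h0

theorem SatisfiesBraid.inr [Monoid N] {f : B₁ ⊕ B₂ → N}
    (h : SatisfiesBraid (blockCoxeter M₁ M₂ c hc) f) : SatisfiesBraid M₂ (f ∘ Sum.inr) :=
  fun s t h0 => h (Sum.inr s) (Sum.inr t) h0

theorem SatisfiesBraid.commute [Monoid N] {f : B₁ ⊕ B₂ → N}
    (h : SatisfiesBraid (directCoxeter M₁ M₂) f) (s : B₁) (t : B₂) :
    Commute (f (Sum.inl s)) (f (Sum.inr t)) := by
  have : [f (Sum.inl s), f (Sum.inr t)].prod = [f (Sum.inr t), f (Sum.inl s)].prod :=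
    h (Sum.inl s) (Sum.inr t) two_ne_zero
  rw [Commute, SemiconjBy]
  simpa using this

variable (M₁ M₂)

theorem satisfiesBraid_freeGen : SatisfiesBraid (freeCoxeter M₁ M₂) (freeGen M₁ M₂) :=
  satisfiesBraid_block (f := freeGen M₁ M₂)
    ((satisfiesBraid_artinGen M₁).map (Monoid.Coprod.inl (N := ArtinMonoid M₂)))
    ((satisfiesBraid_artinGen M₂).map (Monoid.Coprod.inr (M := ArtinMonoid M₁))) (Or.inl rfl)

theorem satisfiesBraid_directGen : SatisfiesBraid (directCoxeter M₁ M₂) (directGen M₁ M₂) := by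
  refine satisfiesBraid_block (f := directGen M₁ M₂)
    ((satisfiesBraid_artinGen M₁).map (MonoidHom.inl _ (ArtinMonoid M₂)))
    ((satisfiesBraid_artinGen M₂).map (MonoidHom.inr (ArtinMonoid M₁) _)) (Or.inr ⟨rfl, fun s t => ?_⟩)
  simp [directGen, Commute, SemiconjBy]

/-- The Artin monoid of the free product matrix is the free product. -/
def artinFreeEquiv : ArtinMonoid (freeCoxeter M₁ M₂) ≃*
    Monoid.Coprod (ArtinMonoid M₁) (ArtinMonoid M₂) :=
  MonoidHom.toMulEquiv (artinLift (freeGen M₁ M₂) (satisfiesBraid_freeGen M₁ M₂))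
    (Monoid.Coprod.lift (artinLift _ (satisfiesBraid_artinGen (freeCoxeter M₁ M₂)).inl)
      (artinLift _ (satisfiesBraid_artinGen (freeCoxeter M₁ M₂)).inr))
    (artinMonoid_hom_ext (by rintro (b | b) <;> rfl))
    (Monoid.Coprod.hom_ext (artinMonoid_hom_ext fun _ => rfl) (artinMonoid_hom_ext fun _ => rfl))

theorem artinFreeEquiv_gen (b : B₁ ⊕ B₂) :
    artinFreeEquiv M₁ M₂ (artinGen _ b) = freeGen M₁ M₂ b := rfl

/-- The Artin monoid of the direct product matrix is the direct product. -/
def artinDirectEquiv : ArtinMonoid (directCoxeter M₁ M₂) ≃* ArtinMonoid M₁ × ArtinMonoid M₂ :=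
  MonoidHom.toMulEquiv (artinLift (directGen M₁ M₂) (satisfiesBraid_directGen M₁ M₂))
    (MonoidHom.noncommCoprod (artinLift _ (satisfiesBraid_artinGen (directCoxeter M₁ M₂)).inl)
      (artinLift _ (satisfiesBraid_artinGen (directCoxeter M₁ M₂)).inr)
      (fun x y => commute_of_artinGen (fun s => (commute_of_artinGen (fun t =>
        ((satisfiesBraid_artinGen (directCoxeter M₁ M₂)).commute s t).symm) y).symm) x))
    (artinMonoid_hom_ext (by rintro (b | b) <;> simp [artinLift_gen, directGen]))
    (MonoidHom.ext fun ⟨x, y⟩ => by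
      have e1 : ((artinLift (directGen M₁ M₂) (satisfiesBraid_directGen M₁ M₂)).comp
          (artinLift _ (satisfiesBraid_artinGen (directCoxeter M₁ M₂)).inl)) =
          MonoidHom.inl (ArtinMonoid M₁) (ArtinMonoid M₂) := artinMonoid_hom_ext fun _ => rfl
      have e2 : ((artinLift (directGen M₁ M₂) (satisfiesBraid_directGen M₁ M₂)).comp
          (artinLift _ (satisfiesBraid_artinGen (directCoxeter M₁ M₂)).inr)) =
          MonoidHom.inr (ArtinMonoid M₁) (ArtinMonoid M₂) := artinMonoid_hom_ext fun _ => rfl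
      rw [MonoidHom.comp_apply, MonoidHom.noncommCoprod_apply, map_mul, ← MonoidHom.comp_apply, e1,
        ← MonoidHom.comp_apply, e2]
      simp)

theorem artinDirectEquiv_gen (b : B₁ ⊕ B₂) :
    artinDirectEquiv M₁ M₂ (artinGen _ b) = directGen M₁ M₂ b := rfl

/-- The free product of Artin group-monoid pairs is the Artin pair of the free product matrix. -/
theorem isArtinPair_free : IsArtinPair (freeCoxeter M₁ M₂)
    (Monoid.Coprod.map (artinToGroup M₁) (artinToGroup M₂)) (freeGen M₁ M₂) := by
  let f : B₁ ⊕ B₂ → Monoid.Coprod (ArtinGroup M₁) (ArtinGroup M₂) :=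
    (Monoid.Coprod.map (artinToGroup M₁) (artinToGroup M₂)) ∘ freeGen M₁ M₂
  have hf : SatisfiesBraid (freeCoxeter M₁ M₂) f :=
    (satisfiesBraid_freeGen M₁ M₂).map (Monoid.Coprod.map (artinToGroup M₁) (artinToGroup M₂))
  have hg := satisfiesBraid_artinGroupGen (freeCoxeter M₁ M₂)
  let e : ArtinGroup (freeCoxeter M₁ M₂) ≃* Monoid.Coprod (ArtinGroup M₁) (ArtinGroup M₂) :=
    MonoidHom.toMulEquiv (artinGroupLift f hf)
      (Monoid.Coprod.lift (artinGroupLift _ hg.inl) (artinGroupLift _ hg.inr))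
      (artinGroup_hom_ext (by
        rintro (b | b) <;> simp [artinGroupLift_gen, f, freeGen, artinToGroup_gen]))
      (Monoid.Coprod.hom_ext
        (artinGroup_hom_ext fun _ => by
          simp [artinGroupLift_gen, f, freeGen, artinToGroup_gen])
        (artinGroup_hom_ext fun _ => by
          simp [artinGroupLift_gen, f, freeGen, artinToGroup_gen]))
  refine ⟨artinFreeEquiv M₁ M₂, e, artinFreeEquiv_gen M₁ M₂, ?_⟩
  have : (e.toMonoidHom.comp (artinToGroup _)) =
      (Monoid.Coprod.map (artinToGroup M₁) (artinToGroup M₂)).comp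
        (artinFreeEquiv M₁ M₂).toMonoidHom := artinMonoid_hom_ext fun b =>
    artinGroupLift_gen f hf b
  exact fun x => DFunLike.congr_fun this x

/-- The direct product of Artin group-monoid pairs is the Artin pair of the direct product
matrix. -/
theorem isArtinPair_direct : IsArtinPair (directCoxeter M₁ M₂)
    (MonoidHom.prodMap (artinToGroup M₁) (artinToGroup M₂)) (directGen M₁ M₂) := by
  let f : B₁ ⊕ B₂ → ArtinGroup M₁ × ArtinGroup M₂ :=
    (MonoidHom.prodMap (artinToGroup M₁) (artinToGroup M₂)) ∘ directGen M₁ M₂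
  have hf : SatisfiesBraid (directCoxeter M₁ M₂) f :=
    (satisfiesBraid_directGen M₁ M₂).map (MonoidHom.prodMap (artinToGroup M₁) (artinToGroup M₂))
  have hg := satisfiesBraid_artinGroupGen (directCoxeter M₁ M₂)
  have e1 : (artinGroupLift f hf).comp (artinGroupLift _ hg.inl) =
      MonoidHom.inl (ArtinGroup M₁) (ArtinGroup M₂) := artinGroup_hom_ext fun b => by
    rw [MonoidHom.comp_apply, artinGroupLift_gen, Function.comp_apply, artinGroupLift_gen]; rfl
  have e2 : (artinGroupLift f hf).comp (artinGroupLift _ hg.inr) =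
      MonoidHom.inr (ArtinGroup M₁) (ArtinGroup M₂) := artinGroup_hom_ext fun b => by
    rw [MonoidHom.comp_apply, artinGroupLift_gen, Function.comp_apply, artinGroupLift_gen]; rfl
  let e : ArtinGroup (directCoxeter M₁ M₂) ≃* ArtinGroup M₁ × ArtinGroup M₂ :=
    MonoidHom.toMulEquiv (artinGroupLift f hf)
      (MonoidHom.noncommCoprod (artinGroupLift _ hg.inl) (artinGroupLift _ hg.inr)
        (fun x y => commute_of_artinGroupGen (fun s => (commute_of_artinGroupGen (fun t => by
          rw [artinGroupLift_gen, artinGroupLift_gen]; exact (hg.commute s t).symm) y).symm) x))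
      (artinGroup_hom_ext (by
        rintro (b | b) <;> simp [artinGroupLift_gen, f, directGen, artinToGroup_gen]))
      (MonoidHom.ext fun ⟨x, y⟩ => by
        rw [MonoidHom.comp_apply, MonoidHom.noncommCoprod_apply, map_mul, ← MonoidHom.comp_apply,
          e1, ← MonoidHom.comp_apply, e2]
        simp)
  refine ⟨artinDirectEquiv M₁ M₂, e, artinDirectEquiv_gen M₁ M₂, ?_⟩
  have : (e.toMonoidHom.comp (artinToGroup _)) =
      (MonoidHom.prodMap (artinToGroup M₁) (artinToGroup M₂)).comp
        (artinDirectEquiv M₁ M₂).toMonoidHom := artinMonoid_hom_ext fun b =>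
    artinGroupLift_gen f hf b
  exact fun x => DFunLike.congr_fun this x

end Presentations

/-! ## The collections `𝒜_R` of direct and free products -/

section ProductCollections

variable {P₁ : Type u₁} {P₂ : Type u₂} [Monoid P₁] [Monoid P₂]
  {R₁ : Set P₁} {R₂ : Set P₂} {len₁ : P₁ → ℕ} {len₂ : P₂ → ℕ}

-- A generator of the form (a, 1) restricts only the first coordinate and one of the form (1, b)
-- only the second.
open Classical in
theorem omegaSet_prod {K : Finset (P₁ × P₂)}
    (hK : (K : Set (P₁ × P₂)) ⊆ (fun x => (x, 1)) '' R₁ ∪ (fun y => (1, y)) '' R₂) :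
    ∃ (K₁ : Finset P₁) (K₂ : Finset P₂), (K₁ : Set P₁) ⊆ R₁ ∧ (K₂ : Set P₂) ⊆ R₂ ∧
      omegaSet K = omegaSet K₁ ×ˢ omegaSet K₂ := by
  refine ⟨(K.filter fun k => k.2 = 1 ∧ k.1 ∈ R₁).image Prod.fst,
    (K.filter fun k => k.1 = 1 ∧ k.2 ∈ R₂).image Prod.snd, ?_, ?_, ?_⟩
  · intro x hx
    obtain ⟨k, hk, rfl⟩ := Finset.mem_image.mp hx
    exact (Finset.mem_filter.mp hk).2.2
  · intro x hx
    obtain ⟨k, hk, rfl⟩ := Finset.mem_image.mp hx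
    exact (Finset.mem_filter.mp hk).2.2
  · ext ⟨x, y⟩
    simp only [mem_omegaSet, Set.mem_prod, Finset.mem_image, Finset.mem_filter]
    constructor
    · intro h
      constructor
      · rintro _ ⟨⟨a, b⟩, ⟨hk, rfl : b = 1, -⟩, rfl⟩ ⟨c, hc⟩
        exact h _ hk ⟨(c, y), Prod.ext hc (one_mul y).symm⟩
      · rintro _ ⟨⟨a, b⟩, ⟨hk, rfl : a = 1, -⟩, rfl⟩ ⟨c, hc⟩
        exact h _ hk ⟨(x, c), Prod.ext (one_mul x).symm hc⟩
    · rintro ⟨h1, h2⟩ k hk ⟨⟨c, d⟩, hc⟩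
      rcases hK hk with ⟨a, ha, rfl⟩ | ⟨a, ha, rfl⟩
      · exact h1 a ⟨_, ⟨hk, rfl, ha⟩, rfl⟩ ⟨c, congrArg Prod.fst hc⟩
      · exact h2 a ⟨_, ⟨hk, rfl, ha⟩, rfl⟩ ⟨d, congrArg Prod.snd hc⟩

open Classical in
theorem mulOmega_prod (p : P₁) (q : P₂) (K₁ : Finset P₁) (K₂ : Finset P₂) :
    mulOmega (p, q) (K₁.image (fun x => (x, 1)) ∪ K₂.image (fun y => (1, y))) =
      mulOmega p K₁ ×ˢ mulOmega q K₂ := by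
  ext ⟨x, y⟩
  constructor
  · rintro ⟨⟨a, b⟩, h, e⟩
    refine ⟨⟨a, fun k hk hd => ?_, congrArg Prod.fst e⟩, ⟨b, fun k hk hd => ?_, congrArg Prod.snd e⟩⟩
    · obtain ⟨c, rfl⟩ := hd
      exact h (k, 1) (Finset.mem_union_left _ (Finset.mem_image_of_mem _ hk))
        ⟨(c, b), Prod.ext rfl (one_mul b).symm⟩
    · obtain ⟨c, rfl⟩ := hd
      exact h (1, k) (Finset.mem_union_right _ (Finset.mem_image_of_mem _ hk))
        ⟨(a, c), Prod.ext (one_mul a).symm rfl⟩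
  · rintro ⟨⟨a, ha, e1⟩, ⟨b, hb, e2⟩⟩
    refine ⟨(a, b), fun k hk hd => ?_, Prod.ext e1 e2⟩
    obtain ⟨⟨c, d⟩, hc⟩ := hd
    rcases Finset.mem_union.mp hk with hk | hk
    · obtain ⟨k, hk', rfl⟩ := Finset.mem_image.mp hk
      exact ha k hk' ⟨c, congrArg Prod.fst hc⟩
    · obtain ⟨k, hk', rfl⟩ := Finset.mem_image.mp hk
      exact hb k hk' ⟨d, congrArg Prod.snd hc⟩

-- The residual criterion applies to rectangles: a generator acts on one side only, and there
-- residuals and differences stay in the algebra of the factor.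
open Classical in
theorem isSetAlgebra_prod {len : P₁ × P₂ → ℕ} (hP : IsGradedLCMMonoid (P₁ × P₂) len)
    (hP₁ : IsGradedLCMMonoid P₁ len₁) (hP₂ : IsGradedLCMMonoid P₂ len₂)
    (hR₁ : (1 : P₁) ∉ R₁) (hR₂ : (1 : P₂) ∉ R₂)
    (hA₁ : MeasureTheory.IsSetAlgebra (omegaCollection R₁))
    (hA₂ : MeasureTheory.IsSetAlgebra (omegaCollection R₂))
    (hgen : GeneratedBy ((fun x => ((x, 1) : P₁ × P₂)) '' R₁ ∪ (fun y => (1, y)) '' R₂)) :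
    MeasureTheory.IsSetAlgebra
      (omegaCollection ((fun x => ((x, 1) : P₁ × P₂)) '' R₁ ∪ (fun y => (1, y)) '' R₂)) := by
  refine isSetAlgebra_of_residuals hP ?_ hgen
    {V | ∃ U₁ ∈ omegaCollection R₁, ∃ U₂ ∈ omegaCollection R₂, V = U₁ ×ˢ U₂} ?_ ?_ ?_ ?_
  · rintro (⟨x, hx, e⟩ | ⟨x, hx, e⟩)
    · exact hR₁ ((show x = 1 from congrArg Prod.fst e) ▸ hx)
    · exact hR₂ ((show x = 1 from congrArg Prod.snd e) ▸ hx)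
  · intro K hK
    obtain ⟨K₁, K₂, h1, h2, e⟩ := omegaSet_prod hK
    exact ⟨_, omegaSet_mem h1, _, omegaSet_mem h2, e⟩
  · rintro _ ⟨_, ⟨n, p, K, hK, hd, rfl⟩, _, ⟨m, q, L, hL, hd', rfl⟩, rfl⟩
    have e : (⋃ j, mulOmega (p j) (K j)) ×ˢ (⋃ j, mulOmega (q j) (L j)) =
        ⋃ r : Fin n × Fin m, mulOmega (p r.1, q r.2)
          ((K r.1).image (fun x => (x, 1)) ∪ (L r.2).image (fun y => (1, y))) := by
      simp only [mulOmega_prod]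
      ext ⟨x, y⟩
      simp only [Set.mem_prod, Set.mem_iUnion, Prod.exists]
      exact ⟨fun ⟨⟨i, hi⟩, j, hj⟩ => ⟨i, j, hi, hj⟩, fun ⟨i, j, hi, hj⟩ => ⟨⟨i, hi⟩, j, hj⟩⟩
    rw [e]
    refine omegaCollection_of_finite _ _ (fun r k hk => ?_) ?_
    · rcases Finset.mem_union.mp (Finset.mem_coe.mp hk) with hk | hk
      · obtain ⟨k, hk', rfl⟩ := Finset.mem_image.mp hk
        exact Or.inl ⟨k, hK _ hk', rfl⟩
      · obtain ⟨k, hk', rfl⟩ := Finset.mem_image.mp hk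
        exact Or.inr ⟨k, hL _ hk', rfl⟩
    · rintro ⟨i, j⟩ ⟨i', j'⟩ hne
      rw [mulOmega_prod, mulOmega_prod, Set.disjoint_prod]
      by_cases hi : i = i'
      · subst hi
        exact Or.inr (hd' fun h => hne (congrArg (Prod.mk i) h))
      · exact Or.inl (hd hi)
  · rintro _ (⟨s, hs, rfl⟩ | ⟨s, hs, rfl⟩) _ ⟨U₁, h1, U₂, h2, rfl⟩
    · refine ⟨_, omegaCollection_residual hP₁ hR₁ hA₁ s h1, U₂, h2, ?_⟩
      ext ⟨x, y⟩; simp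
    · refine ⟨U₁, h1, _, omegaCollection_residual hP₂ hR₂ hA₂ s h2, ?_⟩
      ext ⟨x, y⟩; simp
  · rintro _ (⟨s, hs, rfl⟩ | ⟨s, hs, rfl⟩) _ ⟨U₁, h1, U₂, h2, rfl⟩
    · refine ⟨_, hA₁.sdiff_mem h1 (omegaCollection_dvd s), U₂, h2, ?_⟩
      ext ⟨x, y⟩
      have : (s, (1 : P₂)) ∣ (x, y) ↔ s ∣ x :=
        ⟨fun ⟨c, hc⟩ => ⟨c.1, congrArg Prod.fst hc⟩,
          fun ⟨c, hc⟩ => ⟨(c, y), Prod.ext hc (one_mul y).symm⟩⟩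
      simp only [Set.mem_sdiff, Set.mem_prod, Set.mem_ofPred_eq, this]
      tauto
    · refine ⟨U₁, h1, _, hA₂.sdiff_mem h2 (omegaCollection_dvd s), ?_⟩
      ext ⟨x, y⟩
      have : ((1 : P₁), s) ∣ (x, y) ↔ s ∣ y :=
        ⟨fun ⟨c, hc⟩ => ⟨c.2, congrArg Prod.snd hc⟩,
          fun ⟨c, hc⟩ => ⟨(x, c), Prod.ext (one_mul x).symm hc⟩⟩
      simp only [Set.mem_sdiff, Set.mem_prod, Set.mem_ofPred_eq, this]
      tauto

/-- The head maps `f₁`, `f₂` of a free product of two monoids without units: the first syllable of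
an element, if it lies in the given factor, and `1` otherwise. -/
structure IsHeadPair {P : Type u} [Monoid P] (i₁ : P₁ →* P) (i₂ : P₂ →* P) (f₁ : P → P₁)
    (f₂ : P → P₂) : Prop where
  mul₁ : ∀ x z, f₁ (i₁ x * z) = x * f₁ z
  mul₂ : ∀ y z, f₂ (i₂ y * z) = y * f₂ z
  eq_one₂ : ∀ x z, x ≠ 1 → f₂ (i₁ x * z) = 1
  eq_one₁ : ∀ y z, y ≠ 1 → f₁ (i₂ y * z) = 1
  eq_one : ∀ z, f₁ z = 1 ∨ f₂ z = 1
  factor₁ : ∀ z, ∃ z', z = i₁ (f₁ z) * z' ∧ f₁ z' = 1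
  factor₂ : ∀ z, ∃ z', z = i₂ (f₂ z) * z' ∧ f₂ z' = 1

/-! ### Heads of elements and the algebra of a free product -/

namespace IsHeadPair

variable {P : Type u} [Monoid P] {i₁ : P₁ →* P} {i₂ : P₂ →* P} {f₁ : P → P₁} {f₂ : P → P₂}

theorem symm (h : IsHeadPair i₁ i₂ f₁ f₂) : IsHeadPair i₂ i₁ f₂ f₁ :=
  ⟨h.mul₂, h.mul₁, h.eq_one₁, h.eq_one₂, fun z => (h.eq_one z).symm, h.factor₂, h.factor₁⟩

theorem dvd_iff (h : IsHeadPair i₁ i₂ f₁ f₂) {k : P₁} {z : P} : i₁ k ∣ z ↔ k ∣ f₁ z := by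
  constructor
  · rintro ⟨c, rfl⟩
    exact ⟨_, h.mul₁ k c⟩
  · rintro ⟨c, hc⟩
    obtain ⟨z', hz, -⟩ := h.factor₁ z
    refine ⟨i₁ c * z', ?_⟩
    rw [← mul_assoc, ← map_mul, ← hc, ← hz]

open Classical in
theorem preimage_mulOmega (h : IsHeadPair i₁ i₂ f₁ f₂) (p : P₁) (K : Finset P₁) :
    {z | f₁ z ∈ mulOmega p K} = mulOmega (i₁ p) (K.image i₁) := by
  ext z
  constructor
  · rintro ⟨y, hy, hz⟩
    obtain ⟨z', hz', h1⟩ := h.factor₁ z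
    refine ⟨i₁ y * z', fun k hk => ?_, ?_⟩
    · obtain ⟨k, hk', rfl⟩ := Finset.mem_image.mp hk
      rw [h.dvd_iff, h.mul₁, h1, mul_one]
      exact hy k hk'
    · change i₁ p * (i₁ y * z') = z
      have hz : p * y = f₁ z := hz
      rw [← mul_assoc, ← map_mul, hz, ← hz']
  · rintro ⟨y, hy, rfl⟩
    refine ⟨f₁ y, fun k hk hd => hy (i₁ k) (Finset.mem_image_of_mem _ hk) (h.dvd_iff.mpr hd), ?_⟩
    exact (h.mul₁ p y).symm

open Classical in
theorem preimage_mem (h : IsHeadPair i₁ i₂ f₁ f₂) {U : Set P₁} (hU : U ∈ omegaCollection R₁) :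
    {z | f₁ z ∈ U} ∈ omegaCollection (i₁ '' R₁ ∪ i₂ '' R₂) := by
  obtain ⟨n, p, K, hK, hd, rfl⟩ := hU
  have e : {z | f₁ z ∈ ⋃ j, mulOmega (p j) (K j)} =
      ⋃ j, mulOmega (i₁ (p j)) ((K j).image i₁) := by
    ext z
    simp only [← h.preimage_mulOmega, Set.mem_ofPred_eq, Set.mem_iUnion]
  rw [e]
  refine omegaCollection_of_finite _ _ (fun j k hk => ?_) fun i j hij => ?_
  · obtain ⟨k, hk', rfl⟩ := Finset.mem_image.mp (Finset.mem_coe.mp hk)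
    exact Or.inl ⟨k, hK _ hk', rfl⟩
  · change Disjoint (mulOmega _ _) (mulOmega _ _)
    rw [← h.preimage_mulOmega, ← h.preimage_mulOmega]
    exact Set.disjoint_left.mpr fun z hz hz' => Set.disjoint_left.mp (hd hij) hz hz'

/-- A member of `𝒜_R` that contains the identity contains some `Ω_K`. -/
theorem exists_omegaSet_subset (hP₁ : IsGradedLCMMonoid P₁ len₁) {U : Set P₁}
    (hU : U ∈ omegaCollection R₁) (h1 : 1 ∈ U) :
    ∃ K : Finset P₁, (K : Set P₁) ⊆ R₁ ∧ omegaSet K ⊆ U := by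
  obtain ⟨n, p, K, hK, hd, rfl⟩ := hU
  obtain ⟨j, y, hy, e⟩ := Set.mem_iUnion.mp h1
  refine ⟨K j, hK j, ?_⟩
  have := Set.subset_iUnion (fun j => mulOmega (p j) (K j)) j
  simp only [hP₁.eq_one_of_mul_eq_one e, mulOmega_one] at this
  exact this

theorem one_mem_omegaSet (hP₁ : IsGradedLCMMonoid P₁ len₁) (hR₁ : (1 : P₁) ∉ R₁) {K : Finset P₁}
    (hK : (K : Set P₁) ⊆ R₁) : 1 ∈ omegaSet K := by
  have := self_mem_mulOmega hP₁ hR₁ 1 hK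
  rwa [mulOmega_one] at this

-- One of the two heads is always 1. If 1 is missing from `U₁` or `U₂`, the set is therefore empty
-- or given by a single head. If 1 lies in both, choose Ω_K ⊆ `U₁` and Ω_L ⊆ `U₂`: a head outside
-- Ω_K is not 1, so the other head is 1 and its condition is automatic. This leaves three disjoint
-- pieces.
open Classical in
theorem preimage_inter_mem (h : IsHeadPair i₁ i₂ f₁ f₂) (hP₁ : IsGradedLCMMonoid P₁ len₁)
    (hP₂ : IsGradedLCMMonoid P₂ len₂) (hR₁ : (1 : P₁) ∉ R₁) (hR₂ : (1 : P₂) ∉ R₂)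
    (hA₁ : MeasureTheory.IsSetAlgebra (omegaCollection R₁))
    (hA₂ : MeasureTheory.IsSetAlgebra (omegaCollection R₂)) {U₁ : Set P₁} {U₂ : Set P₂}
    (h1 : U₁ ∈ omegaCollection R₁) (h2 : U₂ ∈ omegaCollection R₂) :
    {z | f₁ z ∈ U₁ ∧ f₂ z ∈ U₂} ∈ omegaCollection (i₁ '' R₁ ∪ i₂ '' R₂) := by
  have half₁ : ∀ V ∈ omegaCollection R₁, {z | f₁ z ∈ V} ∈ omegaCollection (i₁ '' R₁ ∪ i₂ '' R₂) :=
    fun V hV => h.preimage_mem hV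
  have half₂ : ∀ V ∈ omegaCollection R₂,
      {z | f₂ z ∈ V} ∈ omegaCollection (i₁ '' R₁ ∪ i₂ '' R₂) := fun V hV => by
    rw [Set.union_comm]; exact h.symm.preimage_mem hV
  by_cases o1 : 1 ∈ U₁ <;> by_cases o2 : 1 ∈ U₂
  · obtain ⟨K, hK, hKU⟩ := exists_omegaSet_subset hP₁ h1 o1
    obtain ⟨L, hL, hLU⟩ := exists_omegaSet_subset hP₂ h2 o2
    have k1 := one_mem_omegaSet hP₁ hR₁ hK
    have l1 := one_mem_omegaSet hP₂ hR₂ hL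
    have e0 : ∀ z, z ∈ omegaSet (K.image i₁ ∪ L.image i₂) ↔
        f₁ z ∈ omegaSet K ∧ f₂ z ∈ omegaSet L := by
      intro z
      constructor
      · intro hz
        exact ⟨fun k hk hd => hz _ (Finset.mem_union_left _ (Finset.mem_image_of_mem _ hk))
            (h.dvd_iff.mpr hd),
          fun k hk hd => hz _ (Finset.mem_union_right _ (Finset.mem_image_of_mem _ hk))
            (h.symm.dvd_iff.mpr hd)⟩
      · rintro ⟨z1, z2⟩ k hk
        rcases Finset.mem_union.mp hk with hk | hk
        · obtain ⟨k, hk', rfl⟩ := Finset.mem_image.mp hk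
          exact fun hd => z1 k hk' (h.dvd_iff.mp hd)
        · obtain ⟨k, hk', rfl⟩ := Finset.mem_image.mp hk
          exact fun hd => z2 k hk' (h.symm.dvd_iff.mp hd)
    have e : {z | f₁ z ∈ U₁ ∧ f₂ z ∈ U₂} = omegaSet (K.image i₁ ∪ L.image i₂) ∪
        ({z | f₁ z ∈ U₁ \ omegaSet K} ∪ {z | f₂ z ∈ U₂ \ omegaSet L}) := by
      ext z
      simp only [Set.mem_union, e0, Set.mem_ofPred_eq, Set.mem_sdiff]
      constructor
      · rintro ⟨z1, z2⟩
        by_cases c1 : f₁ z ∈ omegaSet K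
        · by_cases c2 : f₂ z ∈ omegaSet L
          · exact Or.inl ⟨c1, c2⟩
          · exact Or.inr (Or.inr ⟨z2, c2⟩)
        · exact Or.inr (Or.inl ⟨z1, c1⟩)
      · rintro (⟨z1, z2⟩ | ⟨z1, z2⟩ | ⟨z1, z2⟩)
        · exact ⟨hKU z1, hLU z2⟩
        · refine ⟨z1, ?_⟩
          rcases h.eq_one z with c | c
          · rw [c] at z2; exact absurd k1 z2
          · rwa [c]
        · refine ⟨?_, z1⟩
          rcases h.eq_one z with c | c
          · rwa [c]
          · rw [c] at z2; exact absurd l1 z2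
    rw [e]
    refine omegaCollection_union (omegaSet_mem ?_) (omegaCollection_union
      (half₁ _ (hA₁.sdiff_mem h1 (omegaSet_mem hK))) (half₂ _ (hA₂.sdiff_mem h2 (omegaSet_mem hL)))
      ?_) ?_
    · intro k hk
      rcases Finset.mem_union.mp (Finset.mem_coe.mp hk) with hk | hk
      · obtain ⟨k, hk', rfl⟩ := Finset.mem_image.mp hk
        exact Or.inl ⟨k, hK hk', rfl⟩
      · obtain ⟨k, hk', rfl⟩ := Finset.mem_image.mp hk
        exact Or.inr ⟨k, hL hk', rfl⟩
    · refine Set.disjoint_left.mpr fun z z1 z2 => ?_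
      rcases h.eq_one z with c | c
      · exact z1.2 (by rw [c]; exact k1)
      · exact z2.2 (by rw [c]; exact l1)
    · refine Set.disjoint_left.mpr fun z z1 z2 => ?_
      rw [e0] at z1
      rcases z2 with z2 | z2
      · exact z2.2 z1.1
      · exact z2.2 z1.2
  · have e : {z | f₁ z ∈ U₁ ∧ f₂ z ∈ U₂} = {z | f₂ z ∈ U₂} := by
      ext z
      refine ⟨fun hz => hz.2, fun hz => ⟨?_, hz⟩⟩
      rcases h.eq_one z with c | c
      · rwa [c]
      · exact absurd (c ▸ hz) o2
    rw [e]; exact half₂ _ h2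
  · have e : {z | f₁ z ∈ U₁ ∧ f₂ z ∈ U₂} = {z | f₁ z ∈ U₁} := by
      ext z
      refine ⟨fun hz => hz.1, fun hz => ⟨hz, ?_⟩⟩
      rcases h.eq_one z with c | c
      · exact absurd (c ▸ hz) o1
      · rwa [c]
    rw [e]; exact half₁ _ h1
  · have e : {z | f₁ z ∈ U₁ ∧ f₂ z ∈ U₂} = ∅ := by
      ext z
      simp only [Set.mem_ofPred_eq, Set.mem_empty_iff_false, iff_false, not_and]
      intro z1 z2
      rcases h.eq_one z with c | c
      · exact o1 (c ▸ z1)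
      · exact o2 (c ▸ z2)
    rw [e]; exact omegaCollection_empty

open Classical in
theorem omegaSet_eq (h : IsHeadPair i₁ i₂ f₁ f₂) {K : Finset P}
    (hK : (K : Set P) ⊆ i₁ '' R₁ ∪ i₂ '' R₂) :
    ∃ (K₁ : Finset P₁) (K₂ : Finset P₂), (K₁ : Set P₁) ⊆ R₁ ∧ (K₂ : Set P₂) ⊆ R₂ ∧
      omegaSet K = {z | f₁ z ∈ omegaSet K₁ ∧ f₂ z ∈ omegaSet K₂} := by
  induction K using Finset.induction_on with
  | empty => exact ⟨∅, ∅, by simp, by simp, by simp [omegaSet_empty]⟩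
  | insert a K _ ih =>
    obtain ⟨K₁, K₂, h1, h2, e⟩ := ih fun k hk => hK (Finset.mem_insert_of_mem hk)
    have e' : omegaSet (insert a K) = {z | ¬ a ∣ z} ∩ omegaSet K := by
      ext z; simp [mem_omegaSet]
    have ins₁ : ∀ (b : P₁) (x : P₁), x ∈ omegaSet (insert b K₁) ↔ ¬ b ∣ x ∧ x ∈ omegaSet K₁ := by
      intro b x; simp [mem_omegaSet]
    have ins₂ : ∀ (b : P₂) (x : P₂), x ∈ omegaSet (insert b K₂) ↔ ¬ b ∣ x ∧ x ∈ omegaSet K₂ := by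
      intro b x; simp [mem_omegaSet]
    rcases hK (Finset.mem_insert_self a K) with ⟨b, hb, rfl⟩ | ⟨b, hb, rfl⟩
    · refine ⟨insert b K₁, K₂, ?_, h2, ?_⟩
      · rw [Finset.coe_insert]; exact Set.insert_subset hb h1
      · rw [e', e]
        ext z
        simp only [Set.mem_inter_iff, Set.mem_ofPred_eq, ins₁, h.dvd_iff]
        tauto
    · refine ⟨K₁, insert b K₂, h1, ?_, ?_⟩
      · rw [Finset.coe_insert]; exact Set.insert_subset hb h2
      · rw [e', e]
        ext z
        simp only [Set.mem_inter_iff, Set.mem_ofPred_eq, ins₂, h.symm.dvd_iff]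
        tauto

/-- The residual criterion applies to conditions on both heads. A generator of one factor multiplies
the head in that factor and resets the other to 1, so the residual of the other condition is
everything or nothing. -/
theorem isSetAlgebra (h : IsHeadPair i₁ i₂ f₁ f₂) {len : P → ℕ} (hP : IsGradedLCMMonoid P len)
    (hP₁ : IsGradedLCMMonoid P₁ len₁) (hP₂ : IsGradedLCMMonoid P₂ len₂)
    (hR₁ : (1 : P₁) ∉ R₁) (hR₂ : (1 : P₂) ∉ R₂)
    (hA₁ : MeasureTheory.IsSetAlgebra (omegaCollection R₁))
    (hA₂ : MeasureTheory.IsSetAlgebra (omegaCollection R₂))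
    (hone : (1 : P) ∉ i₁ '' R₁ ∪ i₂ '' R₂) (hgen : GeneratedBy (i₁ '' R₁ ∪ i₂ '' R₂)) :
    MeasureTheory.IsSetAlgebra (omegaCollection (i₁ '' R₁ ∪ i₂ '' R₂)) := by
  refine isSetAlgebra_of_residuals hP hone hgen {V | ∃ U₁ ∈ omegaCollection R₁,
    ∃ U₂ ∈ omegaCollection R₂, V = {z | f₁ z ∈ U₁ ∧ f₂ z ∈ U₂}} ?_ ?_ ?_ ?_
  · intro K hK
    obtain ⟨K₁, K₂, h1, h2, e⟩ := h.omegaSet_eq hK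
    exact ⟨_, omegaSet_mem h1, _, omegaSet_mem h2, e⟩
  · rintro _ ⟨U₁, h1, U₂, h2, rfl⟩
    exact h.preimage_inter_mem hP₁ hP₂ hR₁ hR₂ hA₁ hA₂ h1 h2
  · rintro _ (⟨s, hs, rfl⟩ | ⟨s, hs, rfl⟩) _ ⟨U₁, h1, U₂, h2, rfl⟩
    · have hs1 : s ≠ 1 := fun e => hR₁ (e ▸ hs)
      refine ⟨_, omegaCollection_residual hP₁ hR₁ hA₁ s h1, {_y | 1 ∈ U₂}, ?_, ?_⟩
      · by_cases o : 1 ∈ U₂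
        · simpa only [o, Set.ofPred_true] using univ_mem_omegaCollection
        · simpa only [o, Set.ofPred_false] using omegaCollection_empty
      · ext z
        simp only [Set.mem_ofPred_eq, h.mul₁, h.eq_one₂ s z hs1]
    · have hs1 : s ≠ 1 := fun e => hR₂ (e ▸ hs)
      refine ⟨{_y | 1 ∈ U₁}, ?_, _, omegaCollection_residual hP₂ hR₂ hA₂ s h2, ?_⟩
      · by_cases o : 1 ∈ U₁
        · simpa only [o, Set.ofPred_true] using univ_mem_omegaCollection
        · simpa only [o, Set.ofPred_false] using omegaCollection_empty
      · ext z
        simp only [Set.mem_ofPred_eq, h.mul₂, h.eq_one₁ s z hs1]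
  · rintro _ (⟨s, hs, rfl⟩ | ⟨s, hs, rfl⟩) _ ⟨U₁, h1, U₂, h2, rfl⟩
    · refine ⟨_, hA₁.sdiff_mem h1 (omegaCollection_dvd s), U₂, h2, ?_⟩
      ext z
      simp only [Set.mem_sdiff, Set.mem_ofPred_eq, h.dvd_iff]
      tauto
    · refine ⟨U₁, h1, _, hA₂.sdiff_mem h2 (omegaCollection_dvd s), ?_⟩
      ext z
      simp only [Set.mem_sdiff, Set.mem_ofPred_eq, h.symm.dvd_iff]
      tauto

end IsHeadPair

open Classical in
/-- The action of a factor without units on pairs of heads. -/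
noncomputable def headActLeft (h : ∀ x y : P₁, x * y = 1 → x = 1) :
    P₁ →* Function.End (P₁ × P₂) where
  toFun x := fun q => if x = 1 then q else (x * q.1, 1)
  map_one' := by funext q; exact if_pos rfl
  map_mul' x y := by
    funext q
    change (if x * y = 1 then q else (x * y * q.1, 1)) = if x = 1 then (if y = 1 then q else (y * q.1, 1))
      else (x * (if y = 1 then q else (y * q.1, 1)).1, 1)
    by_cases hx : x = 1
    · subst hx; simp
    by_cases hy : y = 1
    · subst hy; simp
    have hxy : x * y ≠ 1 := fun e => hx (h x y e)
    simp [hx, hy, hxy, mul_assoc]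

open Classical in
/-- The action of a factor without units on pairs of heads. -/
noncomputable def headActRight (h : ∀ x y : P₂, x * y = 1 → x = 1) :
    P₂ →* Function.End (P₁ × P₂) where
  toFun x := fun q => if x = 1 then q else (1, x * q.2)
  map_one' := by funext q; exact if_pos rfl
  map_mul' x y := by
    funext q
    change (if x * y = 1 then q else (1, x * y * q.2)) = if x = 1 then (if y = 1 then q else (1, y * q.2))
      else (1, x * (if y = 1 then q else (1, y * q.2)).2)
    by_cases hx : x = 1
    · subst hx; simp
    by_cases hy : y = 1
    · subst hy; simp
    have hxy : x * y ≠ 1 := fun e => hx (h x y e)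
    simp [hx, hy, hxy, mul_assoc]

-- The free product acts on pairs of heads, a nontrivial element x of the first factor sending (a,
-- b) to (xa, 1), and similarly for the second factor. The absence of units makes this an action,
-- and the heads of z are the image of (1, 1) under z.
open Classical in
theorem exists_isHeadPair (h1 : ∀ x y : P₁, x * y = 1 → x = 1)
    (h2 : ∀ x y : P₂, x * y = 1 → x = 1) :
    ∃ (f₁ : Monoid.Coprod P₁ P₂ → P₁) (f₂ : Monoid.Coprod P₁ P₂ → P₂),
      IsHeadPair Monoid.Coprod.inl Monoid.Coprod.inr f₁ f₂ := by
  let φ := Monoid.Coprod.lift (headActLeft (P₂ := P₂) h1) (headActRight (P₁ := P₁) h2)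
  let F : Monoid.Coprod P₁ P₂ → P₁ × P₂ := fun z => φ z (1, 1)
  have F1 : F 1 = (1, 1) := by simp only [F, map_one]; rfl
  have Fl : ∀ x z, F (Monoid.Coprod.inl x * z) = if x = 1 then F z else (x * (F z).1, 1) := by
    intro x z
    simp only [F, map_mul, φ, Monoid.Coprod.lift_apply_inl]; rfl
  have Fr : ∀ x z, F (Monoid.Coprod.inr x * z) = if x = 1 then F z else (1, x * (F z).2) := by
    intro x z
    simp only [F, map_mul, φ, Monoid.Coprod.lift_apply_inr]; rfl
  have ind : ∀ p : Monoid.Coprod P₁ P₂ → Prop, p 1 → (∀ x z, p z → p (Monoid.Coprod.inl x * z)) →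
      (∀ x z, p z → p (Monoid.Coprod.inr x * z)) → ∀ z, p z := by
    intro p p1 pl pr z
    have hz : z ∈ Submonoid.closure
        (Set.range (Monoid.Coprod.inl : P₁ →* Monoid.Coprod P₁ P₂) ∪ Set.range
          (Monoid.Coprod.inr : P₂ →* Monoid.Coprod P₁ P₂)) := by
      rw [Monoid.Coprod.mclosure_range_inl_union_inr]; trivial
    induction hz using Submonoid.closure_induction_left with
    | one => exact p1
    | mul_left x hx y _ ih =>
      rcases hx with ⟨a, rfl⟩ | ⟨a, rfl⟩
      · exact pl a y ih
      · exact pr a y ih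
  have M1 : ∀ x z, (F (Monoid.Coprod.inl x * z)).1 = x * (F z).1 := by
    intro x z; rw [Fl]; split_ifs with h <;> simp [h]
  have M2 : ∀ x z, (F (Monoid.Coprod.inr x * z)).2 = x * (F z).2 := by
    intro x z; rw [Fr]; split_ifs with h <;> simp [h]
  refine ⟨fun z => (F z).1, fun z => (F z).2, M1, M2, ?_, ?_, ?_, ?_, ?_⟩
  · intro x z hx; simp only [Fl, if_neg hx]
  · intro x z hx; simp only [Fr, if_neg hx]
  · refine ind _ (Or.inl (by rw [F1])) (fun x z hz => ?_) (fun x z hz => ?_)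
    · by_cases hx : x = 1
      · subst hx; simpa [Fl] using hz
      · exact Or.inr (by rw [Fl, if_neg hx])
    · by_cases hx : x = 1
      · subst hx; simpa [Fr] using hz
      · exact Or.inl (by rw [Fr, if_neg hx])
  · refine ind _ ⟨1, by simp [F1], by rw [F1]⟩ (fun x z hz => ?_) (fun x z hz => ?_)
    · obtain ⟨z', e, h'⟩ := hz
      refine ⟨z', ?_, h'⟩
      rw [M1, map_mul, mul_assoc, ← e]
    · by_cases hx : x = 1
      · subst hx; simpa [Fr] using hz
      · have : (F (Monoid.Coprod.inr x * z)).1 = 1 := by rw [Fr, if_neg hx]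
        exact ⟨_, by rw [this]; simp, this⟩
  · refine ind _ ⟨1, by simp [F1], by rw [F1]⟩ (fun x z hz => ?_) (fun x z hz => ?_)
    · by_cases hx : x = 1
      · subst hx; simpa [Fl] using hz
      · have : (F (Monoid.Coprod.inl x * z)).2 = 1 := by rw [Fl, if_neg hx]
        exact ⟨_, by rw [this]; simp, this⟩
    · obtain ⟨z', e, h'⟩ := hz
      refine ⟨z', ?_, h'⟩
      rw [M2, map_mul, mul_assoc, ← e]

end ProductCollections

/-! ## Free and direct products of Artin monoids -/

section ArtinProducts

variable {B₁ : Type u₁} {B₂ : Type u₂} (M₁ : CoxeterMatrix B₁) (M₂ : CoxeterMatrix B₂)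

theorem GeneratedBy.of_mulEquiv {P : Type u₁} {Q : Type u₂} [Monoid P] [Monoid Q] (e : P ≃* Q)
    {R : Set P} (h : GeneratedBy R) : GeneratedBy (e '' R) := by
  intro x
  rcases h (e.symm x) with hx | ⟨s, hs, y, hy⟩
  · exact Or.inl (by simpa using hx)
  · exact Or.inr ⟨e s, ⟨s, hs, rfl⟩, e y, by rw [← map_mul, ← hy]; simp⟩

/-- Transport from the Artin monoid of the block matrix replaces a separate analysis of least common
multiples in the product. -/
theorem isGradedLCMMonoid_free : IsGradedLCMMonoid (Monoid.Coprod (ArtinMonoid M₁) (ArtinMonoid M₂))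
    fun x => artinLen (freeCoxeter M₁ M₂) ((artinFreeEquiv M₁ M₂).symm x) :=
  (artinMonoid_isGradedLCMMonoid _).of_mulEquiv (artinFreeEquiv M₁ M₂).symm

theorem isGradedLCMMonoid_direct : IsGradedLCMMonoid (ArtinMonoid M₁ × ArtinMonoid M₂)
    fun x => artinLen (directCoxeter M₁ M₂) ((artinDirectEquiv M₁ M₂).symm x) :=
  (artinMonoid_isGradedLCMMonoid _).of_mulEquiv (artinDirectEquiv M₁ M₂).symm

theorem generatedBy_freeGen : GeneratedBy (Set.range (freeGen M₁ M₂)) := by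
  have := (generatedBy_artinGen (freeCoxeter M₁ M₂)).of_mulEquiv (artinFreeEquiv M₁ M₂)
  rwa [← Set.range_comp, show ⇑(artinFreeEquiv M₁ M₂) ∘ artinGen (freeCoxeter M₁ M₂) =
    freeGen M₁ M₂ from funext (artinFreeEquiv_gen M₁ M₂)] at this

theorem generatedBy_directGen : GeneratedBy (Set.range (directGen M₁ M₂)) := by
  have := (generatedBy_artinGen (directCoxeter M₁ M₂)).of_mulEquiv (artinDirectEquiv M₁ M₂)
  rwa [← Set.range_comp, show ⇑(artinDirectEquiv M₁ M₂) ∘ artinGen (directCoxeter M₁ M₂) =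
    directGen M₁ M₂ from funext (artinDirectEquiv_gen M₁ M₂)] at this

theorem artinLen_freeGen (b : B₁ ⊕ B₂) :
    artinLen (freeCoxeter M₁ M₂) ((artinFreeEquiv M₁ M₂).symm (freeGen M₁ M₂ b)) = 1 := by
  rw [← artinFreeEquiv_gen, MulEquiv.symm_apply_apply, artinLen_gen]

theorem artinLen_directGen (b : B₁ ⊕ B₂) :
    artinLen (directCoxeter M₁ M₂) ((artinDirectEquiv M₁ M₂).symm (directGen M₁ M₂ b)) = 1 := by
  rw [← artinDirectEquiv_gen, MulEquiv.symm_apply_apply, artinLen_gen]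

theorem range_freeGen_eq_irreducible : Set.range (freeGen M₁ M₂) = {p | Irreducible p} :=
  (isGradedLCMMonoid_free M₁ M₂).eq_setOf_irreducible (generatedBy_freeGen M₁ M₂) (by
    rintro _ ⟨b, rfl⟩; exact artinLen_freeGen M₁ M₂ b)

theorem range_directGen_eq_irreducible : Set.range (directGen M₁ M₂) = {p | Irreducible p} :=
  (isGradedLCMMonoid_direct M₁ M₂).eq_setOf_irreducible (generatedBy_directGen M₁ M₂) (by
    rintro _ ⟨b, rfl⟩; exact artinLen_directGen M₁ M₂ b)

theorem one_notMem_range_freeGen : 1 ∉ Set.range (freeGen M₁ M₂) := by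
  rintro ⟨b, hb⟩
  have := artinLen_freeGen M₁ M₂ b
  rw [hb, (isGradedLCMMonoid_free M₁ M₂).len_one] at this
  exact zero_ne_one this

theorem one_notMem_range_directGen : 1 ∉ Set.range (directGen M₁ M₂) := by
  rintro ⟨b, hb⟩
  have := artinLen_directGen M₁ M₂ b
  rw [hb, (isGradedLCMMonoid_direct M₁ M₂).len_one] at this
  exact zero_ne_one this

theorem range_freeGen : Set.range (freeGen M₁ M₂) =
    Monoid.Coprod.inl '' Set.range (artinGen M₁) ∪ Monoid.Coprod.inr '' Set.range (artinGen M₂) := by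
  rw [freeGen, Set.Sum.elim_range, ← Set.range_comp, ← Set.range_comp]; rfl

theorem range_directGen : Set.range (directGen M₁ M₂) =
    (fun x => (x, 1)) '' Set.range (artinGen M₁) ∪ (fun y => (1, y)) '' Set.range (artinGen M₂) := by
  rw [directGen, Set.Sum.elim_range, ← Set.range_comp, ← Set.range_comp]; rfl

theorem isSetAlgebra_freeGen
    (h₁ : MeasureTheory.IsSetAlgebra (omegaCollection (Set.range (artinGen M₁))))
    (h₂ : MeasureTheory.IsSetAlgebra (omegaCollection (Set.range (artinGen M₂)))) :
    MeasureTheory.IsSetAlgebra (omegaCollection (Set.range (freeGen M₁ M₂))) := by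
  have hone := one_notMem_range_freeGen M₁ M₂
  have hgen := generatedBy_freeGen M₁ M₂
  rw [range_freeGen] at hone hgen ⊢
  have g₁ := artinMonoid_isGradedLCMMonoid M₁
  have g₂ := artinMonoid_isGradedLCMMonoid M₂
  obtain ⟨f₁, f₂, h⟩ := exists_isHeadPair (fun _ _ => g₁.eq_one_of_mul_eq_one)
    (fun _ _ => g₂.eq_one_of_mul_eq_one)
  exact h.isSetAlgebra (isGradedLCMMonoid_free M₁ M₂) g₁ g₂ (one_notMem_range_artinGen M₁)
    (one_notMem_range_artinGen M₂) h₁ h₂ hone hgen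

theorem isSetAlgebra_directGen
    (h₁ : MeasureTheory.IsSetAlgebra (omegaCollection (Set.range (artinGen M₁))))
    (h₂ : MeasureTheory.IsSetAlgebra (omegaCollection (Set.range (artinGen M₂)))) :
    MeasureTheory.IsSetAlgebra (omegaCollection (Set.range (directGen M₁ M₂))) := by
  have hgen := generatedBy_directGen M₁ M₂
  rw [range_directGen] at hgen ⊢
  exact isSetAlgebra_prod (isGradedLCMMonoid_direct M₁ M₂) (artinMonoid_isGradedLCMMonoid M₁)
    (artinMonoid_isGradedLCMMonoid M₂) (one_notMem_range_artinGen M₁)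
    (one_notMem_range_artinGen M₂) h₁ h₂ hgen

end ArtinProducts

/-! ## Correspondences -/

section CStarAlgebra

variable {A : Type v} [NonUnitalCStarAlgebra A] [PartialOrder A] [StarOrderedRing A]

theorem norm_le_of_mem_quasispectrum {g : A} (hg : 0 ≤ g) {t : ℝ} (ht : t ∈ quasispectrum ℝ g) :
    t ≤ ‖g‖ := by
  have := norm_apply_le_norm_cfcₙ (fun x : ℝ => x) g ht (ha := hg.isSelfAdjoint)
  rw [cfcₙ_id' ℝ g hg.isSelfAdjoint] at this
  exact (Real.le_norm_self t).trans this

/-- A positive element of norm at most one has the form `1 - (1 - k)²`. -/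
theorem exists_eq_sub_sq {g : A} (hg : 0 ≤ g) (h1 : ‖g‖ ≤ 1) :
    ∃ k : A, star k = k ∧ g = k + k - k * k := by
  have hsa : IsSelfAdjoint g := hg.isSelfAdjoint
  -- The function vanishes at 0, so k = 1 - √(1 - g) exists without a unit in A.
  refine ⟨cfcₙ (fun t : ℝ => 1 - √(1 - t)) g, ?_, ?_⟩
  · exact (cfcₙ_predicate (R := ℝ) (p := IsSelfAdjoint) _ g)
  · have hc : Continuous fun t : ℝ => 1 - √(1 - t) := by fun_prop
    rw [← cfcₙ_mul _ _ g hc.continuousOn (by simp) hc.continuousOn (by simp),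
      ← cfcₙ_add _ _ g hc.continuousOn (by simp) hc.continuousOn (by simp),
      ← cfcₙ_sub _ _ g (by fun_prop) (by simp) (by fun_prop) (by simp)]
    conv_lhs => rw [← cfcₙ_id' ℝ g hsa]
    refine cfcₙ_congr fun t ht => ?_
    have ht1 : t ≤ 1 := (norm_le_of_mem_quasispectrum hg ht).trans h1
    have := Real.sq_sqrt (sub_nonneg.mpr ht1)
    nlinarith

/-- The function t - t² is increasing on [0, 1/2]. The bound controls the iteration g ↦ g - g² of
defects. -/
theorem norm_sub_mul_self_le {g : A} (hg : 0 ≤ g) {s : ℝ} (h1 : ‖g‖ ≤ s) (hs : s ≤ 1 / 2) :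
    ‖g - g * g‖ ≤ s - s * s := by
  have hsa : IsSelfAdjoint g := hg.isSelfAdjoint
  have e : g - g * g = cfcₙ (fun t : ℝ => t - t * t) g := by
    rw [cfcₙ_sub (fun t : ℝ => t) (fun t : ℝ => t * t) g (by fun_prop) (by simp) (by fun_prop)
      (by simp), cfcₙ_mul (fun t : ℝ => t) (fun t : ℝ => t) g (by fun_prop) (by simp)
      (by fun_prop) (by simp), cfcₙ_id' ℝ g hsa]
  rw [e]
  refine norm_cfcₙ_le fun t ht => ?_
  have h0 : 0 ≤ t := quasispectrum_nonneg_of_nonneg g hg t ht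
  have ht1 : t ≤ s := (norm_le_of_mem_quasispectrum hg ht).trans h1
  rw [Real.norm_eq_abs, abs_of_nonneg (by nlinarith)]
  nlinarith

end CStarAlgebra

namespace Correspondence

variable {A : Type v} [NonUnitalCStarAlgebra A] [PartialOrder A] [StarOrderedRing A]
  (E : Correspondence.{v, w} A)

@[simp] theorem ip_add_right (x y z : E) : E.ip x (y + z) = E.ip x y + E.ip x z := by simp [ip]
@[simp] theorem ip_add_left (x y z : E) : E.ip (x + y) z = E.ip x z + E.ip y z := by simp [ip]
@[simp] theorem ip_sub_right (x y z : E) : E.ip x (y - z) = E.ip x y - E.ip x z := by simp [ip]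
@[simp] theorem ip_sub_left (x y z : E) : E.ip (x - y) z = E.ip x z - E.ip y z := by simp [ip]
@[simp] theorem ip_zero_right (x : E) : E.ip x 0 = 0 := by simp [ip]
@[simp] theorem ip_zero_left (x : E) : E.ip 0 x = 0 := by simp [ip]
@[simp] theorem ip_smul_right (c : ℂ) (x y : E) : E.ip x (c • y) = c • E.ip x y := by
  simp only [ip, CStarModule.inner_smul_right_complex, unop_smul]
@[simp] theorem ip_smul_left (c : ℂ) (x y : E) : E.ip (c • x) y = star c • E.ip x y := by
  simp only [ip, CStarModule.inner_smul_left_complex, unop_smul]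
theorem star_ip (x y : E) : star (E.ip x y) = E.ip y x := by
  rw [ip, ← unop_star, CStarModule.star_inner]; rfl
theorem ip_self_nonneg (x : E) : 0 ≤ E.ip x x :=
  unop_nonneg.mpr (CStarModule.inner_self_nonneg (A := Aᵐᵒᵖ))
theorem norm_sq_eq_ip (x : E) : ‖x‖ ^ 2 = ‖E.ip x x‖ := CStarModule.norm_sq_eq Aᵐᵒᵖ
theorem norm_ip_le (x y : E) : ‖E.ip x y‖ ≤ ‖x‖ * ‖y‖ := CStarModule.norm_inner_le (A := Aᵐᵒᵖ) E
theorem ip_rmul_left (x y : E) (a : A) : E.ip (E.rmul x a) y = star a * E.ip x y := by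
  rw [← star_ip, ip_rmul, star_mul, star_ip]
theorem ip_left (a : A) (x y : E) : E.ip (E.left a x) y = E.ip x (E.left (star a) y) :=
  congrArg unop (E.left_adjoint a x y)
theorem ip_left_left (a : A) (x y : E) :
    E.ip (E.left a x) (E.left a y) = E.ip x (E.left (star a * a) y) := by
  rw [ip_left, map_mul]; rfl

theorem ip_theta (x y : E) : E.ip y (E.theta x x y) = star (E.ip x y) * E.ip x y := by
  rw [star_ip]
  exact E.ip_rmul y x _

/-- The left action is order contractive. -/
theorem ip_left_le {g : A} (hg : 0 ≤ g) (h1 : ‖g‖ ≤ 1) (y : E) :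
    E.ip y (E.left g y) ≤ E.ip y y := by
  obtain ⟨k, hk, rfl⟩ := exists_eq_sub_sq hg h1
  have := E.ip_self_nonneg (y - E.left k y)
  have e : E.ip (y - E.left k y) (y - E.left k y) =
      E.ip y y - E.ip y (E.left (k + k - k * k) y) := by
    simp only [ip_sub_left, ip_sub_right, ip_left, hk, map_sub, map_add, map_mul,
      sub_apply, add_apply, mul_apply_eq_comp,
      ip_add_right]
    abel
  rwa [e, sub_nonneg] at this

theorem norm_ip_left_le {g : A} (hg : 0 ≤ g) (y : E) :
    ‖E.ip y (E.left g y)‖ ≤ ‖g‖ * ‖y‖ ^ 2 := by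
  obtain ⟨b, hb, rfl⟩ : ∃ b : A, 0 ≤ b ∧ b * b = g :=
    ⟨CFC.sqrt g, CFC.sqrt_nonneg g, CFC.sqrt_mul_sqrt_self g⟩
  rcases eq_or_ne b 0 with rfl | hb0
  · simp
  have hpos : 0 < ‖b * b‖ := by
    have := CStarRing.norm_star_mul_self (x := b)
    rw [hb.isSelfAdjoint.star_eq] at this
    rw [this]; exact mul_pos (norm_pos_iff.mpr hb0) (norm_pos_iff.mpr hb0)
  set g := b * b
  have h2 : 0 ≤ (‖g‖⁻¹ : ℝ) • g := smul_nonneg (by positivity) hg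
  have h3 : ‖(‖g‖⁻¹ : ℝ) • g‖ ≤ 1 := by
    rw [norm_smul, norm_inv, norm_norm, inv_mul_cancel₀ hpos.ne']
  have h4 := E.ip_left_le h2 h3 y
  have h5 : 0 ≤ E.ip y (E.left ((‖g‖⁻¹ : ℝ) • g) y) := by
    have e : (‖g‖⁻¹ : ℝ) • g = star ((√(‖g‖⁻¹) : ℝ) • b) * ((√(‖g‖⁻¹) : ℝ) • b) := by
      rw [star_smul, hb.isSelfAdjoint.star_eq, smul_mul_smul_comm, star_trivial,
        Real.mul_self_sqrt (by positivity)]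
    rw [e, ← ip_left_left]
    exact E.ip_self_nonneg _
  have h6 := CStarAlgebra.norm_le_norm_of_nonneg_of_le h5 h4
  have e : E.left ((‖g‖⁻¹ : ℝ) • g) y = ((‖g‖⁻¹ : ℝ) : ℂ) • E.left g y := by
    rw [← Complex.coe_smul, map_smul]; rfl
  rw [e, ip_smul_right, norm_smul, ← norm_sq_eq_ip, Complex.norm_real, norm_inv, norm_norm,
    inv_mul_le_iff₀ hpos] at h6
  exact h6

end Correspondence

/-! ## Creation operators and their adjoints in a product system -/

namespace ProductSystem

variable {P : Type u} [Monoid P] {A : Type v} [NonUnitalCStarAlgebra A] [PartialOrder A]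
  [StarOrderedRing A] (X : ProductSystem.{u, v, w} P A) {p q r : P}

theorem rmul_mul (h : p * q = r) (x : X.fib p) (a : A) (y : X.fib q) :
    X.mul h ((X.fib p).rmul x a) y = X.mul h x ((X.fib q).left a y) := by
  rw [← X.mul_unit, ← X.unit_mul, X.mul_assoc (mul_one p) h (one_mul q) h]

theorem left_mul (h : p * q = r) (x : X.fib p) (a : A) (y : X.fib q) :
    (X.fib r).left a (X.mul h x y) = X.mul h ((X.fib p).left a x) y := by
  rw [← X.unit_mul, ← X.unit_mul, X.mul_assoc (one_mul p) h h (one_mul r)]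

theorem exists_norm_mul_le (h : p * q = r) (hp : p ≠ 1) (x : X.fib p) :
    ∃ C : ℝ, 0 ≤ C ∧ ∀ y, ‖X.mul h x y‖ ≤ C * ‖y‖ := by
  refine ⟨√‖(X.fib q).left ((X.fib p).ip x x)‖, by positivity, fun y => ?_⟩
  refine le_of_sq_le_sq ?_ (by positivity)
  rw [(X.fib r).norm_sq_eq_ip, X.ip_mul h hp, mul_pow, Real.sq_sqrt (by positivity), sq]
  calc _ ≤ ‖y‖ * ‖(X.fib q).left ((X.fib p).ip x x) y‖ := (X.fib q).norm_ip_le _ _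
    _ ≤ ‖y‖ * (‖(X.fib q).left ((X.fib p).ip x x)‖ * ‖y‖) := by
        gcongr; exact ContinuousLinearMap.le_opNorm _ _
    _ = _ := by ring

/-- The vectors in the domain of the adjoint of `y ↦ x y`. -/
def adjointDomain (h : p * q = r) (x : X.fib p) : Submodule ℂ (X.fib r) where
  carrier := {z | ∃ w, ∀ y, (X.fib q).ip y w = (X.fib r).ip (X.mul h x y) z}
  add_mem' := by
    rintro z z' ⟨w, hw⟩ ⟨w', hw'⟩
    exact ⟨w + w', fun y => by simp [hw, hw']⟩
  zero_mem' := ⟨0, fun y => by simp⟩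
  smul_mem' := by
    rintro c z ⟨w, hw⟩
    exact ⟨c • w, fun y => by simp [hw]⟩

/-- Candidate values w_n of the adjoint at a convergent sequence z_n form a Cauchy sequence: the
square of ‖w_m - w_n‖ is the norm of an inner product of x(w_m - w_n) with z_m - z_n, and y ↦ xy is
bounded. -/
theorem isClosed_adjointDomain (h : p * q = r) (hp : p ≠ 1) (x : X.fib p) :
    IsClosed (X.adjointDomain h x : Set (X.fib r)) := by
  obtain ⟨C, hC, hx⟩ := X.exists_norm_mul_le h hp x
  refine IsSeqClosed.isClosed fun z z' hz hlim => ?_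
  choose w hw using hz
  have hcauchy : CauchySeq w := by
    rw [Metric.cauchySeq_iff]
    intro ε hε
    obtain ⟨n₀, hn⟩ := Metric.cauchySeq_iff.mp hlim.cauchySeq (ε / (C + 1)) (by positivity)
    refine ⟨n₀, fun m hm n hn' => ?_⟩
    rw [dist_eq_norm]
    have h1 := hn m hm n hn'
    rw [dist_eq_norm, lt_div_iff₀ (by positivity)] at h1
    have h2 : ‖w m - w n‖ ^ 2 ≤ C * ‖w m - w n‖ * ‖z m - z n‖ := by
      rw [(X.fib q).norm_sq_eq_ip]
      conv_lhs => rw [(X.fib q).ip_sub_right, hw, hw, ← (X.fib r).ip_sub_right]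
      refine ((X.fib r).norm_ip_le _ _).trans ?_
      gcongr
      exact hx _
    rcases (norm_nonneg (w m - w n)).eq_or_lt with h0 | h0
    · rw [← h0]; exact hε
    · have h3 : ‖w m - w n‖ ≤ C * ‖z m - z n‖ := by
        refine le_of_mul_le_mul_left ?_ h0
        nlinarith
      nlinarith [norm_nonneg (z m - z n)]
  obtain ⟨w', hw'⟩ := cauchySeq_tendsto_of_complete hcauchy
  have hcont : ∀ (F : Correspondence.{v, w} A) (y : F), Continuous (F.ip y) := by
    intro F y
    refine (LipschitzWith.of_dist_le_mul (K := ⟨‖y‖, norm_nonneg y⟩) fun a b => ?_).continuous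
    rw [dist_eq_norm, dist_eq_norm, ← F.ip_sub_right]
    exact F.norm_ip_le _ _
  refine ⟨w', fun y => ?_⟩
  refine tendsto_nhds_unique (((hcont _ y).tendsto w').comp hw') ?_
  have : (X.fib q).ip y ∘ w = (X.fib r).ip (X.mul h x y) ∘ z := funext fun n => hw n y
  rw [this]
  exact ((hcont _ _).tendsto z').comp hlim

/-- On products the adjoint must send x'y' to ⟨x, x'⟩ y'. Products span a dense subspace and the
domain is closed. -/
theorem exists_adjoint (h : p * q = r) (hp : p ≠ 1) (x : X.fib p) (z : X.fib r) :
    ∃ w, ∀ y, (X.fib q).ip y w = (X.fib r).ip (X.mul h x y) z := by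
  have h1 : Submodule.span ℂ {z : X.fib r | ∃ (x : X.fib p) (y : X.fib q), z = X.mul h x y} ≤
      X.adjointDomain h x := by
    rw [Submodule.span_le]
    rintro _ ⟨x', y', rfl⟩
    exact ⟨(X.fib q).left ((X.fib p).ip x x') y', fun y => (X.ip_mul h hp _ _ _ _).symm⟩
  have h2 := (X.isClosed_adjointDomain h hp x).closure_subset_iff.mpr h1
  exact h2 (X.dense_mul h hp z)

/-- The adjoint of the creation operator `y ↦ x y`. -/
noncomputable def annihilate (h : p * q = r) (hp : p ≠ 1) (x : X.fib p) :
    X.fib r →ₗ[ℂ] X.fib q where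
  toFun z := (X.exists_adjoint h hp x z).choose
  map_add' z z' := (X.fib q).ext_ip fun y => by
    rw [(X.fib q).ip_add_right, (X.exists_adjoint h hp x _).choose_spec,
      (X.exists_adjoint h hp x _).choose_spec, (X.exists_adjoint h hp x _).choose_spec,
      (X.fib r).ip_add_right]
  map_smul' c z := (X.fib q).ext_ip fun y => by
    rw [RingHom.id_apply, (X.fib q).ip_smul_right, (X.exists_adjoint h hp x _).choose_spec,
      (X.exists_adjoint h hp x _).choose_spec, (X.fib r).ip_smul_right]

variable (h : p * q = r) (hp : p ≠ 1)

theorem ip_annihilate (x : X.fib p) (y : X.fib q) (z : X.fib r) :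
    (X.fib q).ip y (X.annihilate h hp x z) = (X.fib r).ip (X.mul h x y) z :=
  (X.exists_adjoint h hp x z).choose_spec y

theorem ip_annihilate_left (x : X.fib p) (y : X.fib q) (z : X.fib r) :
    (X.fib q).ip (X.annihilate h hp x z) y = (X.fib r).ip z (X.mul h x y) := by
  rw [← (X.fib q).star_ip, ip_annihilate, (X.fib r).star_ip]

theorem annihilate_mul (x x' : X.fib p) (y : X.fib q) :
    X.annihilate h hp x (X.mul h x' y) = (X.fib q).left ((X.fib p).ip x x') y :=
  (X.fib q).ext_ip fun t => by rw [ip_annihilate, X.ip_mul h hp]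

theorem annihilate_one (h : p * 1 = p) (x z : X.fib p) :
    X.annihilate h hp x z = X.unitEquiv ((X.fib p).ip x z) :=
  (X.fib 1).ext_ip fun t => by
    obtain ⟨a, rfl⟩ := X.unitEquiv.surjective t
    rw [ip_annihilate, X.ip_unit, X.mul_unit, (X.fib p).ip_rmul_left]

/-- The operator `1 - ∑_{ξ ∈ H} L_ξ L_ξ^*` on `X_r`, for `L_ξ : X_q → X_r` the creation operators of
a list `H` of vectors of `X_p`. -/
noncomputable def defectOp : List (X.fib p) → (X.fib r →ₗ[ℂ] X.fib r)
  | [] => LinearMap.id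
  | ξ :: H => defectOp H - (X.mul h ξ).comp (X.annihilate h hp ξ)

theorem defectOp_cons (ξ : X.fib p) (H : List (X.fib p)) (z : X.fib r) :
    X.defectOp h hp (ξ :: H) z = X.defectOp h hp H z - X.mul h ξ (X.annihilate h hp ξ z) := rfl

theorem ip_defectOp_left (H : List (X.fib p)) (y z : X.fib r) :
    (X.fib r).ip (X.defectOp h hp H y) z = (X.fib r).ip y (X.defectOp h hp H z) := by
  induction H with
  | nil => rfl
  | cons ξ H ih =>
    rw [defectOp_cons, defectOp_cons, Correspondence.ip_sub_left, Correspondence.ip_sub_right, ih,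
      ← ip_annihilate, ← ip_annihilate_left]

/-- The quadratic form of `defectOp`. -/
noncomputable def defect (H : List (X.fib p)) (z : X.fib r) : A :=
  (X.fib r).ip z (X.defectOp h hp H z)

theorem defect_nil (z : X.fib r) : X.defect h hp [] z = (X.fib r).ip z z := rfl

theorem defect_cons (ξ : X.fib p) (H : List (X.fib p)) (z : X.fib r) :
    X.defect h hp (ξ :: H) z = X.defect h hp H z -
      (X.fib q).ip (X.annihilate h hp ξ z) (X.annihilate h hp ξ z) := by
  rw [defect, defectOp_cons, Correspondence.ip_sub_right, ip_annihilate_left]; rfl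

theorem defect_append_le (L H : List (X.fib p)) (z : X.fib r) :
    X.defect h hp (L ++ H) z ≤ X.defect h hp H z := by
  induction L with
  | nil => exact le_rfl
  | cons ξ L ih =>
    rw [List.cons_append, defect_cons]
    exact (sub_le_self _ ((X.fib q).ip_self_nonneg _)).trans ih

theorem defect_le (H : List (X.fib p)) (z : X.fib r) :
    X.defect h hp H z ≤ (X.fib r).ip z z := by
  have := X.defect_append_le h hp H [] z
  rwa [List.append_nil] at this

theorem defect_eq_sub_sum (H : List (X.fib p)) (z : X.fib r) :
    X.defect h hp H z = (X.fib r).ip z z -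
      (H.map fun ξ => (X.fib q).ip (X.annihilate h hp ξ z) (X.annihilate h hp ξ z)).sum := by
  induction H with
  | nil => simp [defect_nil]
  | cons ξ H ih => rw [defect_cons, ih, List.map_cons, List.sum_cons]; abel

theorem defectOp_mul (H : List (X.fib p)) (z : X.fib p) (y : X.fib q) :
    X.defectOp h hp H (X.mul h z y) = X.mul h (X.defectOp (mul_one p) hp H z) y := by
  induction H with
  | nil => rfl
  | cons ξ H ih =>
    rw [defectOp_cons, defectOp_cons, map_sub, LinearMap.sub_apply, ih, annihilate_mul,
      annihilate_one, X.mul_unit, rmul_mul]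

theorem annihilate_defectOp (H : List (X.fib p)) (z : X.fib p) (y : X.fib r) :
    X.annihilate h hp (X.defectOp (mul_one p) hp H z) y =
      X.annihilate h hp z (X.defectOp h hp H y) :=
  (X.fib q).ext_ip fun t => by
    rw [ip_annihilate, ip_annihilate, ← defectOp_mul, ip_defectOp_left]

/-- A finite family in `X_p` with `∑_ξ L_ξ L_ξ^* ≤ 1` on every `X_{pq}`. -/
def IsContractiveFamily (H : List (X.fib p)) : Prop :=
  ∀ ⦃q r : P⦄ (h : p * q = r) (z : X.fib r), 0 ≤ X.defect h hp H z

variable {hp}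

theorem isContractiveFamily_nil : X.IsContractiveFamily hp [] :=
  fun _ _ _ _ => (X.fib _).ip_self_nonneg _

/-- Let D be the defect operator of H, so that the new creation operator is D L_z. Put v = L_z^* D y
and g = ⟨z, Dz⟩ ≤ 1. Testing D ≥ 0 on y - zv gives ⟨y, Dy⟩ - ⟨v, v⟩ ≥ ⟨v, v⟩ - ⟨v, gv⟩ ≥ 0, and the
left side is the new defect at y. -/
theorem IsContractiveFamily.cons {H : List (X.fib p)} (hH : X.IsContractiveFamily hp H)
    {z : X.fib p} (hz : ‖z‖ ^ 2 ≤ 1) :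
    X.IsContractiveFamily hp (X.defectOp (mul_one p) hp H z :: H) := by
  intro q r h y
  set g := X.defect (mul_one p) hp H z
  have hg : 0 ≤ g := hH _ _
  have hg1 : ‖g‖ ≤ 1 := by
    refine (CStarAlgebra.norm_le_norm_of_nonneg_of_le hg (X.defect_le _ _ _ _)).trans ?_
    rwa [← Correspondence.norm_sq_eq_ip]
  rw [defect_cons, annihilate_defectOp]
  set v := X.annihilate h hp z (X.defectOp h hp H y) with hv
  have h1 : 0 ≤ X.defect h hp H (y - X.mul h z v) := hH _ _
  have h2 : X.annihilate h hp z (X.defectOp h hp H (X.mul h z v)) = (X.fib q).left g v := by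
    rw [defectOp_mul, annihilate_mul]; rfl
  have h3 : X.defect h hp H (y - X.mul h z v) = X.defect h hp H y - (X.fib q).ip v v -
      ((X.fib q).ip v v - (X.fib q).ip v ((X.fib q).left g v)) := by
    rw [defect, map_sub, Correspondence.ip_sub_left, Correspondence.ip_sub_right,
      Correspondence.ip_sub_right, ← ip_annihilate (hp := hp), ← hv, ← ip_annihilate (hp := hp), h2,
      ← X.ip_defectOp_left h hp H y (X.mul h z v), ← ip_annihilate_left (hp := hp), ← hv]
    rfl
  rw [h3] at h1
  have h4 := (X.fib q).ip_left_le hg hg1 v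
  exact h1.trans (sub_le_self _ (sub_nonneg.mpr h4))

theorem defect_cons_self (H : List (X.fib p)) (z : X.fib p) :
    X.defect (mul_one p) hp (X.defectOp (mul_one p) hp H z :: H) z =
      X.defect (mul_one p) hp H z -
        X.defect (mul_one p) hp H z * X.defect (mul_one p) hp H z := by
  rw [defect_cons, annihilate_one, X.ip_unit, Correspondence.star_ip, ip_defectOp_left]
  rfl

/-- Every contractive family has contractive extensions with arbitrarily small defect at `z`. -/
def IsExhaustible (hp : p ≠ 1) (h : p * q = r) (z : X.fib r) : Prop :=
  ∀ ε > 0, ∀ H, X.IsContractiveFamily hp H →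
    ∃ L, X.IsContractiveFamily hp (L ++ H) ∧ ‖X.defect h hp (L ++ H) z‖ < ε

/-- Adjoining Dz repeatedly replaces the defect g at z by g - g² each time, and 1/m - 1/m² ≤ 1/(m +
1) with m = n + 2. -/
theorem exists_defect_le {z : X.fib p} (hz : ‖z‖ ^ 2 ≤ 1 / 2) {H : List (X.fib p)}
    (hH : X.IsContractiveFamily hp H) (n : ℕ) :
    ∃ L, X.IsContractiveFamily hp (L ++ H) ∧
      ‖X.defect (mul_one p) hp (L ++ H) z‖ ≤ 1 / (n + 2 : ℝ) := by
  induction n with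
  | zero =>
    refine ⟨[], hH, ?_⟩
    refine (CStarAlgebra.norm_le_norm_of_nonneg_of_le (hH _ _) (X.defect_le _ _ _ _)).trans ?_
    rw [← Correspondence.norm_sq_eq_ip]
    simpa using hz
  | succ n ih =>
    obtain ⟨L, hL, hn⟩ := ih
    refine ⟨X.defectOp (mul_one p) hp (L ++ H) z :: L, hL.cons X (hz.trans (by norm_num)), ?_⟩
    rw [List.cons_append, defect_cons_self]
    refine (norm_sub_mul_self_le (hL _ _) hn ?_).trans ?_
    · rw [div_le_div_iff₀ (by positivity) (by positivity)]; linarith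
    · push_cast
      rw [div_sub' (by positivity), div_le_div_iff₀ (by positivity) (by positivity)]
      field_simp
      ring_nf
      nlinarith [(Nat.cast_nonneg n : (0 : ℝ) ≤ n)]

end ProductSystem

/-! ### Exhaustion of vectors by contractive families -/

namespace ProductSystem

variable {P : Type u} [Monoid P] {A : Type v} [NonUnitalCStarAlgebra A] [PartialOrder A]
  [StarOrderedRing A] (X : ProductSystem.{u, v, w} P A) {p q r : P} {hp : p ≠ 1}

theorem defect_smul (h : p * q = r) (c : ℂ) (H : List (X.fib p)) (z : X.fib r) :
    X.defect h hp H (c • z) = (star c * c) • X.defect h hp H z := by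
  rw [defect, map_smul, Correspondence.ip_smul_left, Correspondence.ip_smul_right, smul_smul]; rfl

theorem norm_defect_smul (h : p * q = r) (c : ℂ) (H : List (X.fib p)) (z : X.fib r) :
    ‖X.defect h hp H (c • z)‖ = ‖c‖ ^ 2 * ‖X.defect h hp H z‖ := by
  rw [defect_smul, norm_smul, norm_mul, norm_star, sq]

/-- Parallelogram law: the difference of the two sides is the defect at z - z'. -/
theorem IsContractiveFamily.defect_add_le {H : List (X.fib p)} (hH : X.IsContractiveFamily hp H)
    (h : p * q = r) (z z' : X.fib r) :
    X.defect h hp H (z + z') ≤ X.defect h hp H z + X.defect h hp H z +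
      (X.defect h hp H z' + X.defect h hp H z') := by
  have e : X.defect h hp H z + X.defect h hp H z + (X.defect h hp H z' + X.defect h hp H z') -
      X.defect h hp H (z + z') = X.defect h hp H (z - z') := by
    simp only [defect, map_add, map_sub, Correspondence.ip_add_left, Correspondence.ip_add_right,
      Correspondence.ip_sub_left, Correspondence.ip_sub_right]
    abel
  rw [← sub_nonneg, e]
  exact hH h _

theorem IsContractiveFamily.norm_defect_add_le {H : List (X.fib p)}
    (hH : X.IsContractiveFamily hp H) (h : p * q = r) (z z' : X.fib r) :
    ‖X.defect h hp H (z + z')‖ ≤ 2 * ‖X.defect h hp H z‖ + 2 * ‖X.defect h hp H z'‖ := by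
  refine (CStarAlgebra.norm_le_norm_of_nonneg_of_le (hH h _) (hH.defect_add_le X h z z')).trans ?_
  refine (norm_add_le _ _).trans (add_le_add ?_ ?_) <;> rw [two_mul] <;> exact norm_add_le _ _

theorem IsContractiveFamily.norm_defect_le {H : List (X.fib p)} (hH : X.IsContractiveFamily hp H)
    (h : p * q = r) (z : X.fib r) : ‖X.defect h hp H z‖ ≤ ‖z‖ ^ 2 := by
  rw [Correspondence.norm_sq_eq_ip]
  exact CStarAlgebra.norm_le_norm_of_nonneg_of_le (hH h _) (X.defect_le h hp H z)

theorem IsContractiveFamily.norm_defect_append_le {L H : List (X.fib p)}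
    (hL : X.IsContractiveFamily hp (L ++ H)) (h : p * q = r) (z : X.fib r) :
    ‖X.defect h hp (L ++ H) z‖ ≤ ‖X.defect h hp H z‖ :=
  CStarAlgebra.norm_le_norm_of_nonneg_of_le (hL h _) (X.defect_append_le h hp L H z)

theorem isExhaustible_fib (z : X.fib p) : X.IsExhaustible hp (mul_one p) z := by
  intro ε hε H hH
  -- Rescaling brings the norm of z below 1/2, as the iteration requires; the defect scales by c².
  set c : ℝ := (2 * (1 + ‖z‖))⁻¹ with hc
  have hcpos : 0 < c := by positivity
  have hcz : ‖(c : ℂ) • z‖ ≤ 1 / 2 := by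
    rw [norm_smul, Complex.norm_real, Real.norm_of_nonneg hcpos.le, hc, mul_inv, _root_.mul_assoc]
    have : (1 + ‖z‖)⁻¹ * ‖z‖ ≤ 1 := by
      rw [inv_mul_le_iff₀ (by positivity)]; linarith
    linarith
  obtain ⟨n, hn⟩ := exists_nat_one_div_lt (show 0 < c ^ 2 * ε by positivity)
  obtain ⟨L, hL, h2⟩ := X.exists_defect_le (hp := hp) (z := (c : ℂ) • z)
    (by nlinarith [norm_nonneg ((c : ℂ) • z)]) hH n
  refine ⟨L, hL, ?_⟩
  rw [norm_defect_smul, Complex.norm_real, Real.norm_of_nonneg hcpos.le] at h2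
  have h3 : 1 / ((n : ℝ) + 2) ≤ 1 / (n + 1) :=
    one_div_le_one_div_of_le (by positivity) (by linarith)
  exact lt_of_mul_lt_mul_left (h2.trans_lt (h3.trans_lt hn)) (by positivity)

theorem defect_mul (h : p * q = r) (H : List (X.fib p)) (z : X.fib p) (y : X.fib q) :
    X.defect h hp H (X.mul h z y) =
      (X.fib q).ip y ((X.fib q).left (X.defect (mul_one p) hp H z) y) := by
  rw [defect, defectOp_mul, X.ip_mul h hp]; rfl

theorem isExhaustible_mul (h : p * q = r) (z : X.fib p) (y : X.fib q) :
    X.IsExhaustible hp h (X.mul h z y) := by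
  intro ε hε H hH
  obtain ⟨L, hL, h1⟩ := X.isExhaustible_fib (hp := hp) z (ε / (1 + ‖y‖ ^ 2)) (by positivity) H hH
  refine ⟨L, hL, ?_⟩
  rw [defect_mul]
  refine ((X.fib q).norm_ip_left_le (hL _ _) y).trans_lt ?_
  rw [lt_div_iff₀ (by positivity)] at h1
  nlinarith [norm_nonneg (X.defect (mul_one p) hp (L ++ H) z)]

theorem IsExhaustible.add {h : p * q = r} {z z' : X.fib r} (hz : X.IsExhaustible hp h z)
    (hz' : X.IsExhaustible hp h z') : X.IsExhaustible hp h (z + z') := by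
  intro ε hε H hH
  obtain ⟨L, hL, h1⟩ := hz (ε / 4) (by positivity) H hH
  obtain ⟨L', hL', h2⟩ := hz' (ε / 4) (by positivity) _ hL
  refine ⟨L' ++ L, by rwa [List.append_assoc], ?_⟩
  rw [List.append_assoc]
  have h3 := hL'.norm_defect_append_le X h z
  have h4 := hL'.norm_defect_add_le X h z z'
  linarith

/-- The defect at a product zy is governed by that at z. The property passes to sums because
extending a family never increases an earlier defect, and to limits because the defect at a vector
is at most its squared norm. -/
theorem isExhaustible (h : p * q = r) (z : X.fib r) : X.IsExhaustible hp h z := by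
  have hspan : ∀ z ∈ Submodule.span ℂ
      {z : X.fib r | ∃ (x : X.fib p) (y : X.fib q), z = X.mul h x y}, X.IsExhaustible hp h z := by
    intro z hz
    induction hz using Submodule.span_induction with
    | mem z hz => obtain ⟨x, y, rfl⟩ := hz; exact X.isExhaustible_mul h x y
    | zero =>
      rw [← (X.mul h 0).map_zero]; exact X.isExhaustible_mul h 0 0
    | add z z' _ _ hz hz' => exact hz.add X hz'
    | smul c z _ hz =>
      intro ε hε H hH
      obtain ⟨L, hL, h1⟩ := hz (ε / (1 + ‖c‖ ^ 2)) (by positivity) H hH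
      refine ⟨L, hL, ?_⟩
      rw [norm_defect_smul]
      rw [lt_div_iff₀ (by positivity)] at h1
      nlinarith [norm_nonneg (X.defect h hp (L ++ H) z)]
  intro ε hε H hH
  obtain ⟨z', hz', hd⟩ := Metric.mem_closure_iff.mp (X.dense_mul h hp z) (min 1 (ε / 4))
    (by positivity)
  obtain ⟨L, hL, h1⟩ := hspan z' hz' (ε / 4) (by positivity) H hH
  refine ⟨L, hL, ?_⟩
  have h2 := hL.norm_defect_add_le X h z' (z - z')
  rw [add_sub_cancel] at h2
  have h3 := hL.norm_defect_le X h (z - z')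
  rw [dist_eq_norm, lt_min_iff] at hd
  nlinarith [norm_nonneg (z - z')]

theorem exists_forall_defect_lt (h : p * q = r) (ws : List (X.fib r)) {ε : ℝ} (hε : 0 < ε)
    {H : List (X.fib p)} (hH : X.IsContractiveFamily hp H) :
    ∃ L, X.IsContractiveFamily hp (L ++ H) ∧ ∀ w ∈ ws, ‖X.defect h hp (L ++ H) w‖ < ε := by
  induction ws with
  | nil => exact ⟨[], hH, by simp⟩
  | cons w ws ih =>
    obtain ⟨L, hL, h1⟩ := ih
    obtain ⟨L', hL', h2⟩ := X.isExhaustible h w ε hε _ hL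
    refine ⟨L' ++ L, by rwa [List.append_assoc], fun w' hw' => ?_⟩
    rw [List.append_assoc]
    rcases List.mem_cons.mp hw' with rfl | hw'
    · exact h2
    · exact (hL'.norm_defect_append_le X h w').trans_lt (h1 w' hw')

end ProductSystem

/-! ## Induced traces -/

/-- Provides enough scalars of modulus one to make the vectors of a list distinct. -/
instance : Infinite Circle := by
  rw [Circle.argEquiv.infinite_iff]
  exact (Set.Ioc_infinite (by linarith [Real.pi_pos])).to_subtype

namespace Correspondence

variable {A : Type v} [NonUnitalCStarAlgebra A] [PartialOrder A] [StarOrderedRing A]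
  (E : Correspondence.{v, w} A)

theorem ip_theta_smul (c : Circle) (x y : E) :
    E.ip y (E.theta ((c : ℂ) • x) ((c : ℂ) • x) y) = E.ip y (E.theta x x y) := by
  have hc : (c : ℂ) * star (c : ℂ) = 1 := by
    have := Complex.mul_conj (c : ℂ)
    rw [Circle.normSq_coe] at this
    simpa using this
  rw [ip_theta, ip_theta, ip_smul_left, star_smul, smul_mul_smul_comm, star_star, hc, one_smul]

theorem ip_smul_apply (c : Circle) (T : E →L[ℂ] E) (x : E) :
    E.ip ((c : ℂ) • x) (T ((c : ℂ) • x)) = E.ip x (T x) := by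
  have hc : (c : ℂ) * star (c : ℂ) = 1 := by
    have := Complex.mul_conj (c : ℂ)
    rw [Circle.normSq_coe] at this
    simpa using this
  rw [map_smul, ip_smul_left, ip_smul_right, smul_smul, mul_comm, hc, one_smul]

open Classical in
/-- A finite family of vectors can be replaced by a finite set, up to scalars of modulus one. -/
theorem exists_finset_of_list (τ : A →L[ℂ] ℂ) (l : List E) : ∃ H : Finset E,
    (∀ y, E.ip y ((∑ ξ ∈ H, E.theta ξ ξ) y) = (l.map fun ξ => star (E.ip ξ y) * E.ip ξ y).sum) ∧
    ∀ T : E →L[ℂ] E, ∑ ξ ∈ H, ENNReal.ofReal (τ (E.ip ξ (T ξ))).re =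
      (l.map fun ξ => ENNReal.ofReal (τ (E.ip ξ (T ξ))).re).sum := by
  induction l with
  | nil => exact ⟨∅, by simp, by simp⟩
  | cons ξ l ih =>
    obtain ⟨H, h1, h2⟩ := ih
    rcases eq_or_ne ξ 0 with rfl | hξ
    · exact ⟨H, by simpa using h1, by simpa using h2⟩
    have hinj : Function.Injective fun c : Circle => (c : ℂ) • ξ := fun c c' hcc =>
      Circle.coe_injective (smul_left_injective ℂ hξ hcc)
    -- A phase moves ξ off the set H already chosen and changes neither the form of θ_{ξ,ξ} nor the
    -- trace term.
    obtain ⟨_, ⟨c, rfl⟩, hc⟩ := (Set.infinite_range_of_injective hinj).exists_notMem_finset H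
    refine ⟨insert ((c : ℂ) • ξ) H, fun y => ?_, fun T => ?_⟩
    · rw [Finset.sum_insert hc, add_apply, ip_add_right, h1, ip_theta_smul,
        ip_theta, List.map_cons, List.sum_cons]
    · rw [Finset.sum_insert hc, h2, ip_smul_apply, List.map_cons, List.sum_cons]

theorem sum_le_inducedTrace (τ : A →L[ℂ] ℂ) (l : List E)
    (hl : ∀ y, (l.map fun ξ => star (E.ip ξ y) * E.ip ξ y).sum ≤ E.ip y y) (T : E →L[ℂ] E) :
    (l.map fun ξ => ENNReal.ofReal (τ (E.ip ξ (T ξ))).re).sum ≤ E.inducedTrace τ T := by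
  obtain ⟨H, h1, h2⟩ := E.exists_finset_of_list τ l
  rw [← h2]
  exact le_iSup₂_of_le H (fun y => by rw [h1]; exact hl y) le_rfl

theorem ip_sum_theta (H : Finset E) (y : E) :
    E.ip y ((∑ ξ ∈ H, E.theta ξ ξ) y) = ∑ ξ ∈ H, star (E.ip ξ y) * E.ip ξ y := by
  classical
  induction H using Finset.induction_on with
  | empty => simp
  | insert a s ha ih =>
    rw [Finset.sum_insert ha, Finset.sum_insert ha, add_apply, ip_add_right, ih, ip_theta]

variable {E}

theorem SubIdentity.sum_le {H : Finset E} (hH : E.SubIdentity H) (y : E) :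
    ∑ ξ ∈ H, star (E.ip ξ y) * E.ip ξ y ≤ E.ip y y := by
  rw [← ip_sum_theta]
  exact hH y

variable {τ : A →L[ℂ] ℂ} (hτ : IsTracialState τ)

include hτ

theorem _root_.IsTracialState.re_mono {a b : A} (h : a ≤ b) : (τ a).re ≤ (τ b).re := by
  have := (hτ.nonneg _ (sub_nonneg.mpr h)).1
  rw [map_sub, Complex.sub_re] at this
  linarith

theorem _root_.IsTracialState.re_le_norm (a : A) : (τ a).re ≤ ‖a‖ := by
  refine (Complex.re_le_norm _).trans ((τ.le_opNorm a).trans ?_)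
  rw [hτ.norm_eq_one, one_mul]

/-- Traciality: the roles of the family and of the vector can be exchanged. -/
theorem SubIdentity.sum_trace_le {H : Finset E} (hH : E.SubIdentity H) (y : E) :
    ∑ ξ ∈ H, (τ (star (E.ip y ξ) * E.ip y ξ)).re ≤ (τ (E.ip y y)).re := by
  refine le_trans (le_of_eq ?_) (hτ.re_mono (hH.sum_le y))
  rw [map_sum, Complex.re_sum]
  refine Finset.sum_congr rfl fun ξ _ => ?_
  rw [hτ.tracial, star_ip, star_ip]

end Correspondence

/-! ## Induced traces on the fibres of a product system -/

namespace ProductSystem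

variable {P : Type u} [Monoid P] {A : Type v} [NonUnitalCStarAlgebra A] [PartialOrder A]
  [StarOrderedRing A] (X : ProductSystem.{u, v, w} P A) {p q r : P}

open Classical in
/-- The induced trace `Tr_τ^q(b)`, where `X_e = A` contributes `τ(b)`. -/
noncomputable def fibTrace (τ : A →L[ℂ] ℂ) (q : P) (b : A) : ℝ≥0∞ :=
  if q = 1 then ENNReal.ofReal (τ b).re else (X.fib q).inducedTrace τ ((X.fib q).left b)

theorem fibTrace_one (τ : A →L[ℂ] ℂ) (b : A) :
    X.fibTrace τ 1 b = ENNReal.ofReal (τ b).re := if_pos rfl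

theorem fibTrace_of_ne (τ : A →L[ℂ] ℂ) (hq : q ≠ 1) (b : A) :
    X.fibTrace τ q b = (X.fib q).inducedTrace τ ((X.fib q).left b) := if_neg hq

theorem defect_one_eq {hp : p ≠ 1} (h : p * 1 = p) (H : List (X.fib p)) (z : X.fib p) :
    X.defect h hp H z = (X.fib p).ip z z -
      (H.map fun ξ => star ((X.fib p).ip ξ z) * (X.fib p).ip ξ z).sum := by
  rw [defect_eq_sub_sum]
  simp only [annihilate_one, X.ip_unit]

theorem re_trace_sub_list_sum {ι : Type*} (τ : A →L[ℂ] ℂ) (a : A) (l : List ι) (f : ι → A) :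
    (τ (a - (l.map f).sum)).re = (τ a).re - (l.map fun i => (τ (f i)).re).sum := by
  induction l with
  | nil => simp
  | cons i l ih =>
    rw [map_sub, Complex.sub_re] at ih ⊢
    rw [List.map_cons, List.sum_cons, map_add, Complex.add_re, List.map_cons, List.sum_cons]
    linarith

theorem sum_list_sum_comm {ι κ : Type*} (s : Finset ι) (l : List κ) (f : ι → κ → ℝ) :
    ∑ i ∈ s, (l.map (f i)).sum = (l.map fun k => ∑ i ∈ s, f i k).sum := by
  induction l with
  | nil => simp
  | cons k l ih => simp [Finset.sum_add_distrib, ih]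

theorem ofReal_list_sum {κ : Type*} (l : List κ) (f : κ → ℝ) (hf : ∀ k, 0 ≤ f k) :
    ENNReal.ofReal (l.map f).sum = (l.map fun k => ENNReal.ofReal (f k)).sum := by
  induction l with
  | nil => simp
  | cons k l ih =>
    rw [List.map_cons, List.sum_cons, ENNReal.ofReal_add (hf k)
      (List.sum_nonneg (by simpa using fun k _ => hf k)), ih, List.map_cons, List.sum_cons]

variable {τ : A →L[ℂ] ℂ} (hτ : IsTracialState τ)

-- At each vector Wζ the inner square is the defect plus the inner squares of its images under the
-- annihilation operators, and a state is bounded by the norm on the defect.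
include hτ in
theorem sum_trace_le_of_defect_lt {hp : p ≠ 1} (h : p * q = r) (H0 : Finset (X.fib r))
    (W : X.fib r → X.fib r) (H : List (X.fib p)) {ε : ℝ}
    (hH : ∀ ζ ∈ H0, ‖X.defect h hp H (W ζ)‖ < ε) :
    ∑ ζ ∈ H0, (τ ((X.fib r).ip (W ζ) (W ζ))).re ≤ H0.card * ε +
      (H.map fun ξ => ∑ ζ ∈ H0, (τ ((X.fib q).ip (X.annihilate h hp ξ (W ζ))
        (X.annihilate h hp ξ (W ζ)))).re).sum := by
  rw [← sum_list_sum_comm, ← nsmul_eq_mul, ← Finset.sum_const, ← Finset.sum_add_distrib]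
  refine Finset.sum_le_sum fun ζ hζ => ?_
  have := hτ.re_le_norm (X.defect h hp H (W ζ))
  rw [defect_eq_sub_sum, re_trace_sub_list_sum] at this
  have h2 := hH ζ hζ
  rw [defect_eq_sub_sum] at h2
  linarith

include hτ in
/-- Traciality: `∑_ζ τ(⟨Wζ, Wζ⟩) ≤ Tr(V^* V)` for an adjoint pair `W`, `V`. -/
theorem sum_trace_le_inducedTrace {E : Correspondence.{v, w} A} (hq : q ≠ 1) {H0 : Finset E}
    (hH0 : E.SubIdentity H0) (W : E → X.fib q) (V : X.fib q → E)
    (hWV : ∀ η ζ, (X.fib q).ip η (W ζ) = E.ip (V η) ζ) (b : A)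
    (hV : ∀ η, E.ip (V η) (V η) = (X.fib q).ip η ((X.fib q).left b η)) :
    ENNReal.ofReal (∑ ζ ∈ H0, (τ ((X.fib q).ip (W ζ) (W ζ))).re) ≤
      (X.fib q).inducedTrace τ ((X.fib q).left b) := by
  refine ENNReal.le_of_forall_pos_le_add fun ε hε _ => ?_
  -- Expand each ⟨Wζ, Wζ⟩ over a family in X_q that nearly exhausts it, with total error at most ε.
  -- After exchanging the sums, the inner sum over ζ is at most τ(⟨Vη, Vη⟩) by traciality, since
  -- `H0` is subordinate to the identity.
  obtain ⟨L, hL, h1⟩ := X.exists_forall_defect_lt (hp := hq) (mul_one q) (H0.toList.map W)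
    (show 0 < (ε : ℝ) / (H0.card + 1) by positivity) (X.isContractiveFamily_nil)
  rw [List.append_nil] at hL h1
  have h2 : ∑ ζ ∈ H0, (τ ((X.fib q).ip (W ζ) (W ζ))).re ≤ ε +
      (L.map fun η => (τ ((X.fib q).ip η ((X.fib q).left b η))).re).sum := by
    have h3 : ∑ ζ ∈ H0, (τ ((X.fib q).ip (W ζ) (W ζ))).re ≤ H0.card * ((ε : ℝ) / (H0.card + 1)) +
        (L.map fun η => ∑ ζ ∈ H0,
          (τ (star ((X.fib q).ip η (W ζ)) * (X.fib q).ip η (W ζ))).re).sum := by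
      rw [← sum_list_sum_comm, ← nsmul_eq_mul, ← Finset.sum_const, ← Finset.sum_add_distrib]
      refine Finset.sum_le_sum fun ζ hζ => ?_
      have h4 := h1 (W ζ) (List.mem_map_of_mem (Finset.mem_toList.mpr hζ))
      have := hτ.re_le_norm (X.defect (mul_one q) hq L (W ζ))
      rw [defect_one_eq] at h4 this
      rw [re_trace_sub_list_sum] at this
      linarith
    refine h3.trans (add_le_add ?_ (List.sum_le_sum fun η _ => ?_))
    · rw [mul_div_assoc', div_le_iff₀ (by positivity)]
      nlinarith [ε.coe_nonneg]
    · rw [← hV]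
      simp only [hWV]
      exact hH0.sum_trace_le hτ (V η)
  have h0 : ∀ η, 0 ≤ (τ ((X.fib q).ip η ((X.fib q).left b η))).re := fun η => by
    rw [← hV]; exact (hτ.nonneg _ (E.ip_self_nonneg _)).1
  refine (ENNReal.ofReal_le_ofReal h2).trans ?_
  have h5 : 0 ≤ (L.map fun η => (τ ((X.fib q).ip η ((X.fib q).left b η))).re).sum :=
    List.sum_nonneg (by simpa using fun η _ => h0 η)
  rw [ENNReal.ofReal_add ε.coe_nonneg h5, ofReal_list_sum _ _ h0, ENNReal.ofReal_coe_nnreal, add_comm]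
  gcongr
  refine (X.fib q).sum_le_inducedTrace τ L (fun y => ?_) _
  have := hL (mul_one q) y
  rwa [defect_one_eq, sub_nonneg] at this

include hτ in
/-- Lower approximation of the induced trace on `X_{pq}` by families in `X_p`. -/
theorem exists_lt_sum_fibTrace (hp : p ≠ 1) (h : p * q = r) (hr : r ≠ 1) {a : A} (ha : 0 ≤ a)
    {M : ℝ≥0∞} (hM : M < X.fibTrace τ r a) {H : List (X.fib p)}
    (hH : X.IsContractiveFamily hp H) :
    ∃ L, X.IsContractiveFamily hp (L ++ H) ∧
      M < ((L ++ H).map fun ξ => X.fibTrace τ q ((X.fib p).ip ξ ((X.fib p).left a ξ))).sum := by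
  obtain ⟨b, hb, hba⟩ : ∃ b : A, star b = b ∧ b * b = a :=
    ⟨CFC.sqrt a, (CFC.sqrt_nonneg a).isSelfAdjoint, CFC.sqrt_mul_sqrt_self a⟩
  have hbb : ∀ (E : Correspondence.{v, w} A) (x : E),
      E.ip (E.left b x) (E.left b x) = E.ip x (E.left a x) := fun E x => by
    rw [E.ip_left_left, hb, hba]
  rw [fibTrace_of_ne X τ hr, Correspondence.inducedTrace] at hM
  simp only [lt_iSup_iff] at hM
  obtain ⟨H0, hH0, hM⟩ := hM
  have hpos : ∀ ζ ∈ H0, 0 ≤ (τ ((X.fib r).ip ζ ((X.fib r).left a ζ))).re := fun ζ _ => by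
    rw [← hbb]; exact (hτ.nonneg _ ((X.fib r).ip_self_nonneg _)).1
  rw [← ENNReal.ofReal_sum_of_nonneg hpos] at hM
  obtain ⟨m, hm0, hMm, hm⟩ := ENNReal.lt_iff_exists_real_btwn.mp hM
  have hm := (ENNReal.ofReal_lt_ofReal_iff_of_nonneg hm0).mp hm
  set S := ∑ ζ ∈ H0, (τ ((X.fib r).ip ζ ((X.fib r).left a ζ))).re with hS
  -- The gap between the value S of a nearly optimal `H0` and the real number m above M is spread
  -- over the vectors √a ζ, so the total loss is at most S - m.
  obtain ⟨L, hL, h1⟩ := X.exists_forall_defect_lt (hp := hp) h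
    (H0.toList.map fun ζ => (X.fib r).left b ζ)
    (show 0 < (S - m) / (H0.card + 1) from div_pos (sub_pos.mpr hm) (by positivity)) hH
  refine ⟨L, hL, hMm.trans_le ?_⟩
  have h2 := X.sum_trace_le_of_defect_lt hτ h H0 (fun ζ => (X.fib r).left b ζ) (L ++ H)
    (fun ζ hζ => h1 _ (List.mem_map_of_mem (Finset.mem_toList.mpr hζ)))
  simp only [hbb] at h2
  rw [← hS] at h2
  have h3 : (H0.card : ℝ) * ((S - m) / (H0.card + 1)) ≤ S - m := by
    rw [mul_div_assoc', div_le_iff₀ (by positivity)]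
    nlinarith
  have h4 : m ≤ ((L ++ H).map fun ξ => ∑ ζ ∈ H0,
      (τ ((X.fib q).ip (X.annihilate h hp ξ ((X.fib r).left b ζ))
        (X.annihilate h hp ξ ((X.fib r).left b ζ)))).re).sum := by linarith
  refine (ENNReal.ofReal_le_ofReal h4).trans ?_
  rw [ofReal_list_sum _ _ fun ξ => Finset.sum_nonneg fun ζ _ =>
    (hτ.nonneg _ ((X.fib q).ip_self_nonneg _)).1]
  refine List.sum_le_sum fun ξ _ => ?_
  by_cases hq : q = 1
  · subst hq
    obtain rfl : p = r := (mul_one p).symm.trans h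
    rw [fibTrace_one]
    refine ENNReal.ofReal_le_ofReal ?_
    rw [← hbb]
    refine le_trans (le_of_eq ?_) (hH0.sum_trace_le hτ _)
    refine Finset.sum_congr rfl fun ζ _ => ?_
    rw [annihilate_one, X.ip_unit, (X.fib p).ip_left, hb]
  · rw [fibTrace_of_ne X τ hq]
    -- The adjoint pair is ζ ↦ L_ξ^* √a ζ and η ↦ √a ξη, and ⟨√a ξη, √a ξη⟩ = ⟨η, ⟨ξ, aξ⟩ η⟩.
    refine X.sum_trace_le_inducedTrace hτ hq hH0
      (fun ζ => X.annihilate h hp ξ ((X.fib r).left b ζ))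
      (fun η => (X.fib r).left b (X.mul h ξ η)) (fun η ζ => ?_) _ (fun η => ?_)
    · rw [ip_annihilate, (X.fib r).ip_left, hb]
    · rw [left_mul, X.ip_mul h hp, hbb]

/-- If each ξ of a contractive family is multiplied by a family in X_q subordinate to the identity,
the products ξη are subordinate to the identity of X_r and so compete in the supremum for the trace
there. -/
theorem sum_fibTrace_le (hp : p ≠ 1) (h : p * q = r) (hr : r ≠ 1) (a : A) {H : List (X.fib p)}
    (hH : X.IsContractiveFamily hp H) :
    (H.map fun ξ => X.fibTrace τ q ((X.fib p).ip ξ ((X.fib p).left a ξ))).sum ≤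
      X.fibTrace τ r a := by
  rw [fibTrace_of_ne X τ hr]
  by_cases hq : q = 1
  · subst hq
    obtain rfl : p = r := (mul_one p).symm.trans h
    simp only [fibTrace_one]
    refine (X.fib p).sum_le_inducedTrace τ H (fun y => ?_) _
    have := hH h y
    rwa [defect_one_eq, sub_nonneg] at this
  simp only [fibTrace_of_ne X τ hq]
  -- `G` collects the products already formed and `H` the vectors still to be expanded; each step
  -- expands one ξ and takes the supremum over its family in X_q.
  have key : ∀ (H : List (X.fib p)) (G : List (X.fib r)),
      (∀ y, (G.map fun ξ => star ((X.fib r).ip ξ y) * (X.fib r).ip ξ y).sum +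
        (H.map fun ξ => (X.fib q).ip (X.annihilate h hp ξ y) (X.annihilate h hp ξ y)).sum ≤
          (X.fib r).ip y y) →
      (G.map fun ξ => ENNReal.ofReal (τ ((X.fib r).ip ξ ((X.fib r).left a ξ))).re).sum +
        (H.map fun ξ => (X.fib q).inducedTrace τ
          ((X.fib q).left ((X.fib p).ip ξ ((X.fib p).left a ξ)))).sum ≤
        (X.fib r).inducedTrace τ ((X.fib r).left a) := by
    intro H
    induction H with
    | nil =>
      intro G hG
      simp only [List.map_nil, List.sum_nil, add_zero] at hG ⊢
      exact (X.fib r).sum_le_inducedTrace τ G hG _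
    | cons ξ H ih =>
      intro G hG
      rw [List.map_cons, List.sum_cons, add_left_comm, Correspondence.inducedTrace]
      have : Nonempty {F : Finset (X.fib q) // (X.fib q).SubIdentity F} :=
        ⟨∅, fun y => by simpa using (X.fib q).ip_self_nonneg y⟩
      rw [iSup_subtype', ENNReal.iSup_add]
      refine iSup_le fun ⟨F, hF⟩ => ?_
      refine le_trans (le_of_eq ?_) (ih (F.toList.map (X.mul h ξ) ++ G) fun y => ?_)
      · rw [List.map_append, List.sum_append, List.map_map, add_assoc]
        congr 1
        rw [Finset.sum_map_toList]
        refine Finset.sum_congr rfl fun η _ => ?_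
        simp only [Function.comp_apply]
        rw [left_mul, X.ip_mul h hp]
      · refine le_trans ?_ (hG y)
        rw [List.map_append, List.sum_append, List.map_map, List.map_cons, List.sum_cons,
          add_comm (List.sum _) (List.sum _), add_assoc]
        gcongr
        refine le_trans (le_of_eq ?_) (hF.sum_le (X.annihilate h hp ξ y))
        rw [Finset.sum_map_toList]
        refine Finset.sum_congr rfl fun η _ => ?_
        simp only [Function.comp_apply]
        rw [ip_annihilate]
  have := key H [] fun y => by
    have := hH h y
    rw [defect_eq_sub_sum, sub_nonneg] at this
    simpa using this
  simpa using this

end ProductSystem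

/-! ## Transfer of positivity -/

namespace ProductSystem

variable {P : Type u} [Monoid P] {A : Type v} [NonUnitalCStarAlgebra A] [PartialOrder A]
  [StarOrderedRing A] (X : ProductSystem.{u, v, w} P A) {p q r : P} {τ : A →L[ℂ] ℂ}

theorem _root_.Correspondence.ip_left_nonneg (E : Correspondence.{v, w} A) {a : A} (ha : 0 ≤ a)
    (x : E) : 0 ≤ E.ip x (E.left a x) := by
  have h := E.ip_self_nonneg (E.left (CFC.sqrt a) x)
  rwa [E.ip_left_left, (CFC.sqrt_nonneg a).isSelfAdjoint.star_eq,
    CFC.sqrt_mul_sqrt_self a] at h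

/-- The family is extended for one q after another. Extension only increases the sums, so the
estimates already obtained persist. -/
theorem exists_forall_fibTrace_le (hτ : IsTracialState τ) (hp : p ≠ 1) (hpq : ∀ q, p * q ≠ 1)
    {a : A} (ha : 0 ≤ a) (hfin : ∀ q, X.fibTrace τ q a ≠ ∞) (Q : Finset P) {ε : ℝ≥0∞}
    (hε : ε ≠ 0) : ∃ H, X.IsContractiveFamily hp H ∧ ∀ q ∈ Q, X.fibTrace τ (p * q) a ≤
      (H.map fun ξ => X.fibTrace τ q ((X.fib p).ip ξ ((X.fib p).left a ξ))).sum + ε := by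
  classical
  induction Q using Finset.induction_on with
  | empty => exact ⟨[], X.isContractiveFamily_nil, by simp⟩
  | insert q Q hq ih =>
    obtain ⟨H, hH, h1⟩ := ih
    obtain ⟨L, hL, h2⟩ : ∃ L, X.IsContractiveFamily hp (L ++ H) ∧ X.fibTrace τ (p * q) a ≤
        ((L ++ H).map fun ξ => X.fibTrace τ q ((X.fib p).ip ξ ((X.fib p).left a ξ))).sum + ε := by
      by_cases h0 : X.fibTrace τ (p * q) a = 0
      · exact ⟨[], hH, by rw [h0]; exact zero_le⟩
      · obtain ⟨L, hL, h2⟩ := X.exists_lt_sum_fibTrace hτ hp rfl (hpq q) ha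
          (ENNReal.sub_lt_self (hfin (p * q)) h0 hε) hH
        exact ⟨L, hL, tsub_le_iff_right.mp h2.le⟩
    refine ⟨L ++ H, hL, fun q' hq' => ?_⟩
    rcases Finset.mem_insert.mp hq' with rfl | hq'
    · exact h2
    · refine (h1 q' hq').trans ?_
      rw [List.map_append, List.sum_append]
      gcongr
      exact le_add_self

/-- If a combination of induced traces is positive on `A₊`, so is its translate by `p`. -/
theorem sum_fibTrace_mul_nonneg (hτ : IsTracialState τ) (hp : p ≠ 1) (hpq : ∀ q, p * q ≠ 1)
    (hfin : ∀ q a, 0 ≤ a → X.fibTrace τ q a ≠ ∞) (Q : Finset P) (c : P → ℝ)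
    (hpos : ∀ b, 0 ≤ b → 0 ≤ ∑ q ∈ Q, c q * (X.fibTrace τ q b).toReal) {a : A} (ha : 0 ≤ a) :
    0 ≤ ∑ q ∈ Q, c q * (X.fibTrace τ (p * q) a).toReal := by
  have hpos' : ∀ H : List (X.fib p), (∀ q, (H.map fun ξ =>
      X.fibTrace τ q ((X.fib p).ip ξ ((X.fib p).left a ξ))).sum ≠ ∞) ∧
      0 ≤ ∑ q ∈ Q, c q * (H.map fun ξ =>
        X.fibTrace τ q ((X.fib p).ip ξ ((X.fib p).left a ξ))).sum.toReal := by
    intro H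
    induction H with
    | nil => simp
    | cons ξ H ih =>
      have hξ : ∀ q, X.fibTrace τ q ((X.fib p).ip ξ ((X.fib p).left a ξ)) ≠ ∞ :=
        fun q => hfin q _ ((X.fib p).ip_left_nonneg ha ξ)
      simp only [List.map_cons, List.sum_cons]
      refine ⟨fun q => ENNReal.add_ne_top.mpr ⟨hξ q, ih.1 q⟩, ?_⟩
      simp only [ENNReal.toReal_add (hξ _) (ih.1 _), mul_add, Finset.sum_add_distrib]
      exact add_nonneg (hpos _ ((X.fib p).ip_left_nonneg ha ξ)) ih.2
  set C := ∑ q ∈ Q, |c q| with hC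
  have hC0 : 0 ≤ C := Finset.sum_nonneg fun q _ => abs_nonneg _
  refine le_of_forall_pos_le_add fun δ hδ => ?_
  set ε : ℝ := δ / (C + 1) with hε
  have hε0 : 0 < ε := by positivity
  obtain ⟨H, hH, h1⟩ := X.exists_forall_fibTrace_le hτ hp hpq ha (fun q => hfin q a ha) Q
    (ε := ENNReal.ofReal ε) (by simpa using hε0)
  obtain ⟨h2, h3⟩ := hpos' H
  refine h3.trans ?_
  -- The sum over the family is at most Tr^{pq}(a) and falls short of it by at most ε. Being
  -- two-sided, this controls the term for either sign of c(q).
  have h4 : ∀ q ∈ Q, c q * (H.map fun ξ =>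
      X.fibTrace τ q ((X.fib p).ip ξ ((X.fib p).left a ξ))).sum.toReal ≤
      c q * (X.fibTrace τ (p * q) a).toReal + |c q| * ε := by
    intro q hq
    have h5 := ENNReal.toReal_mono (hfin (p * q) a ha)
      (X.sum_fibTrace_le (τ := τ) hp rfl (hpq q) a hH)
    have h6 := ENNReal.toReal_mono (ENNReal.add_ne_top.mpr ⟨h2 q, ENNReal.ofReal_ne_top⟩) (h1 q hq)
    rw [ENNReal.toReal_add (h2 q) ENNReal.ofReal_ne_top, ENNReal.toReal_ofReal hε0.le] at h6
    have h7 := neg_abs_le (c q)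
    have h8 := le_abs_self (c q)
    rcases le_total 0 (c q) with hc | hc
    · nlinarith
    · rw [abs_of_nonpos hc]; nlinarith
  refine (Finset.sum_le_sum h4).trans ?_
  rw [Finset.sum_add_distrib, ← Finset.sum_mul]
  have h9 : C * ε ≤ δ := by
    rw [hε, mul_div_assoc', div_le_iff₀ (by positivity)]; nlinarith
  linarith

/-- A bound for the induced traces at the elements of a generating set gives one everywhere. -/
theorem fibTrace_le {len : P → ℕ} (hP : IsGradedLCMMonoid P len) (hτ : IsTracialState τ)
    {R : Set P} (hR : GeneratedBy R) (h1 : 1 ∉ R) {N : P →* ℝ} (hN : ∀ p, 0 < N p) {β : ℝ}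
    (hle : ∀ s ∈ R, ∀ a, 0 ≤ a →
      X.fibTrace τ s a ≤ ENNReal.ofReal (N s ^ β) * ENNReal.ofReal (τ a).re)
    (q : P) {a : A} (ha : 0 ≤ a) :
    X.fibTrace τ q a ≤ ENNReal.ofReal (N q ^ β) * ENNReal.ofReal (τ a).re := by
  induction hn : len q using Nat.strong_induction_on generalizing q a with
  | _ n ih =>
    rcases hR q with rfl | ⟨s, hs, q', rfl⟩
    · rw [fibTrace_one, map_one, Real.one_rpow, ENNReal.ofReal_one, one_mul]
    have hs1 : s ≠ 1 := fun e => h1 (e ▸ hs)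
    have hsq : ∀ q, s * q ≠ 1 := fun q e => hs1 (hP.eq_one_of_mul_eq_one e)
    have hlen : len q' < n := by
      rw [← hn, hP.len_mul]
      have : len s ≠ 0 := fun e => hs1 (hP.eq_one_of_len s e)
      omega
    refine le_of_forall_lt fun M hM => ?_
    -- For q = s q' the trace is approximated by ∑ Tr^{q'}(⟨ξ, aξ⟩), which by induction is at most
    -- N(q')^β ∑ τ(⟨ξ, aξ⟩) ≤ N(q')^β Tr^s(a).
    obtain ⟨L, hL, h2⟩ := X.exists_lt_sum_fibTrace hτ hs1 rfl (hsq q') ha hM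
      X.isContractiveFamily_nil
    refine h2.trans_le ?_
    have h3 : ((L ++ []).map fun ξ =>
        X.fibTrace τ q' ((X.fib s).ip ξ ((X.fib s).left a ξ))).sum ≤
        ((L ++ []).map fun ξ => ENNReal.ofReal (N q' ^ β) *
          X.fibTrace τ 1 ((X.fib s).ip ξ ((X.fib s).left a ξ))).sum :=
      List.sum_le_sum fun ξ _ => by
        rw [fibTrace_one]
        exact ih _ hlen q' ((X.fib s).ip_left_nonneg ha ξ) rfl
    refine h3.trans ?_
    rw [List.sum_map_mul_left, map_mul, Real.mul_rpow (hN s).le (hN q').le,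
      ENNReal.ofReal_mul (Real.rpow_nonneg (hN s).le β), mul_comm (ENNReal.ofReal (N s ^ β)),
      _root_.mul_assoc]
    gcongr
    exact (X.sum_fibTrace_le (τ := τ) hs1 (mul_one s) hs1 a hL).trans (hle s hs a ha)

end ProductSystem

/-! ## Inclusion-exclusion -/

section InclusionExclusion

variable {P : Type u} [Monoid P] {len : P → ℕ}

open Classical in
/-- The combination of the sets `qP` given by `∑_q v(q) 1_{qP}`. -/
noncomputable def idealSum : (P →₀ ℝ) →ₗ[ℝ] (P → ℝ) :=
  Finsupp.linearCombination ℝ fun q x => if q ∣ x then (1 : ℝ) else 0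

open Classical in
theorem idealSum_apply (v : P →₀ ℝ) (x : P) :
    idealSum v x = ∑ q ∈ v.support with q ∣ x, v q := by
  rw [idealSum, Finsupp.linearCombination_apply, Finsupp.sum, Finset.sum_apply, Finset.sum_filter]
  exact Finset.sum_congr rfl fun q _ => by simp

open Classical in
/-- The alternating combination `∑_{K ⊆ J} (-1)^{|K|} [∨K]`. -/
noncomputable def lcmSum (J : Finset P) : P →₀ ℝ :=
  ∑ K ∈ J.powerset, if h : ∃ r, IsRightLCM (K : Set P) r then
    Finsupp.single h.choose ((-1 : ℝ) ^ K.card) else 0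

namespace IsGradedLCMMonoid

variable (hP : IsGradedLCMMonoid P len)
include hP

/-- An element of minimal length in the support has no other left divisor in the support, so the
combination takes its coefficient as value there. -/
theorem idealSum_injective : Function.Injective (idealSum (P := P)) := by
  classical
  rw [injective_iff_map_eq_zero]
  intro v hv
  by_contra hne
  obtain ⟨q, hq, hmin⟩ := v.support.exists_min_image len (Finsupp.support_nonempty_iff.mpr hne)
  have h1 := congrFun hv q
  rw [idealSum_apply, Finset.sum_eq_single_of_mem q (by simpa using hq)] at h1
  · exact Finsupp.mem_support_iff.mp hq h1
  · intro q' hq' hne'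
    obtain ⟨hs, c, rfl⟩ := Finset.mem_filter.mp hq'
    have h2 := hmin q' hs
    rw [hP.len_mul] at h2
    exact absurd (by rw [hP.eq_one_of_len c (by omega), mul_one]) hne'

open Classical in
theorem idealSum_mapDomain (p : P) (v : P →₀ ℝ) (x : P) :
    idealSum (v.mapDomain (p * ·)) x = if h : p ∣ x then idealSum v h.choose else 0 := by
  rw [idealSum, Finsupp.linearCombination_mapDomain]
  split_ifs with h
  · conv_lhs => rw [h.choose_spec]
    simp only [Finsupp.linearCombination_apply, Finsupp.sum, Finset.sum_apply, Function.comp_apply,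
      Pi.smul_apply, hP.mul_dvd_mul_iff]
  · simp only [Finsupp.linearCombination_apply, Finsupp.sum, Finset.sum_apply, Function.comp_apply,
      Pi.smul_apply]
    refine Finset.sum_eq_zero fun q _ => ?_
    rw [if_neg fun hd => h ((Dvd.intro _ rfl).trans hd), smul_zero]

-- At x only the K contained in {k ∈ J | k ∣ x} contribute. Such K have least common multiples
-- because x is a common one, and their signs sum to 1 or 0 according to whether this set is empty.
open Classical in
theorem idealSum_lcmSum (J : Finset P) (x : P) :
    idealSum (lcmSum J) x = (omegaSet J).indicator 1 x := by
  have h1 : idealSum (lcmSum J) x =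
      ∑ K ∈ J.powerset, if ∀ k ∈ K, k ∣ x then ((-1 : ℤ) ^ K.card : ℝ) else 0 := by
    rw [lcmSum, map_sum, Finset.sum_apply]
    refine Finset.sum_congr rfl fun K _ => ?_
    split_ifs with h h' h'
    · rw [idealSum, Finsupp.linearCombination_single, Pi.smul_apply,
        if_pos (h.choose_spec.2 x h')]
      simp
    · rw [idealSum, Finsupp.linearCombination_single, Pi.smul_apply,
        if_neg fun hd => h' fun k hk => (h.choose_spec.1 k hk).trans hd, smul_zero]
    · exact absurd (hP.exists_isRightLCM K h') h
    · simp
  have h2 : (J.powerset.filter fun K => ∀ k ∈ K, k ∣ x) = (J.filter (· ∣ x)).powerset := by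
    ext K
    simp only [Finset.mem_filter, Finset.mem_powerset, Finset.subset_iff]
    exact ⟨fun h k hk => ⟨h.1 hk, h.2 k hk⟩, fun h => ⟨fun k hk => (h hk).1, fun k hk => (h hk).2⟩⟩
  rw [h1, ← Finset.sum_filter, h2]
  have h3 := congrArg (Int.cast : ℤ → ℝ) (Finset.sum_powerset_neg_one_pow_card (x := J.filter (· ∣ x)))
  rw [Int.cast_sum] at h3
  simp only [Int.cast_pow] at h3
  rw [h3]
  have h4 : x ∈ omegaSet J ↔ J.filter (· ∣ x) = ∅ := by
    rw [mem_omegaSet, Finset.filter_eq_empty_iff]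
  by_cases h5 : x ∈ omegaSet J
  · rw [Set.indicator_of_mem h5, if_pos (h4.mp h5)]; simp
  · rw [Set.indicator_of_notMem h5, if_neg fun h => h5 (h4.mpr h)]; simp

theorem idealSum_mapDomain_lcmSum (p : P) (J : Finset P) (x : P) :
    idealSum ((lcmSum J).mapDomain (p * ·)) x = (mulOmega p J).indicator 1 x := by
  classical
  rw [hP.idealSum_mapDomain]
  split_ifs with h
  · rw [hP.idealSum_lcmSum]
    have : h.choose ∈ omegaSet J ↔ x ∈ mulOmega p J := by
      constructor
      · exact fun hy => ⟨_, hy, h.choose_spec.symm⟩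
      · rintro ⟨y, hy, e⟩
        rwa [← hP.cancel p _ _ (e.trans h.choose_spec)]
    by_cases hx : x ∈ mulOmega p J
    · rw [Set.indicator_of_mem hx, Set.indicator_of_mem (this.mpr hx)]; rfl
    · rw [Set.indicator_of_notMem hx, Set.indicator_of_notMem fun h => hx (this.mp h)]
  · rw [Set.indicator_of_notMem]
    rintro ⟨y, -, e⟩
    exact h ⟨y, e.symm⟩

/-- A disjoint decomposition `Ω_J = ⨆ p_j Ω_{K_j}` is an identity of alternating combinations. -/
theorem lcmSum_eq_sum {n : ℕ} {J : Finset P} (p : Fin n → P) (K : Fin n → Finset P)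
    (hd : Pairwise fun i j => Disjoint (mulOmega (p i) (K i)) (mulOmega (p j) (K j)))
    (e : omegaSet J = ⋃ j, mulOmega (p j) (K j)) :
    lcmSum J = ∑ j, (lcmSum (K j)).mapDomain (p j * ·) := by
  refine hP.idealSum_injective (funext fun x => ?_)
  rw [map_sum, Finset.sum_apply, hP.idealSum_lcmSum]
  simp only [hP.idealSum_mapDomain_lcmSum]
  by_cases hx : x ∈ omegaSet J
  · rw [Set.indicator_of_mem hx]
    rw [e] at hx
    obtain ⟨j, hj⟩ := Set.mem_iUnion.mp hx
    rw [Finset.sum_eq_single_of_mem j (Finset.mem_univ j), Set.indicator_of_mem hj]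
    intro i _ hij
    exact Set.indicator_of_notMem (fun hi => Set.disjoint_left.mp (hd hij) hi hj) _
  · rw [Set.indicator_of_notMem hx]
    rw [e] at hx
    exact (Finset.sum_eq_zero fun j _ =>
      Set.indicator_of_notMem (fun hj => hx (Set.mem_iUnion.mpr ⟨j, hj⟩)) _).symm

end IsGradedLCMMonoid

theorem omegaSet_mem_of_isSetAlgebra {R : Set P}
    (hA : MeasureTheory.IsSetAlgebra (omegaCollection R)) (J : Finset P) :
    omegaSet J ∈ omegaCollection R := by
  classical
  induction J using Finset.induction_on with
  | empty => rw [omegaSet_empty]; exact univ_mem_omegaCollection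
  | insert a K _ ih =>
    have e : omegaSet (insert a K) = omegaSet K \ {x | a ∣ x} := by
      ext z; simp [mem_omegaSet, and_comm]
    rw [e]
    exact hA.sdiff_mem ih (omegaCollection_dvd a)

end InclusionExclusion

/-! ## Reduction of positivity to generators -/

namespace ProductSystem

variable {P : Type u} [Monoid P] {A : Type v} [NonUnitalCStarAlgebra A] [PartialOrder A]
  [StarOrderedRing A] (X : ProductSystem.{u, v, w} P A) {len : P → ℕ}
  (N : P →* ℝ) (β : ℝ) (τ : A →L[ℂ] ℂ)

/-- The functional `v ↦ ∑_q v(q) N(q)^{-β} Tr_τ^q(a)`. -/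
noncomputable def traceSum (a : A) : (P →₀ ℝ) →ₗ[ℝ] ℝ :=
  Finsupp.linearCombination ℝ fun q => N q ^ (-β) * (X.fibTrace τ q a).toReal

variable {N β τ} (hP : IsGradedLCMMonoid P len) (hτ : IsTracialState τ)

-- Multiplicativity of N pulls out N(p)^{-β}, and what remains is the translation of a positive
-- combination of traces. The case p = 1 is separate because contractive families need p ≠ 1.
include hP hτ in
theorem traceSum_mapDomain_nonneg (hN : ∀ p, 0 < N p)
    (hfin : ∀ q a, 0 ≤ a → X.fibTrace τ q a ≠ ∞) (p : P) (v : P →₀ ℝ)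
    (hv : ∀ b, 0 ≤ b → 0 ≤ X.traceSum N β τ b v) {a : A} (ha : 0 ≤ a) :
    0 ≤ X.traceSum N β τ a (v.mapDomain (p * ·)) := by
  by_cases hp : p = 1
  · subst hp
    simp only [one_mul]
    rw [show (fun x : P => x) = id from rfl, Finsupp.mapDomain_id]
    exact hv a ha
  have hpq : ∀ q, p * q ≠ 1 := fun q e => hp (hP.eq_one_of_mul_eq_one e)
  have h1 := X.sum_fibTrace_mul_nonneg hτ hp hpq hfin v.support (fun q => v q * N q ^ (-β))
    (fun b hb => ?_) ha
  · have e : X.traceSum N β τ a (v.mapDomain (p * ·)) = N p ^ (-β) *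
        ∑ q ∈ v.support, v q * N q ^ (-β) * (X.fibTrace τ (p * q) a).toReal := by
      rw [traceSum, Finsupp.linearCombination_mapDomain, Finsupp.linearCombination_apply,
        Finsupp.sum, Finset.mul_sum]
      refine Finset.sum_congr rfl fun q _ => ?_
      rw [Function.comp_apply, map_mul, Real.mul_rpow (hN p).le (hN q).le, smul_eq_mul]
      ring
    rw [e]
    exact mul_nonneg (Real.rpow_nonneg (hN p).le _) h1
  · have := hv b hb
    rw [traceSum, Finsupp.linearCombination_apply, Finsupp.sum] at this
    simpa only [smul_eq_mul, ← _root_.mul_assoc] using this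

include hP hτ in
/-- The summands of the positivity condition are those of `traceSum`. -/
theorem positivity_sum_eq (hfin : ∀ q a, 0 ≤ a → X.fibTrace τ q a ≠ ∞) {J : Finset P}
    (hJ : ∀ p ∈ J, p ≠ 1) {a : A} (ha : 0 ≤ a) :
    ((τ a).re : EReal) + ∑ K ∈ J.powerset with K.Nonempty, X.lcmTerm N β τ K a =
      ((X.traceSum N β τ a (lcmSum J) : ℝ) : EReal) := by
  classical
  have hterm : ∀ K ∈ J.powerset.filter Finset.Nonempty, X.lcmTerm N β τ K a =
      ((X.traceSum N β τ a (if h : ∃ r, IsRightLCM (K : Set P) r then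
        Finsupp.single h.choose ((-1 : ℝ) ^ K.card) else 0) : ℝ) : EReal) := by
    intro K hK
    obtain ⟨hK, k, hk⟩ := Finset.mem_filter.mp hK
    rw [lcmTerm]
    split_ifs with h
    · have hne : h.choose ≠ 1 := fun e => hJ k (Finset.mem_powerset.mp hK hk)
        (hP.eq_one_of_dvd_one (e ▸ h.choose_spec.1 k hk))
      rw [traceSum, Finsupp.linearCombination_single, ← fibTrace_of_ne X τ hne, smul_eq_mul,
        ← _root_.mul_assoc, ← EReal.coe_ennreal_toReal (hfin _ a ha), ← EReal.coe_mul]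
    · simp
  -- The empty set has least common multiple 1, where `fibTrace` is τ itself, so τ(a) is the missing
  -- summand.
  have hempty : ((τ a).re : EReal) =
      ((X.traceSum N β τ a (if h : ∃ r, IsRightLCM ((∅ : Finset P) : Set P) r then
        Finsupp.single h.choose ((-1 : ℝ) ^ (∅ : Finset P).card) else 0) : ℝ) : EReal) := by
    have h : ∃ r, IsRightLCM ((∅ : Finset P) : Set P) r := ⟨1, by simp, fun _ _ => one_dvd _⟩
    have h1 : h.choose = 1 := hP.eq_one_of_dvd_one (h.choose_spec.2 1 (by simp))
    rw [dif_pos h, h1, traceSum, Finsupp.linearCombination_single, fibTrace_one, map_one,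
      ENNReal.toReal_ofReal (hτ.nonneg a ha).1]
    simp
  rw [Finset.sum_congr rfl hterm, hempty, lcmSum, map_sum,
    ← Finset.sum_filter_add_sum_filter_not J.powerset Finset.Nonempty, EReal.coe_add, add_comm]
  have hf : J.powerset.filter (fun K => ¬ K.Nonempty) = {∅} := by
    ext K
    simp only [Finset.mem_filter, Finset.mem_powerset, Finset.not_nonempty_iff_eq_empty,
      Finset.mem_singleton]
    exact ⟨fun h => h.2, fun h => ⟨h ▸ Finset.empty_subset _, h⟩⟩
  rw [hf, Finset.sum_singleton]
  congr 1
  induction (J.powerset.filter Finset.Nonempty) using Finset.induction_on with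
  | empty => simp
  | insert K s hK ih => rw [Finset.sum_insert hK, Finset.sum_insert hK, ih, EReal.coe_add]

-- This is positivity for J = {s}; an infinite trace would make the left side -∞.
include hP in
theorem fibTrace_le_of_positivity (hN : ∀ p, 0 < N p) {R : Set P} (hpos : X.Positivity N β τ R)
    {s : P} (hs : s ∈ R) (hs1 : s ≠ 1) {a : A} (ha : 0 ≤ a) :
    X.fibTrace τ s a ≤ ENNReal.ofReal (N s ^ β) * ENNReal.ofReal (τ a).re := by
  classical
  have h1 := hpos {s} (by simpa using hs) a ha
  have hf : ({s} : Finset P).powerset.filter Finset.Nonempty = {{s}} := by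
    ext K
    simp only [Finset.mem_filter, Finset.mem_powerset, Finset.subset_singleton_iff,
      Finset.mem_singleton]
    constructor
    · rintro ⟨rfl | rfl, h⟩
      · exact absurd h Finset.not_nonempty_empty
      · rfl
    · rintro rfl; exact ⟨Or.inr rfl, Finset.singleton_nonempty _⟩
  have hlcm : IsRightLCM (({s} : Finset P) : Set P) s := ⟨by simp, fun r' h => h s (by simp)⟩
  have h : ∃ r, IsRightLCM (({s} : Finset P) : Set P) r := ⟨s, hlcm⟩
  have hc := hP.isRightLCM_unique h.choose_spec hlcm
  rw [hf, Finset.sum_singleton, lcmTerm, dif_pos h, ← fibTrace_of_ne X τ (hc.trans_ne hs1), hc, Finset.card_singleton,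
    pow_one, neg_one_mul] at h1
  have hpow : 0 < N s ^ (-β) := Real.rpow_pos_of_pos (hN s) _
  have hne : X.fibTrace τ s a ≠ ∞ := by
    intro htop
    rw [htop, EReal.coe_ennreal_top, EReal.coe_mul_top_of_neg (by linarith), EReal.add_bot] at h1
    simp at h1
  rw [← EReal.coe_ennreal_toReal hne, ← EReal.coe_mul, ← EReal.coe_add, EReal.coe_nonneg] at h1
  rw [← ENNReal.ofReal_mul (Real.rpow_nonneg (hN s).le β), ← ENNReal.ofReal_toReal hne]
  refine ENNReal.ofReal_le_ofReal ?_
  rw [Real.rpow_neg (hN s).le] at h1 hpow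
  have h2 : (N s ^ β)⁻¹ * (X.fibTrace τ s a).toReal ≤ (τ a).re := by linarith
  rwa [inv_mul_le_iff₀ (inv_pos.mp hpow)] at h2

end ProductSystem

/-- If `𝒜_R` is an algebra for a generating set `R`, positivity reduces to `R`. -/
theorem reductionOfPositivity {P : Type u} [Monoid P] {len : P → ℕ}
    (hP : IsGradedLCMMonoid P len) {R : Set P} (hR : GeneratedBy R) (h1 : 1 ∉ R)
    (hA : MeasureTheory.IsSetAlgebra (omegaCollection R)) :
    ReductionOfPositivity.{u, v, w} P R := by
  intro A _ _ _ X _ N hN β τ hτ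
  have hR1 : ∀ s ∈ R, s ≠ 1 := fun s hs e => h1 (e ▸ hs)
  refine ⟨fun h J hJ => h J fun p hp => hR1 p (hJ hp), fun hpos J hJ a ha => ?_⟩
  have hfin : ∀ q a, 0 ≤ a → X.fibTrace τ q a ≠ ∞ := fun q a ha =>
    ((X.fibTrace_le hP hτ hR h1 hN (fun s hs a ha =>
      X.fibTrace_le_of_positivity hP hN hpos hs (hR1 s hs) ha) q ha).trans_lt
      (ENNReal.mul_lt_top ENNReal.ofReal_lt_top ENNReal.ofReal_lt_top)).ne
  have hgen : ∀ K : Finset P, (K : Set P) ⊆ R → ∀ b, 0 ≤ b →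
      0 ≤ X.traceSum N β τ b (lcmSum K) := fun K hK b hb => by
    have := hpos K hK b hb
    rwa [X.positivity_sum_eq hP hτ hfin (fun p hp => hR1 p (hK hp)) hb, EReal.coe_nonneg] at this
  rw [X.positivity_sum_eq hP hτ hfin (fun p hp => hJ hp) ha, EReal.coe_nonneg]
  -- The algebra property enters only here: Ω_J is cut into translates of sets Ω_K with K ⊆ R.
  obtain ⟨n, p, K, hK, hd, e⟩ := omegaSet_mem_of_isSetAlgebra hA J
  rw [hP.lcmSum_eq_sum p K hd e, map_sum]
  exact Finset.sum_nonneg fun j _ =>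
    X.traceSum_mapDomain_nonneg hP hτ hN hfin (p j) _ (hgen _ (hK j)) ha

/-! ## Two rank-two examples -/

/-- A Coxeter group with an entry `∞` is infinite. -/
theorem not_isFiniteType_of_eq_zero {B : Type u} {M : CoxeterMatrix B} {s t : B} (hst : s ≠ t)
    (h : M s t = 0) : ¬ IsFiniteType M := by
  intro hfin
  have : Finite M.Group := hfin
  refine not_injective_infinite_finite (M.altProd s t) fun i j hij => ?_
  rw [← M.len_altProd hst i (Or.inl h), hij, M.len_altProd hst j (Or.inl h)]

/-- If all off-diagonal entries are `∞`, the Artin monoid is free and `𝒜_S` is an algebra. -/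
theorem isSetAlgebra_of_off_diagonal_eq_zero {B : Type u} {M : CoxeterMatrix B}
    (h : ∀ s t, s ≠ t → M s t = 0) :
    MeasureTheory.IsSetAlgebra (omegaCollection (Set.range (artinGen M))) := by
  classical
  refine isSetAlgebra_of_residuals (artinMonoid_isGradedLCMMonoid M) (one_notMem_range_artinGen M)
    (generatedBy_artinGen M)
    {V | V = ∅ ∨ ∃ K : Finset (ArtinMonoid M), (K : Set (ArtinMonoid M)) ⊆ Set.range (artinGen M) ∧
      V = omegaSet K} (fun K hK => Or.inr ⟨K, hK, rfl⟩) ?_ ?_ ?_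
  · rintro _ (rfl | ⟨K, hK, rfl⟩)
    · exact omegaCollection_empty
    · exact omegaSet_mem hK
  · rintro _ ⟨s, rfl⟩ _ (rfl | ⟨K, hK, rfl⟩)
    · exact Or.inl rfl
    -- The residual of Ω_K at s is empty if s ∈ K. Otherwise it is everything, since distinct
    -- generators have no common multiple.
    by_cases hs : artinGen M s ∈ K
    · refine Or.inl (Set.eq_empty_of_forall_notMem fun x hx => ?_)
      exact mem_omegaSet.mp hx _ hs ⟨x, rfl⟩
    · refine Or.inr ⟨∅, by simp, ?_⟩
      rw [omegaSet_empty]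
      refine Set.eq_univ_of_forall fun x => mem_omegaSet.mpr fun k hk hd => ?_
      obtain ⟨t, rfl⟩ := hK hk
      have hst : s ≠ t := fun e => hs (e ▸ hk)
      exact (artinAlt_dvd hst ⟨x, rfl⟩ hd).1 (h s t hst)
  · rintro _ ⟨s, rfl⟩ _ (rfl | ⟨K, hK, rfl⟩)
    · exact Or.inl (by simp)
    refine Or.inr ⟨insert (artinGen M s) K, ?_, ?_⟩
    · rw [Finset.coe_insert]
      exact Set.insert_subset ⟨s, rfl⟩ hK
    · ext z; simp [mem_omegaSet, and_comm]

/-! ### The Artin monoid of type A₂ -/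

/-- The rank-two Coxeter matrix with off-diagonal entry `c`. -/
def edgeCoxeter (c : ℕ) (hc : c ≠ 1) : CoxeterMatrix (Fin 2) where
  M := Matrix.of fun i j => if i = j then 1 else c
  isSymm := by
    ext i j
    simp only [Matrix.transpose_apply, Matrix.of_apply, eq_comm]
  diagonal i := by simp
  off_diagonal i j h := by simpa [h] using hc

theorem edgeCoxeter_apply {c : ℕ} (hc : c ≠ 1) {i j : Fin 2} (h : i ≠ j) :
    edgeCoxeter c hc i j = c := if_neg h

/-- The Coxeter matrix of type `A₂`. -/
abbrev a2Coxeter : CoxeterMatrix (Fin 2) := edgeCoxeter 3 (by decide)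

/-- The reduced words of the six elements of the symmetric group `S₃`. -/
def a2Word : Fin 6 → List (Fin 2) := ![[], [0], [1], [0, 1], [1, 0], [0, 1, 0]]

/-- Left multiplication by the generators in the symmetric group `S₃`. -/
def a2Mul : Fin 2 → Fin 6 → Fin 6 := ![![1, 0, 3, 2, 5, 4], ![2, 4, 0, 5, 1, 3]]

/-- The action of the generators of the Artin monoid of type `A₂` on the greatest common left
divisors with the Garside element. -/
def a2Act : Fin 2 → Fin 6 → Fin 6 := ![![1, 1, 3, 1, 5, 5], ![2, 4, 2, 5, 2, 5]]

/-- The left descents of the six elements of the symmetric group `S₃`. -/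
def a2Descent (s : Fin 2) (i : Fin 6) : Prop := i ∈ (![{1, 3, 5}, {2, 4, 5}] : Fin 2 → Finset (Fin 6)) s

instance (s : Fin 2) : DecidablePred (a2Descent s) := fun i =>
  inferInstanceAs (Decidable (i ∈ (![{1, 3, 5}, {2, 4, 5}] : Fin 2 → Finset (Fin 6)) s))

theorem isFiniteType_a2Coxeter : IsFiniteType a2Coxeter := by
  let cs := a2Coxeter.toCoxeterSystem
  have h0 : ∀ i x, cs.simple i * (cs.simple i * x) = x := fun i x => by simp
  have h1 : cs.simple 1 * (cs.simple 0 * cs.simple 1) =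
      cs.simple 0 * (cs.simple 1 * cs.simple 0) := by
    have := cs.wordProd_braidWord_eq 0 1
    have e : a2Coxeter 0 1 = 3 := rfl
    have e' : a2Coxeter 1 0 = 3 := rfl
    rw [CoxeterSystem.braidWord, CoxeterSystem.braidWord, e, e'] at this
    simpa [CoxeterSystem.alternatingWord, CoxeterSystem.wordProd, List.concat_eq_append] using this
  have h3 : ∀ x, cs.simple 1 * (cs.simple 0 * (cs.simple 1 * x)) =
      cs.simple 0 * (cs.simple 1 * (cs.simple 0 * x)) := fun x => by
    simpa only [mul_assoc] using congrArg (· * x) h1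
  -- Six words closed under left multiplication by the generators exhaust the group.
  have h2 : ∀ s i, cs.simple s * cs.wordProd (a2Word i) = cs.wordProd (a2Word (a2Mul s i)) := by
    intro s i
    fin_cases s <;> fin_cases i <;>
      simp [a2Word, a2Mul, CoxeterSystem.wordProd, h0, h1, h3]
  refine Finite.of_surjective (fun i => cs.wordProd (a2Word i)) fun g => ?_
  induction g using cs.simple_induction_left with
  | one => exact ⟨0, rfl⟩
  | mul_simple_left g s ih =>
    obtain ⟨i, rfl⟩ := ih
    exact ⟨_, (h2 s i).symm⟩

/-- The same action, by self-maps under composition. -/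
def a2End : Fin 2 → Function.End (Fin 6) := a2Act

theorem satisfiesBraid_a2End : SatisfiesBraid a2Coxeter a2End := by
  intro s t _
  funext i
  fin_cases s <;> fin_cases t <;> fin_cases i <;> rfl

/-- The greatest common left divisor with the Garside element. -/
def a2Gcd (x : ArtinMonoid a2Coxeter) : Fin 6 := artinLift a2End satisfiesBraid_a2End x 0

theorem a2Gcd_one : a2Gcd 1 = 0 := by rw [a2Gcd, map_one]; rfl

theorem a2Gcd_gen_mul (s : Fin 2) (x : ArtinMonoid a2Coxeter) :
    a2Gcd (artinGen a2Coxeter s * x) = a2Act s (a2Gcd x) := by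
  rw [a2Gcd, map_mul, artinLift_gen]; rfl

theorem a2Gcd_word_mul (l : List (Fin 2)) (x : ArtinMonoid a2Coxeter) :
    a2Gcd (artinWord a2Coxeter l * x) = l.foldr a2Act (a2Gcd x) := by
  induction l with
  | nil => rw [artinWord_nil, one_mul]; rfl
  | cons s l ih => rw [artinWord_cons, mul_assoc, a2Gcd_gen_mul, ih]; rfl

theorem artinWord_a2_braid : artinWord a2Coxeter [0, 1, 0] = artinWord a2Coxeter [1, 0, 1] :=
  artinAlt_braid (s := 0) (t := 1) a2Coxeter (by decide)

theorem artinWord_dvd_of_prefix {B : Type u} {M : CoxeterMatrix B} {l l' : List B} (h : l <+: l') :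
    artinWord M l ∣ artinWord M l' := by
  obtain ⟨t, rfl⟩ := h
  exact ⟨_, artinWord_append _ _ _⟩

theorem artinWord_a2Act_dvd (s : Fin 2) (i : Fin 6) :
    artinWord a2Coxeter (a2Word (a2Act s i)) ∣
      artinGen a2Coxeter s * artinWord a2Coxeter (a2Word i) := by
  rw [← artinWord_cons]
  -- Here and in `h2` the Garside element 010 is moved past a generator, exchanging 0 and 1.
  have h1 : artinWord a2Coxeter [0, 0, 1, 0] = artinWord a2Coxeter [0, 1, 0, 1] := by
    rw [artinWord_cons, artinWord_a2_braid, ← artinWord_cons]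
  have h2 : artinWord a2Coxeter [1, 0, 1, 0] = artinWord a2Coxeter [0, 1, 0, 0] := by
    rw [show ([1, 0, 1, 0] : List (Fin 2)) = [1, 0, 1] ++ [0] from rfl, artinWord_append,
      ← artinWord_a2_braid, ← artinWord_append]; rfl
  fin_cases s <;> fin_cases i <;> first
    | exact artinWord_dvd_of_prefix (by decide)
    | exact dvd_of_eq artinWord_a2_braid
    | exact (artinWord_dvd_of_prefix (l := [0, 1, 0]) (by decide)).trans (dvd_of_eq h1.symm)
    | exact (artinWord_dvd_of_prefix (l := [0, 1, 0]) (by decide)).trans (dvd_of_eq h2.symm)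

theorem artinWord_a2Gcd_dvd (x : ArtinMonoid a2Coxeter) :
    artinWord a2Coxeter (a2Word (a2Gcd x)) ∣ x := by
  obtain ⟨l, rfl⟩ := exists_artinWord _ x
  induction l with
  | nil => rw [artinWord_nil, a2Gcd_one]; exact dvd_refl _
  | cons s l ih =>
    rw [artinWord_cons, a2Gcd_gen_mul]
    exact (artinWord_a2Act_dvd s _).trans (mul_dvd_mul_left _ ih)

theorem artinGen_dvd_iff_a2Descent (s : Fin 2) (x : ArtinMonoid a2Coxeter) :
    artinGen a2Coxeter s ∣ x ↔ a2Descent s (a2Gcd x) := by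
  constructor
  · rintro ⟨y, rfl⟩
    rw [a2Gcd_gen_mul]
    generalize a2Gcd y = i
    revert s i
    decide
  · intro h
    refine dvd_trans ?_ (artinWord_a2Gcd_dvd x)
    generalize a2Gcd x = i at h
    have e : artinGen a2Coxeter s = artinWord a2Coxeter [s] := by
      rw [artinWord_cons, artinWord_nil, mul_one]
    rw [e]
    revert h
    fin_cases s <;> fin_cases i <;> first
      | exact fun h => absurd h (by decide)
      | exact fun _ => artinWord_dvd_of_prefix (by decide)
      | exact fun _ => (artinWord_dvd_of_prefix (l := [1]) (by decide)).trans
          (dvd_of_eq artinWord_a2_braid.symm)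

/-- The sets `Ω_K` in the decomposition of the Artin monoid of type `A₂` by `a2Gcd`. -/
def a2Omit : Fin 6 → Finset (Fin 2) := ![{0, 1}, {1}, {0}, {0}, {1}, ∅]

-- Whether w_i y has greatest common divisor w_i with the Garside element depends only on which
-- generators divide y; the forbidden ones are tabulated, and both directions are checks on six
-- states.
open Classical in
theorem a2Gcd_fiber (i : Fin 6) : {x | a2Gcd x = i} =
    mulOmega (artinWord a2Coxeter (a2Word i)) ((a2Omit i).image (artinGen a2Coxeter)) := by
  have avoid : ∀ i, ∀ s ∈ a2Omit i, ∀ j, (a2Word i).foldr a2Act (a2Act s j) ≠ i := by decide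
  have hit : ∀ i j, (∀ s ∈ a2Omit i, ¬ a2Descent s j) → (a2Word i).foldr a2Act j = i := by decide
  ext x
  constructor
  · intro hx
    have hx : a2Gcd x = i := hx
    obtain ⟨y, hy⟩ := artinWord_a2Gcd_dvd x
    rw [hx] at hy
    refine ⟨y, mem_omegaSet.mpr fun k hk hd => ?_, hy.symm⟩
    obtain ⟨s, hs, rfl⟩ := Finset.mem_image.mp hk
    obtain ⟨z, rfl⟩ := hd
    rw [hy, a2Gcd_word_mul, a2Gcd_gen_mul] at hx
    exact avoid i s hs _ hx
  · rintro ⟨y, hy, rfl⟩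
    have h : ∀ s ∈ a2Omit i, ¬ a2Descent s (a2Gcd y) := fun s hs hd =>
      mem_omegaSet.mp hy _ (Finset.mem_image_of_mem _ hs) ((artinGen_dvd_iff_a2Descent s y).mpr hd)
    change a2Gcd (_ * y) = i
    rw [a2Gcd_word_mul]
    exact hit i _ h

/-- The residual criterion applies to the sets defined by `a2Gcd`: its value at sx is determined by
s and its value at x, it decides divisibility by generators, and its fibres are basic sets. -/
theorem isSetAlgebra_a2Coxeter :
    MeasureTheory.IsSetAlgebra (omegaCollection (Set.range (artinGen a2Coxeter))) := by
  classical
  refine isSetAlgebra_of_residuals (artinMonoid_isGradedLCMMonoid _)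
    (one_notMem_range_artinGen _) (generatedBy_artinGen _)
    {V | ∃ S : Set (Fin 6), V = {x | a2Gcd x ∈ S}} (fun K hK => ?_) ?_ ?_ ?_
  · refine ⟨{i | ∀ s, artinGen a2Coxeter s ∈ K → ¬ a2Descent s i}, ?_⟩
    ext x
    rw [mem_omegaSet]
    constructor
    · exact fun h s hs hd => h _ hs ((artinGen_dvd_iff_a2Descent s x).mpr hd)
    · intro h k hk hd
      obtain ⟨s, rfl⟩ := hK hk
      exact h s hk ((artinGen_dvd_iff_a2Descent s x).mp hd)
  · rintro _ ⟨S, rfl⟩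
    have e : {x | a2Gcd x ∈ S} = ⋃ i : S, mulOmega (artinWord a2Coxeter (a2Word i))
        ((a2Omit i).image (artinGen a2Coxeter)) := by
      ext x
      simp [← a2Gcd_fiber]
    rw [e]
    refine omegaCollection_of_finite _ _ (fun i k hk => ?_) fun i j hij => ?_
    · obtain ⟨s, -, rfl⟩ := Finset.mem_image.mp (Finset.mem_coe.mp hk)
      exact ⟨s, rfl⟩
    · change Disjoint (mulOmega _ _) (mulOmega _ _)
      rw [← a2Gcd_fiber, ← a2Gcd_fiber]
      exact Set.disjoint_left.mpr fun x hi hj => hij (Subtype.ext (hi.symm.trans hj))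
  · rintro _ ⟨s, rfl⟩ _ ⟨S, rfl⟩
    refine ⟨{i | a2Act s i ∈ S}, ?_⟩
    ext x
    simp only [Set.mem_ofPred_eq, a2Gcd_gen_mul]
  · rintro _ ⟨s, rfl⟩ _ ⟨S, rfl⟩
    refine ⟨S \ {i | a2Descent s i}, ?_⟩
    ext x
    simp only [Set.mem_sdiff, Set.mem_ofPred_eq, artinGen_dvd_iff_a2Descent]

/-! ### The theorem -/

theorem reductionOfPositivity_freeGen {B₁ : Type u₁} {B₂ : Type u₂} (M₁ : CoxeterMatrix B₁)
    (M₂ : CoxeterMatrix B₂)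
    (h₁ : MeasureTheory.IsSetAlgebra (omegaCollection (Set.range (artinGen M₁))))
    (h₂ : MeasureTheory.IsSetAlgebra (omegaCollection (Set.range (artinGen M₂)))) :
    ReductionOfPositivity.{max u₁ u₂, v, w}
      (Monoid.Coprod (ArtinMonoid M₁) (ArtinMonoid M₂)) (Set.range (freeGen M₁ M₂)) :=
  reductionOfPositivity (isGradedLCMMonoid_free M₁ M₂) (generatedBy_freeGen M₁ M₂)
    (one_notMem_range_freeGen M₁ M₂) (isSetAlgebra_freeGen M₁ M₂ h₁ h₂)

theorem reductionOfPositivity_directGen {B₁ : Type u₁} {B₂ : Type u₂} (M₁ : CoxeterMatrix B₁)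
    (M₂ : CoxeterMatrix B₂)
    (h₁ : MeasureTheory.IsSetAlgebra (omegaCollection (Set.range (artinGen M₁))))
    (h₂ : MeasureTheory.IsSetAlgebra (omegaCollection (Set.range (artinGen M₂)))) :
    ReductionOfPositivity.{max u₁ u₂, v, w}
      (ArtinMonoid M₁ × ArtinMonoid M₂) (Set.range (directGen M₁ M₂)) :=
  reductionOfPositivity (isGradedLCMMonoid_direct M₁ M₂) (generatedBy_directGen M₁ M₂)
    (one_notMem_range_directGen M₁ M₂) (isSetAlgebra_directGen M₁ M₂ h₁ h₂)

theorem mainTheorem9 :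
    (∀ {B₁ : Type u₁} {B₂ : Type u₂} (M₁ : CoxeterMatrix B₁) (M₂ : CoxeterMatrix B₂),
      MeasureTheory.IsSetAlgebra (omegaCollection (Set.range (artinGen M₁))) →
      MeasureTheory.IsSetAlgebra (omegaCollection (Set.range (artinGen M₂))) →
      -- the free product
      (IsArtinPair (freeCoxeter M₁ M₂)
          (Monoid.Coprod.map (artinToGroup M₁) (artinToGroup M₂)) (freeGen M₁ M₂) ∧
        Set.range (freeGen M₁ M₂) = {p | Irreducible p} ∧
        MeasureTheory.IsSetAlgebra (omegaCollection (Set.range (freeGen M₁ M₂))) ∧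
        ReductionOfPositivity.{max u₁ u₂, v, w}
          (Monoid.Coprod (ArtinMonoid M₁) (ArtinMonoid M₂)) (Set.range (freeGen M₁ M₂))) ∧
      -- the direct product
      (IsArtinPair (directCoxeter M₁ M₂)
          (MonoidHom.prodMap (artinToGroup M₁) (artinToGroup M₂)) (directGen M₁ M₂) ∧
        Set.range (directGen M₁ M₂) = {p | Irreducible p} ∧
        MeasureTheory.IsSetAlgebra (omegaCollection (Set.range (directGen M₁ M₂))) ∧
        ReductionOfPositivity.{max u₁ u₂, v, w}
          (ArtinMonoid M₁ × ArtinMonoid M₂) (Set.range (directGen M₁ M₂)))) ∧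
    -- new examples
    (∃ (m n : ℕ) (M₁ : CoxeterMatrix (Fin m)) (M₂ : CoxeterMatrix (Fin n)),
      (IsRightAngled M₁ ∨ IsFiniteType M₁) ∧ (IsRightAngled M₂ ∨ IsFiniteType M₂) ∧
      MeasureTheory.IsSetAlgebra (omegaCollection (Set.range (artinGen M₁))) ∧
      MeasureTheory.IsSetAlgebra (omegaCollection (Set.range (artinGen M₂))) ∧
      (¬ IsRightAngled (freeCoxeter M₁ M₂) ∧ ¬ IsFiniteType (freeCoxeter M₁ M₂) ∧
        ReductionOfPositivity.{0, v, w}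
          (Monoid.Coprod (ArtinMonoid M₁) (ArtinMonoid M₂)) (Set.range (freeGen M₁ M₂))) ∧
      (¬ IsRightAngled (directCoxeter M₁ M₂) ∧ ¬ IsFiniteType (directCoxeter M₁ M₂) ∧
        ReductionOfPositivity.{0, v, w}
          (ArtinMonoid M₁ × ArtinMonoid M₂) (Set.range (directGen M₁ M₂)))) := by
  refine ⟨fun M₁ M₂ h₁ h₂ => ⟨⟨isArtinPair_free M₁ M₂, range_freeGen_eq_irreducible M₁ M₂,
    isSetAlgebra_freeGen M₁ M₂ h₁ h₂, reductionOfPositivity_freeGen M₁ M₂ h₁ h₂⟩,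
    isArtinPair_direct M₁ M₂, range_directGen_eq_irreducible M₁ M₂,
    isSetAlgebra_directGen M₁ M₂ h₁ h₂, reductionOfPositivity_directGen M₁ M₂ h₁ h₂⟩, ?_⟩
  -- Type A₂ is of finite type and the free monoid of rank two is right-angled. In both products the
  -- entry 3 excludes right-angled and the entry ∞ excludes finite type.
  let M₂ := edgeCoxeter 0 (by decide)
  have hM₂ : ∀ s t, s ≠ t → M₂ s t = 0 := fun s t h => edgeCoxeter_apply _ h
  have h₁ := isSetAlgebra_a2Coxeter
  have h₂ := isSetAlgebra_of_off_diagonal_eq_zero hM₂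
  refine ⟨2, 2, a2Coxeter, M₂, Or.inr isFiniteType_a2Coxeter,
    Or.inl fun s t h => Or.inr (hM₂ s t h), h₁, h₂,
    ⟨fun h => ?_, ?_, reductionOfPositivity_freeGen _ _ h₁ h₂⟩,
    ⟨fun h => ?_, ?_, reductionOfPositivity_directGen _ _ h₁ h₂⟩⟩
  · rcases h (Sum.inl 0) (Sum.inl 1) (by simp) with h | h <;>
      exact absurd (show (3 : ℕ) = _ from h) (by decide)
  · exact not_isFiniteType_of_eq_zero (s := Sum.inr 0) (t := Sum.inr 1) (by simp) rfl
  · rcases h (Sum.inl 0) (Sum.inl 1) (by simp) with h | h <;>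
      exact absurd (show (3 : ℕ) = _ from h) (by decide)
  · exact not_isFiniteType_of_eq_zero (s := Sum.inr 0) (t := Sum.inr 1) (by simp) rfl
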